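/- Proposition (limiting joint density of an eigenvalue and $|\mathbf v^T\mathbf v|^2$). Fix $0<\tau<1$. For $N\ge 2$ let $G_\tau=\sqrt{\tfrac{1+\tau}{2}}\,G_1+i\sqrt{\tfrac{1-\tau}{2}}\,G_2$, where $G_1,G_2$ are independent real $N\times N$ matrices with i.i.d. standard normal entries. Let $z_1,\dots,z_N$ be the (almost surely distinct) eigenvalues of $G_\tau$, and let $\mathbf v_1,\dots,\mathbf v_N$ be associated right eigenvectors with $\mathbf v_a^*\mathbf v_a=1$, each with a uniformly distributed phase of its first entry. Let $(z,\mathbf v)$ be distributed according to the mean normalized eigenpair measure $\frac1N\,\mathbb E\sum_{a=1}^N\delta_{(z_a,\mathbf v_a)}$, and set $$\tilde z=\frac{z}{\sqrt N},\qquad \tilde u=N\,|\mathbf v^T\mathbf v|^2 .$$ Then, for every $N\ge 2$, the pair $(\tilde z,\tilde u)$ has a joint probability density $\mathcal P^{(\tau)}_{(N)}(\tilde z,\tilde u)$ with respect to Lebesgue measure $d^2\tilde z\,d\tilde u$ which is supported on $\mathbb C\times[0,N]$ and has a (unique) version continuous on $\mathbb C\times[0,N)$, and for this version, for every $\tilde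 z\in\mathbb C$ with $|\tilde z|<1$ and every $\tilde u\ge 0$, $$\lim_{N\to\infty}\mathcal P^{(\tau)}_{(N)}(\tilde z,\tilde u)=\frac{a_\tau(\tilde z)}{2\pi}\,e^{-\frac12 a_\tau(\tilde z)\,\tilde u},\qquad a_\tau(\tilde z)=1-2\tau\,\mathrm{Re}(\tilde z^2)+\tau^2\left(2|\tilde z|^2-1\right).$$ -/

import Mathlib

open MeasureTheory ProbabilityTheory Filter Topology
open scoped Matrix ENNReal

noncomputable section

namespace InterpolatingGinibre

/-- Law of an array of `N × N` independent standard real normal variables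
(the entries of a real Ginibre matrix). -/
def realGinibre (N : ℕ) : Measure (Fin N × Fin N → ℝ) :=
  Measure.pi fun _ => gaussianReal 0 1

/-- The matrix `√((1 + τ) / 2) A + i √((1 - τ) / 2) B`; it belongs to the interpolating Ginibre
ensemble when `A` and `B` are independent real Ginibre matrices. -/
def interpolatingMatrix (N : ℕ) (τ : ℝ) (A B : Fin N × Fin N → ℝ) : Matrix (Fin N) (Fin N) ℂ :=
  Matrix.of fun j k =>
    ((√((1 + τ) / 2) * A (j, k) : ℝ) : ℂ) + Complex.I * ((√((1 - τ) / 2) * B (j, k) : ℝ) : ℂ)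

/-- `v` is a right eigenvector of `X` at `z`, normalized by `v* v = 1`, whose first entry is a
nonnegative real number (phase `0`). -/
def IsNormalizedEigenvector {N : ℕ} (X : Matrix (Fin N) (Fin N) ℂ) (z : ℂ) (v : Fin N → ℂ) : Prop :=
  X *ᵥ v = z • v ∧ star v ⬝ᵥ v = 1 ∧ ∀ i : Fin N, (i : ℕ) = 0 → v i = ((‖v i‖ : ℝ) : ℂ)

/-- A normalized right eigenvector of `X` at the eigenvalue `z` (such a vector exists for every
eigenvalue; if the eigenvalue is simple, it is unique unless its first entry vanishes, and then it
is unique up to a phase). -/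
def eigenvector {N : ℕ} (X : Matrix (Fin N) (Fin N) ℂ) (z : ℂ) : Fin N → ℂ :=
  Classical.epsilon (IsNormalizedEigenvector X z)

/-- The uniform probability measure on `[0, 2π)`. -/
def uniformPhase : Measure ℝ :=
  (ENNReal.ofReal (2 * Real.pi))⁻¹ • volume.restrict (Set.Ico 0 (2 * Real.pi))

/-- Joint empirical measure of the eigenvalues of `X` (with multiplicity) and their normalized right
eigenvectors, averaged over the phase `θ` of the first entry:
`∑ₐ ∫ δ_{(zₐ, exp(i θ) vₐ)} dθ / (2π)`. -/
def empiricalEigenpairs {N : ℕ} (X : Matrix (Fin N) (Fin N) ℂ) : Measure (ℂ × (Fin N → ℂ)) :=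
  (X.charpoly.roots.map fun z =>
    uniformPhase.map fun θ : ℝ => (z, Complex.exp (Complex.I * θ) • eigenvector X z)).sum

/-- Joint probability distribution of an eigenvalue and the associated normalized right eigenvector
for the interpolating Ginibre ensemble: `1 / N` times the expectation of the joint empirical
measure. -/
def eigenpairLaw (N : ℕ) (τ : ℝ) : Measure (ℂ × (Fin N → ℂ)) :=
  (N : ℝ≥0∞)⁻¹ • ((realGinibre N).prod (realGinibre N)).bind fun AB =>
    empiricalEigenpairs (interpolatingMatrix N τ AB.1 AB.2)

/-- Joint distribution of the scaled eigenvalue `z / √N` and of `N |vᵀ v|²`. -/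
def scaledLaw (N : ℕ) (τ : ℝ) : Measure (ℂ × ℝ) :=
  (eigenpairLaw N τ).map fun p => (p.1 / ((√(N : ℝ) : ℝ) : ℂ), (N : ℝ) * ‖p.2 ⬝ᵥ p.2‖ ^ 2)

/-- `p` is the continuous version on `ℂ × [0, N)` of the joint probability density of
`(z / √N, N |vᵀ v|²)` with respect to Lebesgue measure. Such a `p` is unique on `ℂ × [0, N)`. -/
def IsScaledJPD (N : ℕ) (τ : ℝ) (p : ℂ × ℝ → ℝ) : Prop :=
  ContinuousOn p (Set.univ ×ˢ Set.Ico 0 (N : ℝ)) ∧ (∀ x, 0 ≤ p x) ∧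
    scaledLaw N τ = (volume.restrict (Set.univ ×ˢ Set.Ico 0 (N : ℝ))).withDensity
      fun x => ENNReal.ofReal (p x)

/-- `a_τ(z) = 1 - 2 τ Re(z²) + τ² (2 |z|² - 1)`. -/
def aCoeff (τ : ℝ) (z : ℂ) : ℝ :=
  1 - 2 * τ * (z ^ 2).re + τ ^ 2 * (2 * ‖z‖ ^ 2 - 1)

end InterpolatingGinibre

end

open MeasureTheory ProbabilityTheory Filter Topology
open scoped Matrix ENNReal

noncomputable section

namespace InterpolatingGinibre

/-! ### Permutation sums: the second moment of a determinant with independent rows -/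

section Determinant

variable {ι : Type*} [Fintype ι] [DecidableEq ι]

/-! Write N = n + 1 and describe a matrix X by an eigenvalue z, an eigenvector v = (1, w) and the
columns R other than the first; the first column is then forced. This is `chartMap`. Over almost
every X its fibre is the set of eigenpairs of X: eigenvectors with vanishing first entry occur only
on a null set (`ae_no_eigenvector_tail`), and matrices with a critical point in the fibre form a
null set by Sard's lemma, which excludes multiple eigenvalues. The area formula with multiplicity
(`measurable_tsum_fiber_and_lintegral`) therefore turns the expected sum over eigenpairs into an
integral over (z, w, R) of the matrix density times the squared modulus of a complex Jacobian
determinant (`eigenpairLaw_apply`).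

For fixed (z, w) the integral over R is an average over independent rows, row i being conditioned on
r·v = z v_i. A conditioned row is its conditional mean plus a centred residual whose law does not
depend on z (`rowDensity_mul_lintegral`). What is needed is the second moment of the determinant of
a matrix with independent rows, mean A and common row covariance C. It equals ∫₀^∞ exp(-t) det(t C +
A* A) dt, the integral being replaced by the functional t^k ↦ k!
(`sum_perm_perm_eq_factorialFunctional`, `integral_norm_det_sq`). Here t C + A* A is a perturbation
of (t + |z|²) times the identity by the span of v and its conjugate, so its determinant is explicit
(`det_rowCov_add`), and v enters only through q = |vᵀv|² / |v|⁴.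

It remains to find the law of q under the invariant measure |v|^(-2(n+1)) dw of projective space.
Gaussian integrals of powers of |v|⁴ - |vᵀv|² give the moments of 1 - q, proportional to n / (n +
2k); since moments determine measures on [0, 1], q has density proportional to (1 - q)^(n/2 - 1)
(`lintegral_overlapRatio`). This yields the closed form `scaledDensity`, continuous for 0 ≤ u < N.

For the limit, the truncated exponential series coming from the determinant is the probability that
a Poisson variable of mean N|z|² is below n, which tends to 1 when |z| < 1 (`tendsto_poissonHead`).
The other factors converge elementarily: the exponents add up to -a u / 2, and the prefactor (1 -
τ²)(1 - |z|²) + |z - τ z̄|² is again a. -/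

/-- The number of permutations extending an injective partial map. -/
theorem card_perm_extending (s : Finset ι) (r : ι → ι) (hr : Set.InjOn r (sᶜ : Finset ι)) :
    (Finset.univ.filter fun π : Equiv.Perm ι => ∀ i, i ∉ s → π i = r i).card
      = s.card.factorial := by
  obtain ⟨g, hg⟩ := Finset.exists_equiv_extend_of_card_eq (α := ι) (β := ι) (t := Finset.univ)
    (by simp) (s := sᶜ) (f := r) (by simp) hr
  let π₀ : Equiv.Perm ι := g.trans (Equiv.subtypeUnivEquiv (by simp))
  have hπ₀ : ∀ i, i ∉ s → π₀ i = r i := fun i hi => hg i (by simpa using hi)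
  -- Left multiplication by `π₀⁻¹` turns the extensions of `r` into the permutations fixing every
  -- point off `s`.
  have e : {π : Equiv.Perm ι // ∀ i, i ∉ s → π i = r i} ≃
      {f : Equiv.Perm ι // ∀ a, ¬ a ∈ s → f a = a} :=
    { toFun := fun π => ⟨π₀⁻¹ * π.1, fun a ha => by
        simp [π.2 a ha, ← hπ₀ a ha]⟩
      invFun := fun f => ⟨π₀ * f.1, fun i hi => by simp [f.2 i hi, hπ₀ i hi]⟩
      left_inv := fun π => by simp
      right_inv := fun π => by simp }
  have h1 := Fintype.card_congr (e.trans (Equiv.Perm.subtypeEquivSubtypePerm (· ∈ s)).symm)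
  rw [Fintype.card_subtype] at h1
  rw [h1, Fintype.card_perm, Fintype.card_coe]

variable {K : Type*} [CommRing K]

/-- Expanding the rows off `s` on the right multilinearly gives a sum over partial maps `r`. A
non-injective `r` produces proportional rows and contributes nothing; an injective one is the
restriction of exactly `s.card !` permutations, each giving the same determinant on the left. -/
theorem sum_perm_det_piecewise (A B C : Matrix ι ι K) (s : Finset ι) :
    ∑ π : Equiv.Perm ι, Matrix.det (Matrix.of (s.piecewise C fun j => B (π j) j • A (π j)))
      = (s.card.factorial : K) * Matrix.det (Matrix.of (s.piecewise C (Bᵀ * A))) := by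
  let g : ι → ι → ι → K := fun i j => if i ∈ s then C i else B j i • A j
  let h : (ι → ι) → K := fun r => Matrix.detRowAlternating fun i => g i (r i)
  let S : ι → Finset ι := fun i => if i ∈ s then {i} else Finset.univ
  have hR : Matrix.det (Matrix.of (s.piecewise C (Bᵀ * A)))
      = ∑ r ∈ Fintype.piFinset S, h r := by
    have := (Matrix.detRowAlternating (n := ι) (R := K)).toMultilinearMap.map_sum_finset g S
    refine Eq.trans ?_ this
    change Matrix.det _ = Matrix.det _
    congr 1
    ext i k
    by_cases hi : i ∈ s
    · simp [hi, g, S, Finset.piecewise]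
    · simp [hi, g, S, Matrix.mul_apply, Finset.piecewise]
  have hL : ∀ π : Equiv.Perm ι,
      Matrix.det (Matrix.of (s.piecewise C fun j => B (π j) j • A (π j)))
        = h (fun i => if i ∈ s then i else π i) := by
    intro π
    change _ = Matrix.det _
    congr 1
    ext i k
    by_cases hi : i ∈ s <;> simp [hi, g, Finset.piecewise]
  have hzero : ∀ r : ι → ι, ¬ Set.InjOn r (sᶜ : Finset ι) → h r = 0 := by
    intro r hr
    have hr' : ∃ i j, i ∉ s ∧ j ∉ s ∧ r i = r j ∧ i ≠ j := by
      by_contra hcon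
      push Not at hcon
      exact hr fun i hi j hj hij => hcon i j (by simpa using hi) (by simpa using hj) hij
    obtain ⟨i, j, hi, hj, hij, hne⟩ := hr'
    have h1 : h r = Matrix.det (Matrix.of fun k l => (if k ∈ s then 1 else B (r k) k) *
        (Matrix.of (fun k => if k ∈ s then C k else A (r k))) k l) := by
      change Matrix.det _ = _
      congr 1
      ext k l
      by_cases hk : k ∈ s <;> simp [hk, g]
    rw [h1, Matrix.det_mul_column, Matrix.det_zero_of_row_eq hne, mul_zero]
    ext l
    simp [hi, hj, hij]
  rw [hR, Finset.sum_congr rfl fun π _ => hL π, Finset.mul_sum,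
    ← Finset.sum_fiberwise_of_maps_to (s := Finset.univ) (t := Fintype.piFinset S)
      (g := fun (π : Equiv.Perm ι) i => if i ∈ s then i else π i)
      (by intro π _; rw [Fintype.mem_piFinset]; intro i; by_cases hi : i ∈ s <;> simp [hi, S])]
  refine Finset.sum_congr rfl fun r hr => ?_
  rw [Finset.sum_congr rfl (g := fun _ => h r)
    (by intro π hπ; rw [(Finset.mem_filter.1 hπ).2]), Finset.sum_const, nsmul_eq_mul]
  by_cases hinj : Set.InjOn r (sᶜ : Finset ι)
  · rw [← card_perm_extending s r hinj]
    congr 3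
    ext π
    rw [Fintype.mem_piFinset] at hr
    simp only [Finset.mem_filter, Finset.mem_univ, true_and]
    constructor
    · intro hπ i hi
      have := congrFun hπ i
      simpa [hi] using this
    · intro hπ
      funext i
      by_cases hi : i ∈ s
      · have := hr i
        simp only [S, hi, if_true, Finset.mem_singleton] at this
        simp [hi, this]
      · simp [hi, hπ i hi]
  · rw [hzero r hinj, mul_zero, mul_zero]

/-- The linear functional on polynomials sending `X ^ k` to `k!`. -/
def factorialFunctional : Polynomial K →ₗ[K] K :=
  Polynomial.lsum fun k => (k.factorial : K) • LinearMap.id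

theorem factorialFunctional_C_mul_X_pow (a : K) (k : ℕ) :
    factorialFunctional (Polynomial.C a * Polynomial.X ^ k) = k.factorial * a := by
  rw [Polynomial.C_mul_X_pow_eq_monomial]
  simp [factorialFunctional, Polynomial.lsum_apply, Polynomial.sum_monomial_index]

theorem det_smul_add_eq_sum (C D : Matrix ι ι K) (t : K) :
    (t • C + D).det = ∑ s : Finset ι, t ^ s.card * Matrix.det (Matrix.of (s.piecewise C D)) := by
  have h := (Matrix.detRowAlternating (n := ι) (R := K)).toMultilinearMap.map_add_univ
    (fun i => t • C i) D
  refine Eq.trans h (Finset.sum_congr rfl fun s _ => ?_)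
  have h2 := (Matrix.detRowAlternating (n := ι) (R := K)).toMultilinearMap.map_piecewise_smul
    (fun _ => t) (s.piecewise C D) s
  rw [Finset.prod_const] at h2
  refine Eq.trans ?_ h2
  congr 1
  ext i k
  by_cases hi : i ∈ s <;> simp [hi, Finset.piecewise]

/-- The second moment of the determinant of a matrix with independent rows, as a function of the
means and the common covariance of its rows. -/
theorem sum_perm_perm_eq_factorialFunctional (A B C : Matrix ι ι K) (P : Polynomial K)
    (hP : ∀ t : K, (t • C + Bᵀ * A).det = P.eval t) [IsDomain K] [Infinite K] :
    ∑ σ : Equiv.Perm ι, ∑ π : Equiv.Perm ι,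
      ((Equiv.Perm.sign σ : ℤ) : K) * ((Equiv.Perm.sign π : ℤ) : K) *
        ∏ i, (A i (σ i) * B i (π i) + C (π i) (σ i)) = factorialFunctional P := by
  have hP' : P = ∑ s : Finset ι,
      Polynomial.C (Matrix.det (Matrix.of (s.piecewise C (Bᵀ * A)))) * Polynomial.X ^ s.card := by
    apply Polynomial.funext
    intro t
    rw [← hP t, det_smul_add_eq_sum, Polynomial.eval_finsetSum]
    refine Finset.sum_congr rfl fun s _ => ?_
    rw [Polynomial.eval_mul, Polynomial.eval_C, Polynomial.eval_pow, Polynomial.eval_X, mul_comm]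
  rw [hP', map_sum, Finset.sum_congr rfl fun s _ => (factorialFunctional_C_mul_X_pow _ _).trans
    (sum_perm_det_piecewise A B C s).symm, Finset.sum_comm]
  conv_rhs => rw [Finset.sum_comm, ← Equiv.sum_comp (Equiv.inv (Equiv.Perm ι))]
  refine Finset.sum_congr rfl fun π _ => ?_
  have h := det_smul_add_eq_sum C (Matrix.of fun j => B (π⁻¹ j) j • A (π⁻¹ j)) 1
  simp only [one_pow, one_mul, one_smul] at h
  refine Eq.trans ?_ h
  -- Substituting `σ = τ * π` cancels the sign of `π`, so that the sum over `τ` is the Leibniz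
  -- expansion of a single determinant.
  rw [← Matrix.det_transpose, Matrix.det_apply', ← Equiv.sum_comp (Equiv.mulRight π)]
  refine Finset.sum_congr rfl fun τ _ => ?_
  simp only [Equiv.coe_mulRight, Equiv.Perm.sign_mul]
  have h1 : (((Equiv.Perm.sign τ * Equiv.Perm.sign π : ℤˣ) : ℤ) : K)
      * ((Equiv.Perm.sign π : ℤ) : K) = ((Equiv.Perm.sign τ : ℤ) : K) := by
    push_cast
    rw [mul_assoc, ← Int.cast_mul, ← Units.val_mul, Int.units_mul_self]
    simp
  rw [h1]
  congr 1
  conv_rhs => rw [← Equiv.prod_comp π]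
  refine Finset.prod_congr rfl fun i _ => ?_
  simp [Matrix.transpose_apply, add_comm, mul_comm]

end Determinant

/-! ### Area formula with multiplicity, and Sard's lemma -/

section Area

variable {E : Type*} [NormedAddCommGroup E] [NormedSpace ℝ E] [FiniteDimensional ℝ E]
  [MeasurableSpace E] [BorelSpace E] {f : E → E} {f' : E → E →L[ℝ] E}

/-- The inverse function theorem gives injectivity near each regular point; second countability
extracts a countable cover, which is then made disjoint. -/
theorem exists_measurable_partition_injOn (hf : ∀ x, HasStrictFDerivAt f (f' x) x)
    (hf' : Continuous f') :
    ∃ A : ℕ → Set E, (∀ k, MeasurableSet (A k)) ∧ Pairwise (Function.onFun Disjoint A) ∧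
      (⋃ k, A k) = {x | (f' x).det ≠ 0} ∧ ∀ k, Set.InjOn f (A k) := by
  set U : Set E := {x | (f' x).det ≠ 0} with hU
  have hUo : IsOpen U := by
    have : Continuous fun x => (f' x).det := ContinuousLinearMap.continuous_det.comp hf'
    exact isOpen_ne_fun this continuous_const
  have hloc : ∀ x ∈ U, ∃ V : Set E, IsOpen V ∧ x ∈ V ∧ Set.InjOn f V := by
    intro x hx
    have h : HasStrictFDerivAt f
        (((f' x).toContinuousLinearEquivOfDetNeZero hx : E ≃L[ℝ] E) : E →L[ℝ] E) x := hf x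
    refine ⟨(h.toOpenPartialHomeomorph f).source, (h.toOpenPartialHomeomorph f).open_source,
      h.mem_toOpenPartialHomeomorph_source, ?_⟩
    have := (h.toOpenPartialHomeomorph f).injOn
    simpa using this
  choose! V hVo hxV hVi using hloc
  obtain ⟨t, htU, htc, hcov⟩ := TopologicalSpace.countable_cover_nhdsWithin (s := U) (f := V)
    fun x hx => mem_nhdsWithin_of_mem_nhds ((hVo x hx).mem_nhds (hxV x hx))
  have hex : ∃ B : ℕ → Set E, (∀ k, MeasurableSet (B k)) ∧ U ⊆ ⋃ k, B k ∧
      ∀ k, Set.InjOn f (B k) := by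
    rcases t.eq_empty_or_nonempty with rfl | hne
    · refine ⟨fun _ => ∅, by simp, by simpa using hcov, by simp⟩
    · obtain ⟨e, rfl⟩ := htc.exists_eq_range hne
      refine ⟨fun k => V (e k), fun k => (hVo _ (htU ⟨k, rfl⟩)).measurableSet, by simpa using hcov,
        fun k => hVi _ (htU ⟨k, rfl⟩)⟩
  obtain ⟨B, hBm, hBc, hBi⟩ := hex
  refine ⟨disjointed fun k => B k ∩ U, fun k => ?_, disjoint_disjointed _, ?_, fun k => ?_⟩
  · exact MeasurableSet.disjointed (fun k => (hBm k).inter hUo.measurableSet) k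
  · rw [iUnion_disjointed, ← Set.iUnion_inter, Set.inter_eq_right.2 hBc]
  · exact (hBi k).mono ((disjointed_subset _ k).trans Set.inter_subset_left)

/-- Area formula: the sum over the regular points of a fibre. -/
theorem measurable_tsum_fiber_and_lintegral (μ : Measure E) [μ.IsAddHaarMeasure]
    (hf : ∀ x, HasStrictFDerivAt f (f' x) x) (hf' : Continuous f')
    {g : E → ℝ≥0∞} (hg : Measurable g) :
    Measurable (fun y => ∑' x : {x // f x = y ∧ (f' x).det ≠ 0}, g x) ∧
    ∫⁻ y, ∑' x : {x // f x = y ∧ (f' x).det ≠ 0}, g x ∂μ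
      = ∫⁻ x, ENNReal.ofReal |(f' x).det| * g x ∂μ := by
  obtain ⟨A, hAm, hAd, hAU, hAi⟩ := exists_measurable_partition_injOn hf hf'
  have hder : ∀ k, ∀ x ∈ A k, HasFDerivWithinAt f (f' x) (A k) x := fun k x _ =>
    (hf x).hasFDerivAt.hasFDerivWithinAt
  have hemb : ∀ k, MeasurableEmbedding ((A k).domRestrict f) := fun k =>
    measurableEmbedding_of_fderivWithin (hAm k) (hder k) (hAi k)
  let h : ℕ → E → ℝ≥0∞ := fun k =>
    Function.extend ((A k).domRestrict f) (fun x => g x) fun _ => 0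
  have hh : ∀ k, Measurable (h k) := fun k =>
    (hemb k).measurable_extend (hg.comp measurable_subtype_coe) measurable_const
  have hmem : ∀ k, ∀ x ∈ A k, h k (f x) = g x := fun k x hx =>
    (hemb k).injective.extend_apply (fun x : A k => g x) (fun _ => 0) ⟨x, hx⟩
  have hnmem : ∀ k, ∀ y, y ∉ f '' A k → h k y = 0 := by
    intro k y hy
    refine Function.extend_apply' _ _ _ ?_
    rintro ⟨x, hx⟩
    exact hy ⟨x, x.2, hx⟩
  -- Each piece `A k` meets a fibre at most once, so the fibre sum is the sum over `k` of `g`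
  -- transported along `f` from `A k`.
  have key : (fun y => ∑' x : {x // f x = y ∧ (f' x).det ≠ 0}, g x) = fun y => ∑' k, h k y := by
    funext y
    have h1 : ∀ k, h k y
        = ∑' x : {x // f x = y ∧ (f' x).det ≠ 0}, (A k).indicator g x := by
      intro k
      by_cases hy : y ∈ f '' A k
      · obtain ⟨x, hx, rfl⟩ := hy
        have hxU : (f' x).det ≠ 0 := by
          have : x ∈ ⋃ k, A k := Set.mem_iUnion.2 ⟨k, hx⟩
          rw [hAU] at this
          exact this
        rw [hmem k x hx, tsum_eq_single ⟨x, rfl, hxU⟩]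
        · simp [hx]
        · rintro ⟨x', hx', _⟩ hne
          refine Set.indicator_of_notMem (fun hx'A => hne ?_) _
          exact Subtype.ext (hAi k hx'A hx hx')
      · rw [hnmem k y hy]
        symm
        refine ENNReal.tsum_eq_zero.2 fun x => Set.indicator_of_notMem (fun hx => hy ?_) _
        exact ⟨x, hx, x.2.1⟩
    simp_rw [h1]
    rw [ENNReal.tsum_comm]
    refine tsum_congr fun x => ?_
    have hx : (x : E) ∈ ⋃ k, A k := by rw [hAU]; exact x.2.2
    obtain ⟨k, hk⟩ := Set.mem_iUnion.1 hx
    rw [tsum_eq_single k]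
    · simp [hk]
    · intro j hj
      exact Set.indicator_of_notMem (fun hxj => (Set.disjoint_left.1 (hAd hj) hxj) hk) _
  rw [key]
  refine ⟨Measurable.tsum hh, ?_⟩
  have hUm : MeasurableSet (⋃ k, A k) := MeasurableSet.iUnion hAm
  rw [lintegral_tsum fun k => (hh k).aemeasurable]
  have hR : ∫⁻ x, ENNReal.ofReal |(f' x).det| * g x ∂μ
      = ∫⁻ x in ⋃ k, A k, ENNReal.ofReal |(f' x).det| * g x ∂μ := by
    rw [← lintegral_indicator hUm]
    refine lintegral_congr fun x => ?_
    by_cases hx : x ∈ ⋃ k, A k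
    · rw [Set.indicator_of_mem hx]
    · rw [Set.indicator_of_notMem hx]
      rw [hAU] at hx
      simp only [Set.mem_ofPred_eq, not_not] at hx
      simp [hx]
  rw [hR, lintegral_iUnion hAm hAd]
  refine tsum_congr fun k => ?_
  have h2 : ∫⁻ y, h k y ∂μ = ∫⁻ y in f '' A k, h k y ∂μ := by
    rw [← lintegral_indicator (measurable_image_of_fderivWithin (hAm k) (hder k) (hAi k))]
    refine lintegral_congr fun y => ?_
    by_cases hy : y ∈ f '' A k
    · rw [Set.indicator_of_mem hy]
    · rw [Set.indicator_of_notMem hy, hnmem k y hy]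
  rw [h2, lintegral_image_eq_lintegral_abs_det_fderiv_mul μ (hAm k) (hder k) (hAi k)]
  exact setLIntegral_congr_fun (hAm k) fun x hx => by simp only [hmem k x hx]

/-- Sard's lemma: almost every fibre consists of regular points. -/
theorem ae_forall_fiber_det_ne_zero (μ : Measure E) [μ.IsAddHaarMeasure]
    (hf : ∀ x, HasStrictFDerivAt f (f' x) x) :
    ∀ᵐ y ∂μ, ∀ x, f x = y → (f' x).det ≠ 0 := by
  have h := addHaar_image_eq_zero_of_det_fderivWithin_eq_zero μ (s := {x | (f' x).det = 0})
    (fun x _ => (hf x).hasFDerivAt.hasFDerivWithinAt) (fun x hx => hx)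
  refine measure_mono_null (fun y hy => ?_) h
  simp only [Set.mem_compl_iff, Set.mem_ofPred_eq, not_forall, not_not] at hy
  obtain ⟨x, hx, hd⟩ := hy
  exact ⟨x, hd, hx⟩

end Area

/-! ### The eigenpair chart and its Jacobian -/

section Chart

variable {n : ℕ}

/-- A matrix of size `n + 1`, given by its first column and the remaining columns. -/
abbrev SplitMatrix (n : ℕ) : Type := (Fin (n + 1) → ℂ) × (Fin (n + 1) → Fin n → ℂ)

/-- The vector with first entry `1` and the other entries those of `p`. -/
def chartVec (p : Fin (n + 1) → ℂ) : Fin (n + 1) → ℂ := Fin.cons 1 (Fin.tail p)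

@[simp] theorem chartVec_zero (p : Fin (n + 1) → ℂ) : chartVec p 0 = 1 := rfl

@[simp] theorem chartVec_succ (p : Fin (n + 1) → ℂ) (j : Fin n) :
    chartVec p j.succ = p j.succ := rfl

/-- The matrix with the given first column and remaining columns. -/
def joinColumns (Y : SplitMatrix n) : Matrix (Fin (n + 1)) (Fin (n + 1)) ℂ :=
  Matrix.of fun i => Fin.cons (Y.1 i) (Y.2 i)

@[simp] theorem joinColumns_zero (Y : SplitMatrix n) (i : Fin (n + 1)) :
    joinColumns Y i 0 = Y.1 i := rfl

@[simp] theorem joinColumns_succ (Y : SplitMatrix n) (i : Fin (n + 1)) (j : Fin n) :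
    joinColumns Y i j.succ = Y.2 i j := rfl

/-- The matrix with eigenvalue `P.1 0`, right eigenvector `chartVec P.1`, and columns `P.2` except
for the first one. -/
def chartMap (P : SplitMatrix n) : SplitMatrix n :=
  (fun i => P.1 0 * chartVec P.1 i - ∑ j, P.2 i j * P.1 j.succ, P.2)

/-- The complex Jacobian matrix of `chartMap` in the first variable. -/
def chartJacobian (P : SplitMatrix n) : Matrix (Fin (n + 1)) (Fin (n + 1)) ℂ :=
  Matrix.of fun i => Fin.cons (chartVec P.1 i) fun j =>
    (if i = j.succ then P.1 0 else 0) - P.2 i j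

/-- Since `chartVec P.1 0 = 1`, each row of the eigenvector equation can be solved for the entry of
the first column, and `chartMap` is that solution. -/
theorem chartMap_eq_iff (P Y : SplitMatrix n) :
    chartMap P = Y ↔ P.2 = Y.2 ∧ joinColumns Y *ᵥ chartVec P.1 = P.1 0 • chartVec P.1 := by
  rw [Prod.ext_iff, and_comm]
  refine and_congr_right fun h => ?_
  rw [funext_iff, funext_iff]
  refine forall_congr' fun i => ?_
  have h2 : (joinColumns Y *ᵥ chartVec P.1) i = Y.1 i + ∑ j, P.2 i j * P.1 j.succ := by
    have h' : P.2 = Y.2 := h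
    rw [Matrix.mulVec, dotProduct, Fin.sum_univ_succ]
    simp [h']
  rw [h2]
  simp only [chartMap, Pi.smul_apply, smul_eq_mul]
  rw [sub_eq_iff_eq_add, eq_comm]

/-- The shear `(h, k) ↦ (h + B k, k)` has determinant one. -/
theorem det_shear {V W : Type*} [AddCommGroup V] [Module ℂ V] [FiniteDimensional ℂ V]
    [AddCommGroup W] [Module ℂ W] [FiniteDimensional ℂ W] (B : W →ₗ[ℂ] V) :
    LinearMap.det ((LinearMap.fst ℂ V W + B ∘ₗ LinearMap.snd ℂ V W).prod (LinearMap.snd ℂ V W))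
      = 1 := by
  set S : (W →ₗ[ℂ] V) → ((V × W) →ₗ[ℂ] (V × W)) := fun B =>
    (LinearMap.fst ℂ V W + B ∘ₗ LinearMap.snd ℂ V W).prod (LinearMap.snd ℂ V W) with hS
  have hadd : ∀ B C, S B ∘ₗ S C = S (B + C) := by
    intro B C
    ext x <;> simp [hS, add_comm]
  have hzero : S 0 = LinearMap.id := by
    ext x <;> simp [hS]
  -- The dilation `D` conjugates `S B` into `S (B + B)`, whose determinant is the square of that of
  -- `S B`; a nonzero number equal to its square is one.
  let D : (V × W) →ₗ[ℂ] (V × W) := LinearMap.prodMap ((2 : ℂ) • LinearMap.id) LinearMap.id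
  have hD : D ∘ₗ S B = S (B + B) ∘ₗ D := by
    ext x <;> simp [hS, D, two_smul]
  have hDdet : LinearMap.det D ≠ 0 := by
    simp only [D]
    rw [LinearMap.det_prodMap, LinearMap.det_smul]
    simp
  have h1 : LinearMap.det (S B) = LinearMap.det (S B) * LinearMap.det (S B) := by
    have := congrArg LinearMap.det hD
    rw [LinearMap.det_comp, LinearMap.det_comp, mul_comm, ← hadd, LinearMap.det_comp] at this
    exact mul_right_cancel₀ hDdet this
  have h2 : LinearMap.det (S B) * LinearMap.det (S (-B)) = 1 := by
    rw [← LinearMap.det_comp, hadd, add_neg_cancel, hzero, LinearMap.det_id]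
  have h3 : LinearMap.det (S B) ≠ 0 := left_ne_zero_of_mul_eq_one h2
  exact (mul_left_cancel₀ h3 (by rw [mul_one]; exact h1)).symm

/-- The coupling of the remaining columns to the first one in the derivative of `chartMap`. -/
def chartCoupling (P : SplitMatrix n) : (Fin (n + 1) → Fin n → ℂ) →ₗ[ℂ] (Fin (n + 1) → ℂ) where
  toFun k := fun i => -∑ j, k i j * P.1 j.succ
  map_add' k l := by
    funext i
    simp [add_mul, Finset.sum_add_distrib, add_comm]
  map_smul' c k := by
    funext i
    simp [Finset.mul_sum, mul_assoc]

/-- The complex derivative of `chartMap`. -/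
def chartDerivLinear (P : SplitMatrix n) : SplitMatrix n →ₗ[ℂ] SplitMatrix n :=
  ((LinearMap.fst ℂ _ _ + chartCoupling P ∘ₗ LinearMap.snd ℂ _ _).prod (LinearMap.snd ℂ _ _)) ∘ₗ
    LinearMap.prodMap (Matrix.toLin' (chartJacobian P)) LinearMap.id

theorem det_chartDerivLinear (P : SplitMatrix n) :
    LinearMap.det (chartDerivLinear P) = (chartJacobian P).det := by
  rw [chartDerivLinear, LinearMap.det_comp, det_shear, LinearMap.det_prodMap,
    LinearMap.det_toLin', LinearMap.det_id]
  simp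

theorem contDiff_chartMap : ContDiff ℂ 1 (chartMap (n := n)) := by
  have h : ∀ i : Fin (n + 1), ContDiff ℂ 1 fun P : SplitMatrix n => chartVec P.1 i := by
    intro i
    refine Fin.cases ?_ (fun j => ?_) i
    · simp only [chartVec_zero]; fun_prop
    · simp only [chartVec_succ]; fun_prop
  unfold chartMap
  refine ContDiff.prodMk (contDiff_pi.2 fun i => ?_) contDiff_snd
  have := h i
  fun_prop

/-- Differentiability is already known, so the derivative can be read off along each line `P + t •
H`. -/
theorem fderiv_chartMap_apply (P : SplitMatrix n) (H : SplitMatrix n) :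
    fderiv ℂ chartMap P H = chartDerivLinear P H := by
  have hd : HasFDerivAt (chartMap (n := n)) (fderiv ℂ chartMap P) P :=
    (contDiff_chartMap.differentiable one_ne_zero P).hasFDerivAt
  have hline : HasDerivAt (fun t : ℂ => P + t • H) H 0 := by
    simpa using ((hasDerivAt_id (0 : ℂ)).smul_const H).const_add P
  have hd' : HasFDerivAt (chartMap (n := n)) (fderiv ℂ chartMap P) (P + (0 : ℂ) • H) := by
    simpa using hd
  have h1 := hd'.comp_hasDerivAt (0 : ℂ) hline
  have h2 : HasDerivAt (chartMap ∘ fun t : ℂ => P + t • H) (chartDerivLinear P H) 0 := by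
    have hv : ∀ i : Fin (n + 1), HasDerivAt (fun t : ℂ => chartVec (P + t • H).1 i)
        ((Fin.cons 0 (Fin.tail H.1) : Fin (n + 1) → ℂ) i) 0 := by
      intro i
      refine Fin.cases ?_ (fun j => ?_) i
      · simpa using hasDerivAt_const (0 : ℂ) (1 : ℂ)
      · simpa [Fin.tail] using
          ((hasDerivAt_id (0 : ℂ)).mul_const (H.1 j.succ)).const_add (P.1 j.succ)
    have hp : ∀ i : Fin (n + 1), HasDerivAt (fun t : ℂ => (P + t • H).1 i) (H.1 i) 0 := by
      intro i
      simpa using ((hasDerivAt_id (0 : ℂ)).mul_const (H.1 i)).const_add (P.1 i)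
    have hR : ∀ (i : Fin (n + 1)) (j : Fin n),
        HasDerivAt (fun t : ℂ => (P + t • H).2 i j) (H.2 i j) 0 := by
      intro i j
      simpa using ((hasDerivAt_id (0 : ℂ)).mul_const (H.2 i j)).const_add (P.2 i j)
    have hsnd : HasDerivAt (fun t : ℂ => (P + t • H).2) H.2 0 := by
      simpa using ((hasDerivAt_id (0 : ℂ)).smul_const H.2).const_add P.2
    refine HasDerivAt.prodMk (f₁ := fun t : ℂ => (chartMap (P + t • H)).1)
      (f₁' := (chartDerivLinear P H).1) (hasDerivAt_pi.2 fun i => ?_) hsnd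
    have h3 := ((hp 0).mul (hv i)).sub
      (HasDerivAt.fun_sum (u := Finset.univ) fun j _ => (hR i j).mul (hp j.succ))
    refine h3.congr_deriv ?_
    change _ = (chartJacobian P *ᵥ H.1) i + -∑ j, H.2 i j * P.1 j.succ
    simp only [zero_smul, add_zero, Matrix.mulVec, dotProduct, Fin.sum_univ_succ]
    have h4 : ∑ j : Fin n, chartJacobian P i j.succ * H.1 j.succ
        = P.1 0 * (Fin.cons 0 (Fin.tail H.1) : Fin (n + 1) → ℂ) i
          - ∑ j : Fin n, P.2 i j * H.1 j.succ := by
      simp only [chartJacobian, Matrix.of_apply, Fin.cons_succ, sub_mul, Finset.sum_sub_distrib]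
      congr 1
      refine Fin.cases ?_ (fun k => ?_) i
      · simp [(Fin.succ_ne_zero _).symm]
      · simp [Fin.succ_inj, Fin.tail]
    rw [h4, Finset.sum_add_distrib]
    simp only [chartJacobian, Matrix.of_apply, Fin.cons_zero]
    ring
  exact h1.unique h2

/-- The real derivative of `chartMap`. -/
def chartDeriv (P : SplitMatrix n) : SplitMatrix n →L[ℝ] SplitMatrix n := fderiv ℝ chartMap P

theorem contDiff_real_chartMap : ContDiff ℝ 1 (chartMap (n := n)) :=
  contDiff_chartMap.restrict_scalars ℝ

theorem hasStrictFDerivAt_chartMap (P : SplitMatrix n) :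
    HasStrictFDerivAt chartMap (chartDeriv P) P :=
  contDiff_real_chartMap.contDiffAt.hasStrictFDerivAt one_ne_zero

theorem continuous_chartDeriv : Continuous (chartDeriv (n := n)) :=
  contDiff_real_chartMap.continuous_fderiv one_ne_zero

/-- The real determinant of a complex linear map is the squared modulus of its complex determinant,
and the shear by `chartCoupling` does not change the latter. -/
theorem det_chartDeriv (P : SplitMatrix n) :
    (chartDeriv P).det = ‖(chartJacobian P).det‖ ^ 2 := by
  have h1 : chartDeriv P = (fderiv ℂ chartMap P).restrictScalars ℝ :=
    ((contDiff_chartMap.differentiable one_ne_zero P).hasFDerivAt.restrictScalars ℝ).fderiv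
  have h2 : ((fderiv ℂ chartMap P : SplitMatrix n →L[ℂ] SplitMatrix n) :
      SplitMatrix n →ₗ[ℂ] SplitMatrix n) = chartDerivLinear P :=
    LinearMap.ext fun H => fderiv_chartMap_apply P H
  have h3 : ((chartDeriv P : SplitMatrix n →L[ℝ] SplitMatrix n) :
      SplitMatrix n →ₗ[ℝ] SplitMatrix n) = (chartDerivLinear P).restrictScalars ℝ := by
    rw [h1, ← h2]
    rfl
  rw [ContinuousLinearMap.det, h3, LinearMap.det_restrictScalars, det_chartDerivLinear,
    Algebra.norm_complex_eq]
  simp [Complex.normSq_eq_norm_sq]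

end Chart

/-! ### Null sets: vanishing first entries and critical fibres -/

section Generic

variable {n : ℕ}

instance : (volume : Measure (Fin (n + 1) → Fin n → ℂ)).IsAddHaarMeasure :=
  Measure.pi.isAddHaarMeasure fun _ : Fin (n + 1) => (volume : Measure (Fin n → ℂ))

instance : (volume : Measure (SplitMatrix n)).IsAddHaarMeasure :=
  Measure.prod.instIsAddHaarMeasure _ _

/-- Overwrites the column `k` of `R` so that `(0, w)` becomes an eigenvector, where the eigenvalue
and the entries `w l`, `l ≠ k`, are read off from the old column, and `w k = 1`. -/
def insertEigenvector (k : Fin n) (R : Fin (n + 1) → Fin n → ℂ) : Fin (n + 1) → Fin n → ℂ :=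
  fun i j => if j = k then
    R 0 k * (Fin.cons 0 (fun l => if l = k then 1 else R l.succ k) : Fin (n + 1) → ℂ) i
      - ∑ l ∈ Finset.univ.erase k, R i l * (if l = k then 1 else R l.succ k)
    else R i j

theorem differentiable_insertEigenvector (k : Fin n) :
    Differentiable ℝ (insertEigenvector k) := by
  refine differentiable_pi.2 fun i => differentiable_pi.2 fun j => ?_
  have h : ∀ l : Fin n, Differentiable ℝ fun R : Fin (n + 1) → Fin n → ℂ =>
      if l = k then (1 : ℂ) else R l.succ k := by
    intro l
    by_cases hl : l = k
    · simp only [hl, if_true]; fun_prop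
    · simp only [hl, if_false]; fun_prop
  have h' : Differentiable ℝ fun R : Fin (n + 1) → Fin n → ℂ =>
      (Fin.cons 0 (fun l => if l = k then 1 else R l.succ k) : Fin (n + 1) → ℂ) i := by
    refine Fin.cases ?_ (fun l => ?_) i
    · simp only [Fin.cons_zero]; fun_prop
    · simpa only [Fin.cons_succ] using h l
  unfold insertEigenvector
  by_cases hj : j = k
  · simp only [hj, if_true]
    refine Differentiable.sub (by fun_prop) (Differentiable.fun_sum fun l _ => ?_)
    have := h l
    fun_prop
  · simp only [hj, if_false]; fun_prop

theorem volume_entry_eq_zero (i : Fin (n + 1)) (k : Fin n) :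
    volume {R : Fin (n + 1) → Fin n → ℂ | R i k = 0} = 0 := by
  let L : (Fin (n + 1) → Fin n → ℂ) →ₗ[ℝ] ℂ :=
    (LinearMap.proj k : (Fin n → ℂ) →ₗ[ℝ] ℂ) ∘ₗ LinearMap.proj i
  have h := Measure.addHaar_submodule (volume : Measure (Fin (n + 1) → Fin n → ℂ))
    (LinearMap.ker L) (by
      intro htop
      have : (fun _ _ => (1 : ℂ)) ∈ LinearMap.ker L := by rw [htop]; trivial
      simp [L] at this)
  exact h

/-- A dimension count: after normalizing `w k = 1`, the pair (z, w) has n parameters, whereas it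
determines the n + 1 entries of column `k` from the other columns. The exceptional matrices thus lie
in differentiable images of hyperplanes, which are null. -/
theorem ae_no_eigenvector_tail : ∀ᵐ R : Fin (n + 1) → Fin n → ℂ,
    ∀ (z : ℂ) (w : Fin n → ℂ),
      (∀ i, ∑ l, R i l * w l = z * (Fin.cons 0 w : Fin (n + 1) → ℂ) i) → w = 0 := by
  have hnull : ∀ k : Fin n, volume (insertEigenvector k '' {R | R k.succ k = 0}) = 0 := fun k =>
    addHaar_image_eq_zero_of_differentiableOn_of_addHaar_eq_zero volume
      (differentiable_insertEigenvector k).differentiableOn (volume_entry_eq_zero k.succ k)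
  refine measure_mono_null ?_ (measure_iUnion_null hnull)
  intro R hR
  simp only [Set.mem_compl_iff, Set.mem_ofPred_eq, not_forall] at hR
  obtain ⟨z, w, hw, hne⟩ := hR
  obtain ⟨k, hk⟩ : ∃ k, w k ≠ 0 := by
    by_contra hcon
    push Not at hcon
    exact hne (funext hcon)
  -- The preimage stores `z` and the ratios `w l / w k` in column `k`, with 0 in the slot (k.succ,
  -- k), which `insertEigenvector` never reads.
  refine Set.mem_iUnion.2 ⟨k, fun i j => if j = k then
    (Fin.cons z (fun l => if l = k then 0 else w l / w k) : Fin (n + 1) → ℂ) i else R i j, ?_, ?_⟩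
  · simp
  · funext i j
    by_cases hj : j = k
    · subst hj
      have hv : (fun l => if l = j then (1 : ℂ) else if l = j then 0 else w l / w j)
          = fun l => w l / w j := by
        funext l
        by_cases hl : l = j
        · simp [hl, hk]
        · simp [hl]
      have hc : (Fin.cons 0 (fun l => w l / w j) : Fin (n + 1) → ℂ) i
          = (Fin.cons 0 w : Fin (n + 1) → ℂ) i / w j := by
        refine Fin.cases ?_ (fun l => ?_) i <;> simp
      simp only [insertEigenvector, if_true, Fin.cons_zero, Fin.cons_succ, hv, hc]
      have h2 : ∑ l ∈ Finset.univ.erase j, (if l = j then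
          (Fin.cons z (fun l => if l = j then 0 else w l / w j) : Fin (n + 1) → ℂ) i else R i l) *
            (if l = j then 1 else if l = j then 0 else w l / w j)
          = (∑ l ∈ Finset.univ.erase j, R i l * w l) / w j := by
        rw [Finset.sum_div]
        refine Finset.sum_congr rfl fun l hl => ?_
        have hl' : l ≠ j := (Finset.mem_erase.1 hl).1
        simp [hl', mul_div_assoc]
      rw [h2]
      have h3 := hw i
      rw [← Finset.add_sum_erase _ _ (Finset.mem_univ j)] at h3
      field_simp
      linear_combination -h3
    · simp [insertEigenvector, hj]

/-- For almost every matrix no eigenvector has a vanishing first entry. -/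
theorem ae_eigenvector_first_ne_zero : ∀ᵐ Y : SplitMatrix n, ∀ (z : ℂ) (v : Fin (n + 1) → ℂ),
    joinColumns Y *ᵥ v = z • v → v 0 = 0 → v = 0 := by
  have h := (Measure.quasiMeasurePreserving_snd (μ := (volume : Measure (Fin (n + 1) → ℂ)))
    (ν := (volume : Measure (Fin (n + 1) → Fin n → ℂ)))).ae (ae_no_eigenvector_tail (n := n))
  filter_upwards [h] with Y hY z v hv h0
  have hvt : v = Fin.cons 0 (Fin.tail v) := by
    rw [← h0, Fin.cons_self_tail]
  have ht : Fin.tail v = 0 := by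
    refine hY z (Fin.tail v) fun i => ?_
    have := congrFun hv i
    rw [Matrix.mulVec, dotProduct, Fin.sum_univ_succ] at this
    rw [← hvt]
    simpa [h0, Fin.tail] using this
  rw [hvt, ht]
  funext i
  refine Fin.cases ?_ (fun l => ?_) i <;> simp

theorem ae_fiber_regular : ∀ᵐ Y : SplitMatrix n, ∀ P, chartMap P = Y →
    (chartJacobian P).det ≠ 0 := by
  filter_upwards [ae_forall_fiber_det_ne_zero volume (hasStrictFDerivAt_chartMap (n := n))]
    with Y hY P hP h0
  exact hY P hP (by rw [det_chartDeriv, h0]; simp)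

end Generic

/-! ### Fibres of the chart as sets of eigenpairs -/

section Fiber

variable {n : ℕ} {Y : SplitMatrix n}

/-- The characteristic polynomial of a matrix with the eigenpair `(P.1 0, chartVec P.1)`. -/
theorem charpoly_eq_X_sub_C_mul {P : SplitMatrix n} (hP : chartMap P = Y) :
    ∃ Q : Polynomial ℂ, (joinColumns Y).charpoly = (Polynomial.X - Polynomial.C (P.1 0)) * Q ∧
      Q.eval (P.1 0) = (chartJacobian P).det := by
  obtain ⟨h2, hv⟩ := (chartMap_eq_iff P Y).1 hP
  let A := (joinColumns Y).charmatrix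
  let v : Fin (n + 1) → Polynomial ℂ := fun i => Polynomial.C (chartVec P.1 i)
  refine ⟨(A.updateCol 0 v).det, ?_, ?_⟩
  · have h1 := Matrix.det_updateCol_sum A 0 v
    have h3 : (fun k => ∑ i, v i • A k i)
        = (Polynomial.X - Polynomial.C (P.1 0)) • v := by
      funext k
      have hk := congrFun hv k
      have : ∑ i, v i • A k i = (A *ᵥ v) k := by
        simp [Matrix.mulVec, dotProduct, mul_comm]
      rw [this]
      simp only [A, Matrix.charmatrix, Matrix.sub_mulVec, Pi.sub_apply, RingHom.mapMatrix_apply,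
        Pi.smul_apply, smul_eq_mul, sub_mul, Matrix.scalar_apply]
      congr 1
      · simp [Matrix.mulVec_diagonal]
      · have : (joinColumns Y).map Polynomial.C *ᵥ v
            = fun i => Polynomial.C ((joinColumns Y *ᵥ chartVec P.1) i) := by
          funext i
          simp [Matrix.mulVec, dotProduct, v]
        change ((joinColumns Y).map Polynomial.C *ᵥ v) k = _
        rw [this]
        simp [hk, v]
    rw [h3, Matrix.det_updateCol_smul] at h1
    simpa [v, Matrix.charpoly, A] using h1.symm
  · rw [← Polynomial.coe_evalRingHom, RingHom.map_det]
    congr 1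
    ext i j
    refine Fin.cases ?_ (fun l => ?_) j
    · simp [v, chartJacobian]
    · simp [A, Matrix.charmatrix_apply, Matrix.diagonal_apply, chartJacobian, h2,
        apply_ite]

theorem rootMultiplicity_eq_one {P : SplitMatrix n} (hP : chartMap P = Y)
    (hd : (chartJacobian P).det ≠ 0) :
    (joinColumns Y).charpoly.rootMultiplicity (P.1 0) = 1 := by
  obtain ⟨Q, hQ, hQe⟩ := charpoly_eq_X_sub_C_mul hP
  have h0 : (joinColumns Y).charpoly ≠ 0 := (Matrix.charpoly_monic _).ne_zero
  have hroot : ¬ Q.IsRoot (P.1 0) := by rw [Polynomial.IsRoot, hQe]; exact hd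
  rw [hQ] at h0 ⊢
  rw [Polynomial.rootMultiplicity_mul h0, Polynomial.rootMultiplicity_X_sub_C_self,
    Polynomial.rootMultiplicity_eq_zero hroot]

/-- An eigenvector with nonzero first entry can be rescaled to have first entry 1. -/
theorem exists_fiber_of_root
    (hY : ∀ (z : ℂ) (v : Fin (n + 1) → ℂ), joinColumns Y *ᵥ v = z • v → v 0 = 0 → v = 0)
    {z : ℂ} (hz : z ∈ (joinColumns Y).charpoly.roots) : ∃ P, chartMap P = Y ∧ P.1 0 = z := by
  have hz' : (joinColumns Y).charpoly.IsRoot z := Polynomial.isRoot_of_mem_roots hz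
  rw [Polynomial.IsRoot, Matrix.eval_charpoly] at hz'
  obtain ⟨v, hv0, hv⟩ := Matrix.exists_mulVec_eq_zero_iff.2 hz'
  have hv' : joinColumns Y *ᵥ v = z • v := by
    rw [Matrix.sub_mulVec, sub_eq_zero] at hv
    rw [← hv]
    ext i
    simp [Matrix.scalar_apply, Matrix.mulVec_diagonal]
  have hne : v 0 ≠ 0 := fun h => hv0 (hY z v hv' h)
  refine ⟨(Fin.cons z fun j => v j.succ / v 0, Y.2), (chartMap_eq_iff _ _).2 ⟨rfl, ?_⟩, rfl⟩
  have hc : chartVec (Fin.cons z fun j => v j.succ / v 0) = (v 0)⁻¹ • v := by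
    funext i
    refine Fin.cases ?_ (fun l => ?_) i
    · simp [hne]
    · simp [div_eq_inv_mul]
  simp only [hc, Fin.cons_zero]
  rw [Matrix.mulVec_smul, hv', smul_comm]

theorem nodup_roots
    (hY : ∀ (z : ℂ) (v : Fin (n + 1) → ℂ), joinColumns Y *ᵥ v = z • v → v 0 = 0 → v = 0)
    (hreg : ∀ P, chartMap P = Y → (chartJacobian P).det ≠ 0) :
    (joinColumns Y).charpoly.roots.Nodup := by
  rw [Multiset.nodup_iff_count_le_one]
  intro z
  by_cases hz : z ∈ (joinColumns Y).charpoly.roots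
  · obtain ⟨P, hP, rfl⟩ := exists_fiber_of_root hY hz
    rw [Polynomial.count_roots, rootMultiplicity_eq_one hP (hreg P hP)]
  · rw [Multiset.count_eq_zero_of_notMem hz]
    exact zero_le_one

/-- The squared norm of the eigenvector `chartVec p`. -/
def chartNormSq (p : Fin (n + 1) → ℂ) : ℝ := ∑ i, ‖chartVec p i‖ ^ 2

theorem chartNormSq_pos (p : Fin (n + 1) → ℂ) : 0 < chartNormSq p := by
  rw [chartNormSq, Fin.sum_univ_succ]
  have : 0 ≤ ∑ i : Fin n, ‖chartVec p i.succ‖ ^ 2 := Finset.sum_nonneg fun i _ => by positivity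
  simp only [chartVec_zero, norm_one]
  linarith

/-- The normalization of `chartVec p`. -/
def chartUnitVec (p : Fin (n + 1) → ℂ) : Fin (n + 1) → ℂ :=
  (((√(chartNormSq p))⁻¹ : ℝ) : ℂ) • chartVec p

theorem star_dotProduct_self_eq {m : ℕ} (v : Fin m → ℂ) :
    star v ⬝ᵥ v = ((∑ i, ‖v i‖ ^ 2 : ℝ) : ℂ) := by
  simp only [dotProduct, Pi.star_apply, RCLike.star_def, Complex.conj_mul']
  push_cast
  rfl

/-- The vector chosen by `epsilon` minus the right multiple of `chartVec` is an eigenvector with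
vanishing first entry, hence zero; normalization and the phase convention then fix the multiple. -/
theorem eigenvector_eq_chartUnitVec
    (hY : ∀ (z : ℂ) (v : Fin (n + 1) → ℂ), joinColumns Y *ᵥ v = z • v → v 0 = 0 → v = 0)
    {P : SplitMatrix n} (hP : chartMap P = Y) :
    eigenvector (joinColumns Y) (P.1 0) = chartUnitVec P.1 := by
  obtain ⟨-, hv⟩ := (chartMap_eq_iff P Y).1 hP
  have hpos := chartNormSq_pos P.1
  have hspos : 0 < √(chartNormSq P.1) := Real.sqrt_pos.2 hpos
  have hex : IsNormalizedEigenvector (joinColumns Y) (P.1 0) (chartUnitVec P.1) := by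
    refine ⟨?_, ?_, ?_⟩
    · rw [chartUnitVec, Matrix.mulVec_smul, hv, smul_comm]
    · rw [star_dotProduct_self_eq]
      norm_cast
      simp only [chartUnitVec, Pi.smul_apply, smul_eq_mul, norm_mul, mul_pow, ← Finset.mul_sum]
      change _ * chartNormSq P.1 = 1
      rw [Complex.norm_real, Real.norm_eq_abs, sq_abs, inv_pow, Real.sq_sqrt hpos.le,
        inv_mul_cancel₀ hpos.ne']
    · intro i hi
      obtain rfl : i = 0 := Fin.ext hi
      simp [chartUnitVec, abs_of_pos hspos]
  obtain ⟨h1, h2, h3⟩ : IsNormalizedEigenvector (joinColumns Y) (P.1 0)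
      (eigenvector (joinColumns Y) (P.1 0)) := Classical.epsilon_spec ⟨_, hex⟩
  set u := eigenvector (joinColumns Y) (P.1 0)
  have hu0 := h3 0 rfl
  set r : ℝ := ‖u 0‖
  have hu : u = (r : ℂ) • chartVec P.1 := by
    rw [← sub_eq_zero]
    refine hY (P.1 0) _ ?_ ?_
    · rw [Matrix.mulVec_sub, Matrix.mulVec_smul, h1, hv, smul_sub, smul_comm (r : ℂ)]
    · simp [hu0]
  rw [star_dotProduct_self_eq, hu] at h2
  simp only [Pi.smul_apply, smul_eq_mul, norm_mul, mul_pow, ← Finset.mul_sum] at h2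
  rw [Complex.norm_real, Real.norm_eq_abs, sq_abs] at h2
  change ((r ^ 2 * chartNormSq P.1 : ℝ) : ℂ) = 1 at h2
  have h4 : r ^ 2 * chartNormSq P.1 = 1 := by exact_mod_cast h2
  have h5 : r = (√(chartNormSq P.1))⁻¹ := by
    have hr : 0 ≤ r := norm_nonneg _
    rw [← Real.sqrt_inv, ← eq_inv_of_mul_eq_one_left h4, Real.sqrt_sq hr]
  rw [hu, h5, chartUnitVec]

/-- The law of an eigenpair with a uniformly distributed phase. -/
def chartPhaseLaw (p : Fin (n + 1) → ℂ) : Measure (ℂ × (Fin (n + 1) → ℂ)) :=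
  uniformPhase.map fun θ : ℝ => (p 0, Complex.exp (Complex.I * θ) • chartUnitVec p)

/-- The empirical measure of the eigenpairs, as a sum over the regular points of a fibre. -/
def fiberEigenpairs (Y : SplitMatrix n) : Measure (ℂ × (Fin (n + 1) → ℂ)) :=
  Measure.sum fun P : {P // chartMap P = Y ∧ (chartDeriv P).det ≠ 0} => chartPhaseLaw P.1.1

theorem multiset_sum_measure_apply {α : Type*} [MeasurableSpace α] (s : Multiset (Measure α))
    (S : Set α) : s.sum S = (s.map fun μ => μ S).sum := by
  induction s using Multiset.induction_on with
  | empty => simp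
  | cons a s ih => simp [ih]

/-- The map P ↦ z is a bijection from the fibre onto the roots: injective since two normalized
eigenvectors at the same z differ by an eigenvector with vanishing first entry, surjective by
rescaling. Simplicity of the roots removes multiplicities. -/
theorem empiricalEigenpairs_eq_fiberEigenpairs
    (hY : ∀ (z : ℂ) (v : Fin (n + 1) → ℂ), joinColumns Y *ᵥ v = z • v → v 0 = 0 → v = 0)
    (hreg : ∀ P, chartMap P = Y → (chartJacobian P).det ≠ 0) :
    empiricalEigenpairs (joinColumns Y) = fiberEigenpairs Y := by
  have hnd := nodup_roots hY hreg
  set p := (joinColumns Y).charpoly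
  have hp0 : p ≠ 0 := (Matrix.charpoly_monic _).ne_zero
  have hmem : ∀ P : {P // chartMap P = Y ∧ (chartDeriv P).det ≠ 0},
      P.1.1 0 ∈ p.roots.toFinset := by
    rintro ⟨P, hP, -⟩
    rw [Multiset.mem_toFinset, Polynomial.mem_roots hp0]
    obtain ⟨Q, hQ, -⟩ := charpoly_eq_X_sub_C_mul hP
    simp [p, hQ]
  let e : {P // chartMap P = Y ∧ (chartDeriv P).det ≠ 0} ≃ {z // z ∈ p.roots.toFinset} :=
    Equiv.ofBijective (fun P => ⟨P.1.1 0, hmem P⟩) (by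
      constructor
      · rintro ⟨P, hP, hPd⟩ ⟨P', hP', hPd'⟩ h
        have h0 : P.1 0 = P'.1 0 := congrArg Subtype.val h
        obtain ⟨h2, hv⟩ := (chartMap_eq_iff P Y).1 hP
        obtain ⟨h2', hv'⟩ := (chartMap_eq_iff P' Y).1 hP'
        have hsub : chartVec P.1 - chartVec P'.1 = 0 := by
          refine hY (P.1 0) _ ?_ (by simp)
          rw [Matrix.mulVec_sub, hv, hv', ← h0, smul_sub]
        refine Subtype.ext (Prod.ext (funext fun i => ?_) (h2.trans h2'.symm))
        refine Fin.cases h0 (fun j => ?_) i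
        simpa using congrFun (sub_eq_zero.1 hsub) j.succ
      · rintro ⟨z, hz⟩
        obtain ⟨P, hP, rfl⟩ := exists_fiber_of_root hY (Multiset.mem_toFinset.1 hz)
        refine ⟨⟨P, hP, ?_⟩, rfl⟩
        rw [det_chartDeriv]
        exact pow_ne_zero _ (norm_ne_zero_iff.2 (hreg P hP)))
  ext S hS
  rw [fiberEigenpairs, Measure.sum_apply _ hS, empiricalEigenpairs, multiset_sum_measure_apply,
    Multiset.map_map]
  let m : ℂ → ℝ≥0∞ := fun z => (uniformPhase.map fun θ : ℝ =>
    (z, Complex.exp (Complex.I * θ) • eigenvector (joinColumns Y) z)) S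
  have h1 : (p.roots.map m).sum = ∑ z ∈ p.roots.toFinset, m z := by
    rw [Finset.sum, Multiset.toFinset_val, hnd.dedup]
  refine Eq.trans h1 ?_
  rw [← Finset.tsum_subtype p.roots.toFinset m, ← e.tsum_eq]
  refine tsum_congr fun P => ?_
  change m (P.1.1 0) = chartPhaseLaw P.1.1 S
  simp only [m, chartPhaseLaw]
  rw [eigenvector_eq_chartUnitVec hY P.2.1]

theorem ae_empiricalEigenpairs_eq : ∀ᵐ Y : SplitMatrix n,
    empiricalEigenpairs (joinColumns Y) = fiberEigenpairs Y := by
  filter_upwards [ae_eigenvector_first_ne_zero, ae_fiber_regular] with Y h1 h2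
  exact empiricalEigenpairs_eq_fiberEigenpairs h1 h2

theorem continuous_chartVec : Continuous (chartVec (n := n)) := by
  refine continuous_pi fun i => ?_
  refine Fin.cases ?_ (fun j => ?_) i
  · simp only [chartVec_zero]; fun_prop
  · simp only [chartVec_succ]; fun_prop

theorem continuous_chartNormSq : Continuous (chartNormSq (n := n)) := by
  unfold chartNormSq
  have := continuous_chartVec (n := n)
  fun_prop

theorem continuous_chartUnitVec : Continuous (chartUnitVec (n := n)) := by
  unfold chartUnitVec
  have h1 := continuous_chartVec (n := n)
  have h2 := continuous_chartNormSq (n := n)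
  have h3 : ∀ p : Fin (n + 1) → ℂ, √(chartNormSq p) ≠ 0 := fun p =>
    (Real.sqrt_pos.2 (chartNormSq_pos p)).ne'
  have h4 : Continuous fun p : Fin (n + 1) → ℂ => (√(chartNormSq p))⁻¹ :=
    (Real.continuous_sqrt.comp h2).inv₀ h3
  fun_prop

instance : IsFiniteMeasure uniformPhase := by
  unfold uniformPhase
  refine ⟨?_⟩
  simp only [Measure.smul_apply, Measure.restrict_apply MeasurableSet.univ, Set.univ_inter,
    Real.volume_Ico, smul_eq_mul, sub_zero]
  refine ENNReal.mul_lt_top ?_ ENNReal.ofReal_lt_top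
  exact ENNReal.inv_lt_top.2 (by positivity)

theorem uniformPhase_univ : uniformPhase Set.univ = 1 := by
  simp only [uniformPhase, Measure.smul_apply, Measure.restrict_apply MeasurableSet.univ,
    Set.univ_inter, Real.volume_Ico, smul_eq_mul, sub_zero]
  exact ENNReal.inv_mul_cancel (by simp [Real.pi_pos]) ENNReal.ofReal_ne_top

theorem measurable_chartPhaseLaw_apply {S : Set (ℂ × (Fin (n + 1) → ℂ))} (hS : MeasurableSet S) :
    Measurable fun P : SplitMatrix n => chartPhaseLaw P.1 S := by
  have hc : Continuous fun x : SplitMatrix n × ℝ =>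
      (x.1.1 0, Complex.exp (Complex.I * x.2) • chartUnitVec x.1.1) := by
    have := continuous_chartUnitVec (n := n)
    fun_prop
  have h := measurable_measure_prodMk_left (ν := uniformPhase) (hc.measurable hS)
  convert h using 2 with P
  rw [chartPhaseLaw, Measure.map_apply _ hS]
  · rfl
  · exact (hc.comp (Continuous.prodMk_right P)).measurable

/-- This supplies a measurable version of the empirical measure, which is itself defined through an
arbitrary choice of eigenvectors; `Measure.bind` needs one. -/
theorem measurable_fiberEigenpairs : Measurable (fiberEigenpairs (n := n)) := by
  refine Measure.measurable_of_measurable_coe _ fun S hS => ?_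
  have h := (measurable_tsum_fiber_and_lintegral volume (hasStrictFDerivAt_chartMap (n := n))
    continuous_chartDeriv (measurable_chartPhaseLaw_apply hS)).1
  exact (funext fun Y => Measure.sum_apply _ hS : (fun Y => fiberEigenpairs Y S) = _) ▸ h

end Fiber

/-! ### Densities of finite product measures -/

section ProductDensity

variable {α : Type*} [MeasurableSpace α]

theorem lintegral_fin_pi_prod {m : ℕ} (μ : Measure α) [SigmaFinite μ] (f : Fin m → α → ℝ≥0∞)
    (hf : ∀ i, Measurable (f i)) :
    ∫⁻ x, ∏ i, f i (x i) ∂(Measure.pi fun _ => μ) = ∏ i, ∫⁻ x, f i x ∂μ := by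
  induction m with
  | zero => simp
  | succ m ih =>
    have h := measurePreserving_piFinSuccAbove (fun _ : Fin (m + 1) => μ) 0
    have hm : Measurable fun x : α × (Fin m → α) => f 0 x.1 * ∏ i : Fin m, f i.succ (x.2 i) := by
      refine ((hf 0).comp measurable_fst).mul (Finset.measurable_prod _ fun i _ => ?_)
      exact (hf i.succ).comp ((measurable_pi_apply i).comp measurable_snd)
    have h1 : ∫⁻ x, ∏ i, f i (x i) ∂(Measure.pi fun _ : Fin (m + 1) => μ)
        = ∫⁻ x : α × (Fin m → α), f 0 x.1 * ∏ i : Fin m, f i.succ (x.2 i)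
          ∂(μ.prod (Measure.pi fun _ => μ)) := by
      rw [← h.lintegral_comp hm]
      refine lintegral_congr fun x => ?_
      rw [Fin.prod_univ_succ]
      rfl
    have hm2 : Measurable fun y : Fin m → α => ∏ i : Fin m, f i.succ (y i) :=
      Finset.measurable_prod _ fun i _ => (hf i.succ).comp (measurable_pi_apply i)
    rw [h1, lintegral_prod_mul (hf 0).aemeasurable hm2.aemeasurable,
      ih (fun i => f i.succ) fun i => hf i.succ, Fin.prod_univ_succ]

theorem pi_withDensity_fin {m : ℕ} (μ : Measure α) [SigmaFinite μ] (f : Fin m → α → ℝ≥0∞)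
    (hf : ∀ i, Measurable (f i)) [∀ i, SigmaFinite (μ.withDensity (f i))] :
    (Measure.pi fun i => μ.withDensity (f i))
      = (Measure.pi fun _ => μ).withDensity fun x => ∏ i, f i (x i) := by
  refine Measure.pi_eq fun s hs => ?_
  rw [withDensity_apply _ (MeasurableSet.univ_pi hs),
    ← lintegral_indicator (MeasurableSet.univ_pi hs)]
  have h : ∀ x : Fin m → α, (Set.univ.pi s).indicator (fun x => ∏ i, f i (x i)) x
      = ∏ i, (s i).indicator (f i) (x i) := by
    intro x
    by_cases hx : x ∈ Set.univ.pi s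
    · rw [Set.indicator_of_mem hx]
      exact Finset.prod_congr rfl fun i _ => (Set.indicator_of_mem (hx i trivial) _).symm
    · rw [Set.indicator_of_notMem hx]
      simp only [Set.mem_univ_pi, not_forall] at hx
      obtain ⟨i, hi⟩ := hx
      exact (Finset.prod_eq_zero (Finset.mem_univ i) (Set.indicator_of_notMem hi _)).symm
  simp_rw [h]
  rw [lintegral_fin_pi_prod μ _ fun i => (hf i).indicator (hs i)]
  refine Finset.prod_congr rfl fun i _ => ?_
  rw [lintegral_indicator (hs i), withDensity_apply _ (hs i)]

end ProductDensity

/-! ### The Gaussian law of a matrix entry -/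

section EntryLaw

/-- The density of an entry of a matrix of the interpolating Ginibre ensemble. -/
def gaussDensity (τ : ℝ) (x : ℂ) : ℝ :=
  (Real.pi * √(1 - τ ^ 2))⁻¹ * Real.exp (-((‖x‖ ^ 2 - τ * (x ^ 2).re) / (1 - τ ^ 2)))

/-- The law of an entry of a matrix of the interpolating Ginibre ensemble. -/
def entryLaw (τ : ℝ) : Measure ℂ := volume.withDensity fun x => ENNReal.ofReal (gaussDensity τ x)

theorem continuous_gaussDensity (τ : ℝ) : Continuous (gaussDensity τ) := by
  unfold gaussDensity
  have h : Continuous fun x : ℂ => ‖x‖ ^ 2 - τ * (x ^ 2).re := by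
    have : Continuous fun x : ℂ => (x ^ 2).re := Complex.continuous_re.comp (by fun_prop)
    fun_prop
  fun_prop

@[fun_prop]
theorem measurable_gaussDensity (τ : ℝ) : Measurable (gaussDensity τ) :=
  (continuous_gaussDensity τ).measurable

theorem gaussDensity_nonneg (τ : ℝ) (x : ℂ) : 0 ≤ gaussDensity τ x := by
  unfold gaussDensity; positivity

theorem measurable_ofReal_gaussDensity (τ : ℝ) :
    Measurable fun x => ENNReal.ofReal (gaussDensity τ x) :=
  ENNReal.measurable_ofReal.comp (continuous_gaussDensity τ).measurable

variable {τ : ℝ} (hτ0 : 0 < τ) (hτ1 : τ < 1)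

/-- An entry as a function of two standard normal variables. -/
def entryOf (τ : ℝ) (x : ℝ × ℝ) : ℂ :=
  ((√((1 + τ) / 2) * x.1 : ℝ) : ℂ) + Complex.I * ((√((1 - τ) / 2) * x.2 : ℝ) : ℂ)

theorem measurable_entryOf (τ : ℝ) : Measurable (entryOf τ) := by
  have : Continuous (entryOf τ) := by
    unfold entryOf
    fun_prop
  exact this.measurable

include hτ0 hτ1

/-- Real and imaginary parts are independent centred Gaussians of variances (1 ± τ)/2; the product
of their densities is `gaussDensity`. -/
theorem map_entryOf :
    ((gaussianReal 0 1).prod (gaussianReal 0 1)).map (entryOf τ) = entryLaw τ := by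
  have hp : 0 < (1 + τ) / 2 := by linarith
  have hm : 0 < (1 - τ) / 2 := by linarith
  have hg : ∀ {c : ℝ} (hc : 0 < c), (gaussianReal 0 1).map (fun x => √c * x)
      = volume.withDensity fun x => ENNReal.ofReal ((√(2 * Real.pi * c))⁻¹
          * Real.exp (-x ^ 2 / (2 * c))) := by
    intro c hc
    have h := gaussianReal_map_const_mul (μ := 0) (v := 1) (√c)
    have h2 : (NNReal.mk (√c ^ 2) (sq_nonneg _) * 1 : NNReal) ≠ 0 := by
      rw [mul_one, ← NNReal.coe_ne_zero]
      change √c ^ 2 ≠ 0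
      rw [Real.sq_sqrt hc.le]
      exact hc.ne'
    refine h.trans ?_
    rw [gaussianReal_of_var_ne_zero _ h2]
    congr 1
    funext x
    rw [gaussianPDF, gaussianPDFReal]
    have h3 : ((NNReal.mk (√c ^ 2) (sq_nonneg _) * 1 : NNReal) : ℝ) = c := by
      rw [mul_one]
      exact Real.sq_sqrt hc.le
    rw [h3]
    simp
  have h1 : entryOf τ = Complex.measurableEquivRealProd.symm ∘
      Prod.map (fun x => √((1 + τ) / 2) * x) (fun x => √((1 - τ) / 2) * x) := by
    funext x
    apply Complex.ext <;> simp [entryOf, Complex.measurableEquivRealProd_symm_apply]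
  have hm1 : ∀ c : ℝ, Measurable fun x : ℝ => c * x := fun c => measurable_const_mul c
  rw [h1, ← Measure.map_map (Complex.measurableEquivRealProd.symm.measurable)
    ((hm1 _).prodMap (hm1 _)), ← Measure.map_prod_map _ _ (hm1 _) (hm1 _), hg hp, hg hm,
    prod_withDensity (by fun_prop) (by fun_prop)]
  have hv := Complex.volume_preserving_equiv_real_prod.symm
  ext s hs
  rw [Measure.map_apply Complex.measurableEquivRealProd.symm.measurable hs, entryLaw,
    withDensity_apply _ hs, withDensity_apply _ (Complex.measurableEquivRealProd.symm.measurable hs),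
    ← hv.setLIntegral_comp_preimage hs (measurable_ofReal_gaussDensity τ)]
  refine lintegral_congr fun x => ?_
  rw [← ENNReal.ofReal_mul (by positivity)]
  congr 1
  have ht : (0 : ℝ) < 1 - τ ^ 2 := by nlinarith
  have hc : (√(2 * Real.pi * ((1 + τ) / 2)))⁻¹ * (√(2 * Real.pi * ((1 - τ) / 2)))⁻¹
      = (Real.pi * √(1 - τ ^ 2))⁻¹ := by
    rw [← mul_inv, ← Real.sqrt_mul (by positivity)]
    congr 1
    rw [show 2 * Real.pi * ((1 + τ) / 2) * (2 * Real.pi * ((1 - τ) / 2))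
      = Real.pi ^ 2 * (1 - τ ^ 2) by ring, Real.sqrt_mul (by positivity),
      Real.sqrt_sq Real.pi_pos.le]
  have he : -x.1 ^ 2 / (2 * ((1 + τ) / 2)) + -x.2 ^ 2 / (2 * ((1 - τ) / 2))
      = -((‖Complex.measurableEquivRealProd.symm x‖ ^ 2
        - τ * (Complex.measurableEquivRealProd.symm x ^ 2).re) / (1 - τ ^ 2)) := by
    have e1 : (1 : ℝ) - τ ^ 2 = (1 - τ) * (1 + τ) := by ring
    have e2 : (1 : ℝ) - τ ≠ 0 := by linarith
    have e3 : (1 : ℝ) + τ ≠ 0 := by linarith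
    rw [← Complex.normSq_eq_norm_sq, Complex.normSq_apply, pow_two
      (Complex.measurableEquivRealProd.symm x), Complex.mul_re,
      Complex.measurableEquivRealProd_symm_apply, e1]
    field_simp
    ring
  rw [gaussDensity, ← he, Real.exp_add, ← hc]
  ring

theorem isProbabilityMeasure_entryLaw : IsProbabilityMeasure (entryLaw τ) := by
  rw [← map_entryOf hτ0 hτ1]
  exact Measure.isProbabilityMeasure_map (measurable_entryOf τ).aemeasurable

theorem memLp_entryLaw : MemLp (fun x : ℂ => x) 2 (entryLaw τ) := by
  rw [← map_entryOf hτ0 hτ1]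
  have := (memLp_map_measure_iff (f := entryOf τ) (g := fun x : ℂ => x)
    (μ := (gaussianReal 0 1).prod (gaussianReal 0 1)) (p := 2)
    (by fun_prop) (measurable_entryOf τ).aemeasurable).2
  refine this ?_
  have h0 : MemLp (fun x : ℝ => (x : ℂ)) 2 (gaussianReal 0 1) :=
    (memLp_id_gaussianReal 2).ofReal
  have h1 : MemLp (fun x : ℝ × ℝ => (x.1 : ℂ)) 2 ((gaussianReal 0 1).prod (gaussianReal 0 1)) :=
    h0.comp_fst _
  have h2 : MemLp (fun x : ℝ × ℝ => (x.2 : ℂ)) 2 ((gaussianReal 0 1).prod (gaussianReal 0 1)) :=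
    h0.comp_snd _
  have h3 := (h1.const_mul (√((1 + τ) / 2) : ℂ)).add
    (h2.const_mul (Complex.I * (√((1 - τ) / 2) : ℂ)))
  refine h3.ae_eq (Filter.Eventually.of_forall fun x => ?_)
  simp [entryOf]
  ring

end EntryLaw

/-! ### First and second moments of an entry -/

section EntryMoments

variable {τ : ℝ} (hτ0 : 0 < τ) (hτ1 : τ < 1)

theorem integral_ofReal_gaussian : ∫ x : ℝ, (x : ℂ) ∂(gaussianReal 0 1) = 0 := by
  rw [integral_complex_ofReal, integral_id_gaussianReal]
  simp

theorem integral_ofReal_sq_gaussian : ∫ x : ℝ, (x : ℂ) ^ 2 ∂(gaussianReal 0 1) = 1 := by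
  have h := variance_eq_integral (μ := gaussianReal 0 1) (X := fun x : ℝ => x)
    measurable_id.aemeasurable
  rw [variance_fun_id_gaussianReal, integral_id_gaussianReal] at h
  simp only [sub_zero, NNReal.coe_one] at h
  have h2 : ∫ x : ℝ, (x : ℂ) ^ 2 ∂(gaussianReal 0 1)
      = ((∫ x : ℝ, x ^ 2 ∂(gaussianReal 0 1) : ℝ) : ℂ) := by
    rw [← integral_complex_ofReal]
    simp
  rw [h2, ← h]
  simp

theorem integrable_ofReal_pow_gaussian (i : Fin 3) :
    Integrable (fun x : ℝ => (x : ℂ) ^ (i : ℕ)) (gaussianReal 0 1) := by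
  have h0 : MemLp (fun x : ℝ => (x : ℂ)) 2 (gaussianReal 0 1) :=
    (memLp_id_gaussianReal 2).ofReal
  fin_cases i
  · simp
  · simpa using h0.integrable (by norm_num)
  · refine (h0.integrable_mul h0).congr (Filter.Eventually.of_forall fun x => ?_)
    simp [pow_two]

/-- The integral of a quadratic form in two independent standard normal variables. -/
theorem integral_quadratic_gaussian (a b c d e : ℂ) :
    ∫ x : ℝ × ℝ, (a * (x.1 : ℂ) ^ 2 + b * ((x.1 : ℂ) * (x.2 : ℂ)) + c * (x.2 : ℂ) ^ 2
      + d * (x.1 : ℂ) + e * (x.2 : ℂ)) ∂((gaussianReal 0 1).prod (gaussianReal 0 1)) = a + c := by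
  have hi : ∀ i j : Fin 3, Integrable (fun x : ℝ × ℝ => (x.1 : ℂ) ^ (i : ℕ) * (x.2 : ℂ) ^ (j : ℕ))
      ((gaussianReal 0 1).prod (gaussianReal 0 1)) := fun i j =>
    (integrable_ofReal_pow_gaussian i).mul_prod (integrable_ofReal_pow_gaussian j)
  have hv : ∀ i j : Fin 3, ∫ x : ℝ × ℝ, (x.1 : ℂ) ^ (i : ℕ) * (x.2 : ℂ) ^ (j : ℕ)
      ∂((gaussianReal 0 1).prod (gaussianReal 0 1))
      = (∫ x : ℝ, (x : ℂ) ^ (i : ℕ) ∂(gaussianReal 0 1))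
        * ∫ x : ℝ, (x : ℂ) ^ (j : ℕ) ∂(gaussianReal 0 1) := fun i j =>
    integral_prod_mul (fun x : ℝ => (x : ℂ) ^ (i : ℕ)) fun x : ℝ => (x : ℂ) ^ (j : ℕ)
  have i20 := hi 2 0
  have i11 := hi 1 1
  have i02 := hi 0 2
  have i10 := hi 1 0
  have i01 := hi 0 1
  have v20 := hv 2 0
  have v11 := hv 1 1
  have v02 := hv 0 2
  have v10 := hv 1 0
  have v01 := hv 0 1
  simp only [Fin.val_zero, Fin.val_one, Fin.val_two, pow_zero, pow_one, mul_one, one_mul,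
    integral_ofReal_gaussian, integral_ofReal_sq_gaussian, integral_const, probReal_univ, one_smul]
    at i20 i11 i02 i10 i01 v20 v11 v02 v10 v01
  rw [integral_add, integral_add, integral_add, integral_add, integral_const_mul,
    integral_const_mul, integral_const_mul, integral_const_mul, integral_const_mul,
    v20, v11, v02, v10, v01]
  · ring
  · exact i20.const_mul a
  · exact i11.const_mul b
  · exact (i20.const_mul a).add (i11.const_mul b)
  · exact i02.const_mul c
  · exact ((i20.const_mul a).add (i11.const_mul b)).add (i02.const_mul c)
  · exact i10.const_mul d
  · exact (((i20.const_mul a).add (i11.const_mul b)).add (i02.const_mul c)).add (i10.const_mul d)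
  · exact i01.const_mul e

include hτ0 hτ1

theorem integral_entryLaw : ∫ x, x ∂(entryLaw τ) = 0 := by
  rw [← map_entryOf hτ0 hτ1, integral_map (measurable_entryOf τ).aemeasurable (by fun_prop)]
  refine Eq.trans ?_ ((integral_quadratic_gaussian 0 0 0 (√((1 + τ) / 2) : ℂ)
    (Complex.I * (√((1 - τ) / 2) : ℂ))).trans (by simp))
  refine integral_congr_ae (Filter.Eventually.of_forall fun x => ?_)
  simp [entryOf]
  ring

theorem integral_mul_self_entryLaw : ∫ x, x * x ∂(entryLaw τ) = τ := by
  rw [← map_entryOf hτ0 hτ1, integral_map (measurable_entryOf τ).aemeasurable (by fun_prop)]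
  have h1 : ((√((1 + τ) / 2) : ℝ) : ℂ) ^ 2 = (((1 + τ) / 2 : ℝ) : ℂ) := by
    rw [← Complex.ofReal_pow, Real.sq_sqrt (by linarith)]
  have h2 : ((√((1 - τ) / 2) : ℝ) : ℂ) ^ 2 = (((1 - τ) / 2 : ℝ) : ℂ) := by
    rw [← Complex.ofReal_pow, Real.sq_sqrt (by linarith)]
  rw [show (τ : ℂ) = (√((1 + τ) / 2) : ℂ) ^ 2 + -(√((1 - τ) / 2) : ℂ) ^ 2 by
      rw [h1, h2]; push_cast; ring,
    ← integral_quadratic_gaussian ((√((1 + τ) / 2) : ℂ) ^ 2)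
      (2 * Complex.I * √((1 + τ) / 2) * √((1 - τ) / 2)) (-(√((1 - τ) / 2) : ℂ) ^ 2) 0 0]
  refine integral_congr_ae (Filter.Eventually.of_forall fun x => ?_)
  simp only [entryOf]
  push_cast
  linear_combination ((√((1 - τ) / 2) : ℂ) * x.2) ^ 2 * Complex.I_sq

theorem integral_star_mul_self_entryLaw : ∫ x, star x * x ∂(entryLaw τ) = 1 := by
  rw [← map_entryOf hτ0 hτ1, integral_map (measurable_entryOf τ).aemeasurable
    (by fun_prop)]
  have h1 : ((√((1 + τ) / 2) : ℝ) : ℂ) ^ 2 = (((1 + τ) / 2 : ℝ) : ℂ) := by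
    rw [← Complex.ofReal_pow, Real.sq_sqrt (by linarith)]
  have h2 : ((√((1 - τ) / 2) : ℝ) : ℂ) ^ 2 = (((1 - τ) / 2 : ℝ) : ℂ) := by
    rw [← Complex.ofReal_pow, Real.sq_sqrt (by linarith)]
  rw [show (1 : ℂ) = (√((1 + τ) / 2) : ℂ) ^ 2 + (√((1 - τ) / 2) : ℂ) ^ 2 by
      rw [h1, h2]; push_cast; ring,
    ← integral_quadratic_gaussian ((√((1 + τ) / 2) : ℂ) ^ 2) 0 ((√((1 - τ) / 2) : ℂ) ^ 2) 0 0]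
  refine integral_congr_ae (Filter.Eventually.of_forall fun x => ?_)
  simp only [entryOf, RCLike.star_def, map_add, map_mul, Complex.conj_ofReal, Complex.conj_I]
  push_cast
  linear_combination (-((√((1 - τ) / 2) : ℂ) * x.2) ^ 2) * Complex.I_sq

end EntryMoments

/-! ### The density of the matrix, with its first column split off -/

section MatrixLaw

variable {n : ℕ} {τ : ℝ} (hτ0 : 0 < τ) (hτ1 : τ < 1)

/-- Splits off the first column of a matrix. -/
def splitColumns (M : Fin (n + 1) × Fin (n + 1) → ℂ) : SplitMatrix n :=
  (fun i => M (i, 0), fun i j => M (i, j.succ))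

/-- The density of the entries of a matrix of the interpolating Ginibre ensemble. -/
def matrixDensity (τ : ℝ) (Y : SplitMatrix n) : ℝ≥0∞ :=
  (∏ i, ENNReal.ofReal (gaussDensity τ (Y.1 i))) *
    ∏ i, ∏ j, ENNReal.ofReal (gaussDensity τ (Y.2 i j))

theorem measurable_matrixDensity (τ : ℝ) : Measurable (matrixDensity (n := n) τ) := by
  have := measurable_ofReal_gaussDensity τ
  unfold matrixDensity
  fun_prop

/-- The matrix of the interpolating Ginibre ensemble as a function of a pair of real matrices. -/
def splitInterpolating (n : ℕ) (τ : ℝ)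
    (AB : (Fin (n + 1) × Fin (n + 1) → ℝ) × (Fin (n + 1) × Fin (n + 1) → ℝ)) : SplitMatrix n :=
  splitColumns fun jk => entryOf τ (AB.1 jk, AB.2 jk)

theorem joinColumns_splitInterpolating (n : ℕ) (τ : ℝ)
    (AB : (Fin (n + 1) × Fin (n + 1) → ℝ) × (Fin (n + 1) × Fin (n + 1) → ℝ)) :
    joinColumns (splitInterpolating n τ AB) = interpolatingMatrix (n + 1) τ AB.1 AB.2 := by
  ext i j
  refine Fin.cases ?_ (fun k => ?_) j <;> rfl

include hτ0 hτ1

/-- Pairing the two real matrices entrywise gives independent pairs, each pushed to `entryLaw`;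
regrouping by columns only reindexes the product measure. -/
theorem measurePreserving_splitInterpolating :
    MeasurePreserving (splitInterpolating n τ)
      ((realGinibre (n + 1)).prod (realGinibre (n + 1)))
      (volume.withDensity (matrixDensity τ)) := by
  have := isProbabilityMeasure_entryLaw hτ0 hτ1
  let ι := Fin (n + 1) × Fin (n + 1)
  have h1 : MeasurePreserving (MeasurableEquiv.arrowProdEquivProdArrow ℝ ℝ ι).symm
      ((realGinibre (n + 1)).prod (realGinibre (n + 1)))
      (Measure.pi fun _ : ι => (gaussianReal 0 1).prod (gaussianReal 0 1)) :=
    (measurePreserving_arrowProdEquivProdArrow ℝ ℝ ι (fun _ => gaussianReal 0 1)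
      fun _ => gaussianReal 0 1).symm
  have h2 : MeasurePreserving (fun (x : ι → ℝ × ℝ) i => entryOf τ (x i))
      (Measure.pi fun _ : ι => (gaussianReal 0 1).prod (gaussianReal 0 1))
      (Measure.pi fun _ : ι => entryLaw τ) :=
    measurePreserving_pi _ _ fun _ => ⟨measurable_entryOf τ, map_entryOf hτ0 hτ1⟩
  have hsm : Measurable (splitColumns (n := n)) := by
    unfold splitColumns
    fun_prop
  let g : SplitMatrix n → ι → ℂ := fun Y jk => joinColumns Y jk.1 jk.2
  have hgm : Measurable g := by
    refine measurable_pi_lambda _ ?_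
    rintro ⟨i, j⟩
    refine Fin.cases ?_ (fun k => ?_) j
    · change Measurable fun Y : SplitMatrix n => Y.1 i
      fun_prop
    · change Measurable fun Y : SplitMatrix n => Y.2 i k
      fun_prop
  have h3 : ((Measure.pi fun _ => entryLaw τ).prod
      (Measure.pi fun _ : Fin (n + 1) => Measure.pi fun _ : Fin n => entryLaw τ)).map g
        = Measure.pi fun _ : ι => entryLaw τ := by
    refine (Measure.pi_eq fun s hs => ?_).symm
    rw [Measure.map_apply hgm (MeasurableSet.univ_pi hs)]
    have : g ⁻¹' Set.univ.pi s = (Set.univ.pi fun i => s (i, 0)) ×ˢ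
        (Set.univ.pi fun i => Set.univ.pi fun j : Fin n => s (i, j.succ)) := by
      ext Y
      simp only [Set.mem_preimage, Set.mem_univ_pi, Set.mem_prod]
      refine ⟨fun h => ⟨fun i => h (i, 0), fun i j => h (i, j.succ)⟩, fun h => ?_⟩
      rintro ⟨i, j⟩
      exact Fin.cases (h.1 i) (fun k => h.2 i k) j
    rw [this, Measure.prod_prod, Measure.pi_pi, Measure.pi_pi]
    simp_rw [Measure.pi_pi]
    rw [Fintype.prod_prod_type, ← Finset.prod_mul_distrib]
    simp_rw [Fin.prod_univ_succ (fun j => entryLaw τ (s (_, j)))]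
  have h4 : ((Measure.pi fun _ => entryLaw τ).prod
      (Measure.pi fun _ : Fin (n + 1) => Measure.pi fun _ : Fin n => entryLaw τ))
        = volume.withDensity (matrixDensity τ) := by
    have hm := measurable_ofReal_gaussDensity τ
    have : ∀ m : ℕ, ∀ i : Fin m, SigmaFinite
        (volume.withDensity ((fun _ x => ENNReal.ofReal (gaussDensity τ x)) i)) := by
      intro m i
      change SigmaFinite (entryLaw τ)
      infer_instance
    have e1 : ∀ m : ℕ, (Measure.pi fun _ : Fin m => entryLaw τ) = volume.withDensity
        fun x => ∏ i, ENNReal.ofReal (gaussDensity τ (x i)) := fun m =>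
      pi_withDensity_fin (volume : Measure ℂ) (fun _ : Fin m => fun x =>
        ENNReal.ofReal (gaussDensity τ x)) fun _ => hm
    have hm2 : Measurable fun x : Fin n → ℂ => ∏ i, ENNReal.ofReal (gaussDensity τ (x i)) := by
      fun_prop
    have hσ : ∀ _ : Fin (n + 1), SigmaFinite (volume.withDensity
        (fun (x : Fin n → ℂ) => ∏ i, ENNReal.ofReal (gaussDensity τ (x i)))) := by
      intro _
      rw [← e1 n]
      infer_instance
    have e2 : (Measure.pi fun _ : Fin (n + 1) => Measure.pi fun _ : Fin n => entryLaw τ)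
        = volume.withDensity fun x => ∏ i, ∏ j, ENNReal.ofReal (gaussDensity τ (x i j)) := by
      rw [e1 n]
      exact @pi_withDensity_fin _ _ (n + 1) (volume : Measure (Fin n → ℂ)) _
        (fun _ => fun x => ∏ i, ENNReal.ofReal (gaussDensity τ (x i))) (fun _ => hm2) hσ
    rw [e1, e2, prod_withDensity (by fun_prop) (by fun_prop)]
    rfl
  have h5 : MeasurePreserving (splitColumns (n := n)) (Measure.pi fun _ : ι => entryLaw τ)
      (volume.withDensity (matrixDensity τ)) := by
    refine ⟨hsm, ?_⟩
    rw [← h3, Measure.map_map hsm hgm, ← h4]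
    exact Measure.map_id
  exact h5.comp (h2.comp h1)

end MatrixLaw

/-! ### An elliptic Gaussian integral over the complex plane -/

section ComplexGaussian

theorem lintegral_exp_neg_mul_sq {b : ℝ} (hb : 0 < b) :
    ∫⁻ x : ℝ, ENNReal.ofReal (Real.exp (-b * x ^ 2)) = ENNReal.ofReal √(Real.pi / b) := by
  rw [← ofReal_integral_eq_lintegral_ofReal (integrable_exp_neg_mul_sq hb)
    (Filter.Eventually.of_forall fun x => (Real.exp_pos _).le), integral_gaussian]

/-- Rotating η by half the argument of `c` makes `c` real and nonnegative; the exponent then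
separates into two real Gaussians with coefficients a - |c| and a + |c|. -/
theorem lintegral_complex_gaussian {a : ℝ} {c : ℂ} (h : ‖c‖ < a) :
    ∫⁻ η : ℂ, ENNReal.ofReal (Real.exp (-(a * ‖η‖ ^ 2 - (c * η ^ 2).re)))
      = ENNReal.ofReal (Real.pi / √(a ^ 2 - ‖c‖ ^ 2)) := by
  have hpos : 0 ≤ ‖c‖ := norm_nonneg c
  set u : ℂ := Complex.exp (-(Complex.arg c / 2 : ℝ) * Complex.I) with hu
  have hun : ‖u‖ = 1 := by
    rw [hu, ← Complex.ofReal_neg, Complex.norm_exp_ofReal_mul_I]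
  have hcu : c * u ^ 2 = (‖c‖ : ℂ) := by
    conv_lhs => rw [← Complex.norm_mul_exp_arg_mul_I c]
    rw [hu, ← Complex.exp_nat_mul, mul_assoc, ← Complex.exp_add]
    push_cast
    ring_nf
    simp
  let e : ℂ ≃ₗᵢ[ℝ] ℂ := rotation ⟨u, by simp [Submonoid.unitSphere, hun]⟩
  have he : ∀ η, e η = u * η := fun η => rotation_apply _ η
  have hmp : MeasurePreserving e volume volume := e.measurePreserving
  have hcont : Continuous fun η : ℂ =>
      ENNReal.ofReal (Real.exp (-(a * ‖η‖ ^ 2 - (c * η ^ 2).re))) := by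
    have : Continuous fun η : ℂ => (c * η ^ 2).re := Complex.continuous_re.comp (by fun_prop)
    refine ENNReal.continuous_ofReal.comp ?_
    fun_prop
  rw [← hmp.lintegral_comp hcont.measurable]
  have hcont' : Continuous fun η : ℂ =>
      ENNReal.ofReal (Real.exp (-(a * ‖e η‖ ^ 2 - (c * e η ^ 2).re))) := hcont.comp e.continuous
  have hv := Complex.volume_preserving_equiv_real_prod.symm
  rw [← hv.lintegral_comp hcont'.measurable]
  have h1 : ∀ x : ℝ × ℝ, ENNReal.ofReal (Real.exp (-(a
      * ‖e (Complex.measurableEquivRealProd.symm x)‖ ^ 2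
        - (c * e (Complex.measurableEquivRealProd.symm x) ^ 2).re)))
      = ENNReal.ofReal (Real.exp (-(a - ‖c‖) * x.1 ^ 2))
        * ENNReal.ofReal (Real.exp (-(a + ‖c‖) * x.2 ^ 2)) := by
    intro x
    rw [← ENNReal.ofReal_mul (Real.exp_pos _).le, ← Real.exp_add, e.norm_map, he, mul_pow,
      ← mul_assoc, hcu, Complex.re_ofReal_mul, ← Complex.normSq_eq_norm_sq, Complex.normSq_apply,
      pow_two (Complex.measurableEquivRealProd.symm x), Complex.mul_re,
      Complex.measurableEquivRealProd_symm_apply]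
    congr 2
    ring
  have h2 : ∀ b : ℝ, Measurable fun x : ℝ => ENNReal.ofReal (Real.exp (-b * x ^ 2)) := by
    intro b
    fun_prop
  refine (lintegral_congr h1).trans ?_
  change ∫⁻ x, _ ∂((volume : Measure ℝ).prod volume) = _
  rw [lintegral_prod_mul (h2 _).aemeasurable (h2 _).aemeasurable,
    lintegral_exp_neg_mul_sq (by linarith), lintegral_exp_neg_mul_sq (by linarith),
    ← ENNReal.ofReal_mul (Real.sqrt_nonneg _), ← Real.sqrt_mul (by
      have : 0 < a - ‖c‖ := by linarith
      positivity)]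
  congr 1
  rw [div_mul_div_comm, ← pow_two, show (a - ‖c‖) * (a + ‖c‖) = a ^ 2 - ‖c‖ ^ 2 by ring,
    Real.sqrt_div (by positivity), Real.sqrt_sq Real.pi_pos.le]

end ComplexGaussian

/-! ### Conditioning a Gaussian row on its product with `v` -/

section Row

variable {n : ℕ} {τ : ℝ}

/-- The squared norm of a vector. -/
def vecNormSq (v : Fin (n + 1) → ℂ) : ℝ := ∑ i, ‖v i‖ ^ 2

/-- The discriminant `|v|⁴ - τ² |vᵀ v|²`. -/
def rowDisc (τ : ℝ) (v : Fin (n + 1) → ℂ) : ℝ := vecNormSq v ^ 2 - τ ^ 2 * ‖v ⬝ᵥ v‖ ^ 2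

/-- The conditional mean of a row `r` given `r ⬝ᵥ v = ζ`. -/
def rowMean (τ : ℝ) (v : Fin (n + 1) → ℂ) (ζ : ℂ) : Fin (n + 1) → ℂ := fun i =>
  (star (v i) * (vecNormSq v * ζ - τ * (v ⬝ᵥ v) * star ζ)
    + τ * v i * (vecNormSq v * star ζ - τ * star (v ⬝ᵥ v) * ζ)) / rowDisc τ v

/-- The exponent of the density of `r ⬝ᵥ v`. -/
def rowExponent (τ : ℝ) (v : Fin (n + 1) → ℂ) (ζ : ℂ) : ℝ :=
  (vecNormSq v * ‖ζ‖ ^ 2 - τ * (star (v ⬝ᵥ v) * ζ ^ 2).re) / rowDisc τ v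

/-- The exponent of the density of a row. -/
def rowQuad (τ : ℝ) (r : Fin (n + 1) → ℂ) : ℝ :=
  ∑ i, (‖r i‖ ^ 2 - τ * (r i ^ 2).re) / (1 - τ ^ 2)

theorem norm_dotProduct_self_le (v : Fin (n + 1) → ℂ) : ‖v ⬝ᵥ v‖ ≤ vecNormSq v := by
  refine (norm_sum_le _ _).trans (le_of_eq ?_)
  simp [vecNormSq, pow_two]

theorem rowDisc_pos (hτ0 : 0 < τ) (hτ1 : τ < 1) {v : Fin (n + 1) → ℂ} (hv : 0 < vecNormSq v) :
    0 < rowDisc τ v := by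
  have h := norm_dotProduct_self_le v
  have h0 := norm_nonneg (v ⬝ᵥ v)
  have h1 : τ * ‖v ⬝ᵥ v‖ < vecNormSq v := by
    rcases h0.eq_or_lt with h0 | h0
    · rw [← h0, mul_zero]; exact hv
    · nlinarith
  have h2 : (τ * ‖v ⬝ᵥ v‖) ^ 2 < vecNormSq v ^ 2 :=
    pow_lt_pow_left₀ h1 (by positivity) two_ne_zero
  rw [mul_pow] at h2
  exact sub_pos.2 h2

theorem sum_star_mul_self (v : Fin (n + 1) → ℂ) : ∑ i, v i * star (v i) = vecNormSq v := by
  rw [vecNormSq]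
  push_cast
  refine Finset.sum_congr rfl fun i _ => ?_
  rw [RCLike.star_def, Complex.mul_conj']

theorem ofReal_rowDisc (τ : ℝ) (v : Fin (n + 1) → ℂ) :
    (rowDisc τ v : ℂ) = vecNormSq v ^ 2 - τ ^ 2 * ((v ⬝ᵥ v) * star (v ⬝ᵥ v)) := by
  rw [rowDisc, RCLike.star_def, Complex.mul_conj']
  push_cast
  ring

theorem dotProduct_rowMean {v : Fin (n + 1) → ℂ} (hD : rowDisc τ v ≠ 0) (ζ : ℂ) :
    rowMean τ v ζ ⬝ᵥ v = ζ := by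
  have hD' : (rowDisc τ v : ℂ) ≠ 0 := by exact_mod_cast hD
  have h : rowMean τ v ζ ⬝ᵥ v
      = ((∑ i, v i * star (v i)) * (vecNormSq v * ζ - τ * (v ⬝ᵥ v) * star ζ)
        + τ * (v ⬝ᵥ v) * (vecNormSq v * star ζ - τ * star (v ⬝ᵥ v) * ζ)) / rowDisc τ v := by
    unfold rowMean
    generalize (vecNormSq v * ζ - τ * (v ⬝ᵥ v) * star ζ) = a
    generalize (vecNormSq v * star ζ - τ * star (v ⬝ᵥ v) * ζ) = b
    rw [dotProduct, dotProduct, Finset.sum_mul, Finset.mul_sum, Finset.sum_mul, ← Finset.sum_add_distrib, Finset.sum_div]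
    refine Finset.sum_congr rfl fun i _ => ?_
    ring
  rw [h, sum_star_mul_self, div_eq_iff hD', ofReal_rowDisc]
  ring

/-- With m the conditional mean, the polar form of `rowQuad` pairs r with m through the real part of
Σ (m̄_i - τ m_i) r_i. As the vector m̄ - τ m is a multiple of `v`, the mean is orthogonal to every r
with r·v = 0. -/
theorem star_rowMean_sub (v : Fin (n + 1) → ℂ) (ζ : ℂ) (i : Fin (n + 1)) :
    star (rowMean τ v ζ i) - τ * rowMean τ v ζ i = (1 - τ ^ 2) *
      ((vecNormSq v * star ζ - τ * star (v ⬝ᵥ v) * ζ) / rowDisc τ v) * v i := by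
  simp only [rowMean, RCLike.star_def, map_div₀, map_add, map_mul, map_sub, Complex.conj_ofReal,
    Complex.conj_conj]
  ring

/-- Pythagoras for the Gaussian quadratic form: the cross term vanishes by `star_rowMean_sub`, and
the value at the mean is `rowExponent`. -/
theorem rowQuad_add_rowMean (hτ : 1 - τ ^ 2 ≠ 0) {v : Fin (n + 1) → ℂ}
    (hD : rowDisc τ v ≠ 0) (ζ : ℂ) {r : Fin (n + 1) → ℂ} (hr : r ⬝ᵥ v = 0) :
    rowQuad τ (r + rowMean τ v ζ) = rowQuad τ r + rowExponent τ v ζ := by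
  set m := rowMean τ v ζ with hm
  set k : ℂ := (vecNormSq v * star ζ - τ * star (v ⬝ᵥ v) * ζ) / rowDisc τ v with hk
  have h1 : ∀ i, (‖(r + m) i‖ ^ 2 - τ * ((r + m) i ^ 2).re) / (1 - τ ^ 2)
      = (‖r i‖ ^ 2 - τ * (r i ^ 2).re) / (1 - τ ^ 2) + (k * (2 * (r i * v i) + m i * v i)).re := by
    intro i
    have h2 : ((1 - τ ^ 2 : ℝ) : ℂ) * (k * (2 * (r i * v i) + m i * v i))
        = (star (m i) - τ * m i) * (2 * r i + m i) := by
      rw [hm, star_rowMean_sub, ← hk]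
      push_cast
      ring
    have h3 := congrArg Complex.re h2
    rw [Complex.re_ofReal_mul] at h3
    have hx : ∀ x : ℝ, (1 - τ ^ 2) * (x / (1 - τ ^ 2)) = x := fun x => by field_simp
    have hn : ∀ x : ℂ, ‖x‖ ^ 2 = x.re * x.re + x.im * x.im := fun x => by
      rw [← Complex.normSq_eq_norm_sq, Complex.normSq_apply]
    rw [← mul_right_inj' hτ, mul_add, h3, hx, hx, hn, hn]
    simp only [Pi.add_apply, pow_two, Complex.add_re, Complex.add_im, Complex.mul_re, Complex.mul_im, Complex.sub_re,
      Complex.sub_im, RCLike.star_def, Complex.conj_re, Complex.conj_im, Complex.ofReal_re,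
      Complex.ofReal_im, Complex.re_ofNat, Complex.im_ofNat]
    ring
  rw [rowQuad, Finset.sum_congr rfl fun i _ => h1 i, Finset.sum_add_distrib, ← Complex.re_sum,
    ← Finset.mul_sum, Finset.sum_add_distrib, ← Finset.mul_sum]
  change rowQuad τ r + (k * (2 * (r ⬝ᵥ v) + m ⬝ᵥ v)).re = _
  rw [hr, hm, dotProduct_rowMean hD, mul_zero, zero_add]
  congr 1
  rw [hk, rowExponent, div_mul_eq_mul_div, Complex.div_ofReal_re]
  congr 1
  have h4 : (vecNormSq v * star ζ - τ * star (v ⬝ᵥ v) * ζ) * ζ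
      = ((vecNormSq v * ‖ζ‖ ^ 2 : ℝ) : ℂ) - (τ : ℂ) * (star (v ⬝ᵥ v) * ζ ^ 2) := by
    push_cast
    rw [← Complex.mul_conj' ζ, RCLike.star_def]
    ring
  rw [h4, Complex.sub_re, Complex.ofReal_re, Complex.re_ofReal_mul]

theorem rowMean_sub (v : Fin (n + 1) → ℂ) (ζ η : ℂ) :
    rowMean τ v (ζ - η) = rowMean τ v ζ - rowMean τ v η := by
  funext i
  simp only [rowMean, Pi.sub_apply, star_sub]
  ring

theorem prod_gaussDensity (τ : ℝ) (r : Fin (n + 1) → ℂ) :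
    ∏ i, gaussDensity τ (r i)
      = ((Real.pi * √(1 - τ ^ 2))⁻¹) ^ (n + 1) * Real.exp (-rowQuad τ r) := by
  simp only [gaussDensity, Finset.prod_mul_distrib, Finset.prod_const, Finset.card_univ,
    Fintype.card_fin, rowQuad, ← Finset.sum_neg_distrib, Real.exp_sum]

/-- The row with prescribed last entries and `r ⬝ᵥ v = ζ`, where `v 0 = 1`. -/
def rowOfTail (v : Fin (n + 1) → ℂ) (ζ : ℂ) (r : Fin n → ℂ) : Fin (n + 1) → ℂ :=
  Fin.cons (ζ - ∑ j, r j * v j.succ) r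

theorem rowOfTail_dotProduct {v : Fin (n + 1) → ℂ} (hv : v 0 = 1) (ζ : ℂ) (r : Fin n → ℂ) :
    rowOfTail v ζ r ⬝ᵥ v = ζ := by
  simp [rowOfTail, dotProduct, Fin.sum_univ_succ, hv]

/-- The row obtained from `r` by shifting `r ⬝ᵥ v` to `ζ`. -/
def rowShift (τ : ℝ) (v : Fin (n + 1) → ℂ) (ζ : ℂ) (r : Fin (n + 1) → ℂ) : Fin (n + 1) → ℂ :=
  r - rowMean τ v (r ⬝ᵥ v) + rowMean τ v ζ

theorem continuous_rowMean (τ : ℝ) (v : Fin (n + 1) → ℂ) : Continuous (rowMean τ v) := by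
  unfold rowMean
  fun_prop

theorem continuous_rowShift (τ : ℝ) (v : Fin (n + 1) → ℂ) (ζ : ℂ) :
    Continuous (rowShift τ v ζ) := by
  have h1 : Continuous fun r : Fin (n + 1) → ℂ => r ⬝ᵥ v := by
    unfold dotProduct
    fun_prop
  have := (continuous_rowMean τ v).comp h1
  unfold rowShift
  exact (continuous_id.sub this).add continuous_const

theorem continuous_rowOfTail (v : Fin (n + 1) → ℂ) :
    Continuous fun x : ℂ × (Fin n → ℂ) => rowOfTail v x.1 x.2 := by
  unfold rowOfTail
  refine continuous_pi fun i => ?_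
  refine Fin.cases ?_ (fun j => ?_) i
  · simp only [Fin.cons_zero]; fun_prop
  · simp only [Fin.cons_succ]; fun_prop

/-- The density of `r ⬝ᵥ v`. -/
def rowDensity (τ : ℝ) (v : Fin (n + 1) → ℂ) (ζ : ℂ) : ℝ :=
  (Real.pi * √(rowDisc τ v))⁻¹ * Real.exp (-rowExponent τ v ζ)

theorem lintegral_rowExponent (hτ0 : 0 < τ) (hτ1 : τ < 1) {v : Fin (n + 1) → ℂ}
    (hv : 0 < vecNormSq v) :
    ∫⁻ η : ℂ, ENNReal.ofReal (Real.exp (-rowExponent τ v η))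
      = ENNReal.ofReal (Real.pi * √(rowDisc τ v)) := by
  have hD := rowDisc_pos hτ0 hτ1 hv
  set a : ℝ := vecNormSq v / rowDisc τ v
  set c : ℂ := (τ / rowDisc τ v : ℝ) * star (v ⬝ᵥ v)
  have hc : ‖c‖ = τ * ‖v ⬝ᵥ v‖ / rowDisc τ v := by
    simp only [c, norm_mul, Complex.norm_real, norm_star, Real.norm_eq_abs]
    rw [abs_of_pos (by positivity)]
    ring
  have hac : a ^ 2 - ‖c‖ ^ 2 = (rowDisc τ v)⁻¹ := by
    rw [hc, div_pow, div_pow, ← sub_div, mul_pow]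
    change rowDisc τ v / _ = _
    field_simp
  have hlt : ‖c‖ < a := by
    refine lt_of_pow_lt_pow_left₀ 2 (by positivity) ?_
    have : 0 < (rowDisc τ v)⁻¹ := inv_pos.2 hD
    linarith
  have h := lintegral_complex_gaussian hlt
  rw [hac, Real.sqrt_inv, div_inv_eq_mul] at h
  rw [← h]
  refine lintegral_congr fun η => ?_
  congr 3
  simp only [rowExponent, a, c]
  rw [mul_assoc, Complex.re_ofReal_mul]
  ring

/-- Disintegration of the row law along r·v: the density of r·v at ζ times the conditional law,
where the latter is realized by shifting an unconditioned row along `rowMean`. The proof takes η =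
r·v and the tail of r as coordinates, undoes the shift by a translation of the tail, and integrates
out η. -/
theorem rowDensity_mul_lintegral (hτ0 : 0 < τ) (hτ1 : τ < 1) {v : Fin (n + 1) → ℂ}
    (hv0 : v 0 = 1) (ζ : ℂ) {f : (Fin n → ℂ) → ℝ≥0∞} (hf : Measurable f) :
    ∫⁻ r, ENNReal.ofReal (∏ i, gaussDensity τ (rowOfTail v ζ r i)) * f r
      = ENNReal.ofReal (rowDensity τ v ζ)
        * ∫⁻ r, f (Fin.tail (rowShift τ v ζ r)) ∂(Measure.pi fun _ => entryLaw τ) := by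
  have hv : 0 < vecNormSq v := by
    rw [vecNormSq, Fin.sum_univ_succ, hv0]
    have : 0 ≤ ∑ i : Fin n, ‖v i.succ‖ ^ 2 := Finset.sum_nonneg fun i _ => by positivity
    simp only [norm_one]
    linarith
  have hD := rowDisc_pos hτ0 hτ1 hv
  have hτ : 1 - τ ^ 2 ≠ 0 := by nlinarith
  have hprob := isProbabilityMeasure_entryLaw hτ0 hτ1
  set P : (Fin (n + 1) → ℂ) → ℝ≥0∞ := fun r => ENNReal.ofReal (∏ i, gaussDensity τ (r i)) with hP
  have hPm : Measurable P := by fun_prop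
  have hft : Measurable fun r => f (Fin.tail (rowShift τ v ζ r)) := by
    refine hf.comp (Continuous.measurable ?_)
    have := continuous_rowShift τ v ζ
    unfold Fin.tail
    fun_prop
  have e1 : (Measure.pi fun _ : Fin (n + 1) => entryLaw τ) = volume.withDensity P := by
    have hσ : ∀ i : Fin (n + 1), SigmaFinite
        (volume.withDensity ((fun _ x => ENNReal.ofReal (gaussDensity τ x)) i)) := by
      intro i
      change SigmaFinite (entryLaw τ)
      infer_instance
    refine (pi_withDensity_fin (volume : Measure ℂ) (fun _ : Fin (n + 1) => fun x =>
      ENNReal.ofReal (gaussDensity τ x)) fun _ => measurable_ofReal_gaussDensity τ).trans ?_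
    congr 1
    funext r
    exact (ENNReal.ofReal_prod_of_nonneg fun i _ => gaussDensity_nonneg τ _).symm
  have hvol := (volume_preserving_piFinSuccAbove (fun _ : Fin (n + 1) => ℂ) 0).symm
  have hshift : ∀ (η : ℂ) (r : Fin n → ℂ),
      rowOfTail v η (r + Fin.tail (rowMean τ v (η - ζ)))
        = rowOfTail v ζ r - rowMean τ v ζ + rowMean τ v η := by
    intro η r
    have h0 := dotProduct_rowMean hD.ne' (η - ζ)
    rw [dotProduct, Fin.sum_univ_succ, hv0, mul_one] at h0
    have h3 : rowOfTail v ζ r - rowMean τ v ζ + rowMean τ v η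
        = rowOfTail v ζ r + rowMean τ v (η - ζ) := by
      rw [rowMean_sub]
      abel
    rw [h3]
    funext i
    refine Fin.cases ?_ (fun j => ?_) i
    · simp only [rowOfTail, Fin.cons_zero, Pi.add_apply, add_mul, Finset.sum_add_distrib,
        Fin.tail]
      linear_combination -h0
    · simp [rowOfTail, Fin.tail]
  -- The two rows have the same component orthogonal to `v`, so by `rowQuad_add_rowMean` their
  -- densities differ only by the factors depending on η and ζ.
  have hdens : ∀ (η : ℂ) (r : Fin n → ℂ), ENNReal.ofReal (Real.exp (-rowExponent τ v ζ))
      * P (rowOfTail v η (r + Fin.tail (rowMean τ v (η - ζ))))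
        = ENNReal.ofReal (Real.exp (-rowExponent τ v η)) * P (rowOfTail v ζ r) := by
    intro η r
    have hperp : (rowOfTail v ζ r - rowMean τ v ζ) ⬝ᵥ v = 0 := by
      rw [sub_dotProduct, rowOfTail_dotProduct hv0, dotProduct_rowMean hD.ne', sub_self]
    have h1 := rowQuad_add_rowMean hτ hD.ne' η hperp
    have h2 := rowQuad_add_rowMean hτ hD.ne' ζ hperp
    rw [sub_add_cancel] at h2
    simp only [hP]
    rw [hshift, ← ENNReal.ofReal_mul (Real.exp_pos _).le, ← ENNReal.ofReal_mul
      (Real.exp_pos _).le, prod_gaussDensity, prod_gaussDensity, h1, h2, neg_add, neg_add,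
      Real.exp_add, Real.exp_add]
    congr 1
    ring
  have hmain : ENNReal.ofReal (Real.exp (-rowExponent τ v ζ))
      * ∫⁻ r, f (Fin.tail (rowShift τ v ζ r)) ∂(Measure.pi fun _ => entryLaw τ)
      = ENNReal.ofReal (Real.pi * √(rowDisc τ v)) * ∫⁻ r, P (rowOfTail v ζ r) * f r := by
    have hm0 : Measurable fun r => P r * f (Fin.tail (rowShift τ v ζ r)) := hPm.mul hft
    rw [e1, lintegral_withDensity_eq_lintegral_mul _ hPm hft]
    simp only [Pi.mul_apply]
    rw [← hvol.lintegral_comp hm0]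
    have hm1 : Measurable fun x : ℂ × (Fin n → ℂ) =>
        P (Fin.cons x.1 x.2) * f (Fin.tail (rowShift τ v ζ (Fin.cons x.1 x.2))) := by
      have : Measurable fun x : ℂ × (Fin n → ℂ) => (Fin.cons x.1 x.2 : Fin (n + 1) → ℂ) := by
        refine measurable_pi_lambda _ fun i => ?_
        refine Fin.cases ?_ (fun j => ?_) i
        · simp only [Fin.cons_zero]; fun_prop
        · simp only [Fin.cons_succ]; fun_prop
      exact hm0.comp this
    have e2 : ∫⁻ x : ℂ × (Fin n → ℂ), (fun r => P r * f (Fin.tail (rowShift τ v ζ r)))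
        ((MeasurableEquiv.piFinSuccAbove (fun _ : Fin (n + 1) => ℂ) 0).symm x)
        = ∫⁻ x : ℂ × (Fin n → ℂ), P (Fin.cons x.1 x.2)
          * f (Fin.tail (rowShift τ v ζ (Fin.cons x.1 x.2))) := by
      refine lintegral_congr fun x => ?_
      have hx : (MeasurableEquiv.piFinSuccAbove (fun _ : Fin (n + 1) => ℂ) 0).symm x
          = Fin.cons x.1 x.2 := by
        rw [MeasurableEquiv.piFinSuccAbove_symm_apply]
        exact Fin.insertNth_zero' x.1 x.2
      rw [hx]
    refine (congrArg _ e2).trans ?_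
    change _ * ∫⁻ x, _ ∂((volume : Measure ℂ).prod (volume : Measure (Fin n → ℂ))) = _
    rw [lintegral_prod_symm _ hm1.aemeasurable]
    -- Translating the first entry by Σ r_j v_j makes η = r·v the coordinate, since `v 0 = 1`.
    have e3 : ∀ r : Fin n → ℂ, ∫⁻ x : ℂ, P (Fin.cons x r)
        * f (Fin.tail (rowShift τ v ζ (Fin.cons x r)))
        = ∫⁻ η : ℂ, P (rowOfTail v η r) * f (r - Fin.tail (rowMean τ v (η - ζ))) := by
      intro r
      rw [← lintegral_sub_right_eq_self _ (∑ j, r j * v j.succ)]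
      refine lintegral_congr fun η => ?_
      congr 2
      have : (Fin.cons (η - ∑ j, r j * v j.succ) r : Fin (n + 1) → ℂ) = rowOfTail v η r := rfl
      rw [this, rowShift, rowOfTail_dotProduct hv0, rowMean_sub]
      funext j
      simp [Fin.tail, rowOfTail]
      ring
    simp_rw [e3]
    have hm2 : Measurable fun x : (Fin n → ℂ) × ℂ => P (rowOfTail v x.2 x.1)
        * f (x.1 - Fin.tail (rowMean τ v (x.2 - ζ))) := by
      refine (hPm.comp ?_).mul (hf.comp ?_)
      · exact ((continuous_rowOfTail v).comp continuous_swap).measurable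
      · have := continuous_rowMean τ v
        refine Continuous.measurable ?_
        unfold Fin.tail
        fun_prop
    rw [lintegral_lintegral_swap hm2.aemeasurable]
    have e4 : ∀ η : ℂ, ∫⁻ r : Fin n → ℂ, P (rowOfTail v η r)
        * f (r - Fin.tail (rowMean τ v (η - ζ)))
        = ∫⁻ r : Fin n → ℂ, P (rowOfTail v η (r + Fin.tail (rowMean τ v (η - ζ)))) * f r := by
      intro η
      rw [← lintegral_add_right_eq_self _ (Fin.tail (rowMean τ v (η - ζ)))]
      simp
    have hPr : ∀ η, Measurable fun r : Fin n → ℂ => P (rowOfTail v η r) := fun η =>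
      hPm.comp ((continuous_rowOfTail v).comp (Continuous.prodMk_right η)).measurable
    simp_rw [e4]
    rw [← lintegral_const_mul' _ _ ENNReal.ofReal_ne_top]
    have e5 : ∀ η : ℂ, ENNReal.ofReal (Real.exp (-rowExponent τ v ζ)) * ∫⁻ r : Fin n → ℂ,
        P (rowOfTail v η (r + Fin.tail (rowMean τ v (η - ζ)))) * f r
        = ENNReal.ofReal (Real.exp (-rowExponent τ v η)) * ∫⁻ r, P (rowOfTail v ζ r) * f r := by
      intro η
      rw [← lintegral_const_mul' _ _ ENNReal.ofReal_ne_top,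
        ← lintegral_const_mul' _ _ ENNReal.ofReal_ne_top]
      refine lintegral_congr fun r => ?_
      rw [← mul_assoc, hdens, mul_assoc]
    simp_rw [e5]
    rw [lintegral_mul_const'' _ (by
      refine Measurable.aemeasurable ?_
      have : Continuous (rowExponent τ v) := by
        unfold rowExponent
        have : Continuous fun ζ : ℂ => (star (v ⬝ᵥ v) * ζ ^ 2).re :=
          Complex.continuous_re.comp (by fun_prop)
        fun_prop
      have := this.measurable
      fun_prop), lintegral_rowExponent hτ0 hτ1 hv]
  have hpos : 0 < Real.pi * √(rowDisc τ v) := by positivity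
  rw [rowDensity, ENNReal.ofReal_mul (by positivity), mul_assoc, hmain, ← mul_assoc,
    ← ENNReal.ofReal_mul (by positivity), inv_mul_cancel₀ hpos.ne', ENNReal.ofReal_one, one_mul]

end Row

/-! ### A rank-two determinant -/

section LinearAlgebra

variable {n : ℕ} {τ : ℝ}

/-- Sylvester's identity between the characteristic polynomials of V W and W V, evaluated at `y`. -/
theorem det_smul_one_add_mul (hn : 1 ≤ n) (V : Matrix (Fin (n + 1)) (Fin 2) ℂ)
    (W : Matrix (Fin 2) (Fin (n + 1)) ℂ) (y : ℂ) :
    (y • (1 : Matrix (Fin (n + 1)) (Fin (n + 1)) ℂ) + V * W).det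
      = y ^ (n - 1) * (y • (1 : Matrix (Fin 2) (Fin 2) ℂ) + W * V).det := by
  have h := congrArg (Polynomial.eval y) (Matrix.charpoly_mul_comm_of_le V (-W)
    (by simp only [Fintype.card_fin]; omega))
  rw [Polynomial.eval_mul, Matrix.eval_charpoly, Matrix.eval_charpoly] at h
  simp only [Fintype.card_fin, Polynomial.eval_pow, Polynomial.eval_X, Matrix.scalar_apply,
    Matrix.mul_neg, Matrix.neg_mul, sub_neg_eq_add] at h
  rw [Matrix.smul_one_eq_diagonal, Matrix.smul_one_eq_diagonal, h]
  congr 2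

/-- The vector `v` and its conjugate as columns. -/
def conjPair (v : Fin (n + 1) → ℂ) : Matrix (Fin (n + 1)) (Fin 2) ℂ :=
  Matrix.of fun i => ![v i, star (v i)]

theorem conjPair_gram (v : Fin (n + 1) → ℂ) :
    (conjPair v)ᴴ * conjPair v
      = !![(vecNormSq v : ℂ), star (v ⬝ᵥ v); v ⬝ᵥ v, (vecNormSq v : ℂ)] := by
  have h := sum_star_mul_self v
  have h' : ∑ i, star (v i) * v i = vecNormSq v := by
    rw [← h]; exact Finset.sum_congr rfl fun i _ => mul_comm _ _
  ext i j
  fin_cases i <;> fin_cases j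
  · simpa [conjPair, Matrix.mul_apply] using h'
  · simp [conjPair, Matrix.mul_apply, dotProduct]
  · simp [conjPair, Matrix.mul_apply, dotProduct]
  · simpa [conjPair, Matrix.mul_apply] using h

/-- The mean of the matrix `z - X + v v*/|v|²` given that `v` is an eigenvector of `X` at `z`. -/
def shiftedMean (τ : ℝ) (v : Fin (n + 1) → ℂ) (z : ℂ) : Matrix (Fin (n + 1)) (Fin (n + 1)) ℂ :=
  Matrix.of fun i j => (if i = j then z else 0) - rowMean τ v (z * v i) j
    + v i * (star (v j) / vecNormSq v)

/-- The covariance matrix of a row `r` given `r ⬝ᵥ v`. -/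
def rowCov (τ : ℝ) (v : Fin (n + 1) → ℂ) : Matrix (Fin (n + 1)) (Fin (n + 1)) ℂ :=
  Matrix.of fun k j => (if k = j then 1 else 0)
    - ((vecNormSq v * v k - τ ^ 2 * (v ⬝ᵥ v) * star (v k)) * star (v j)
      + τ ^ 2 * (vecNormSq v * star (v k) - star (v ⬝ᵥ v) * v k) * v j) / rowDisc τ v

/-- The coefficients of `shiftedMean` with respect to `v` and its conjugate. -/
def meanCoeff (τ : ℝ) (v : Fin (n + 1) → ℂ) (z : ℂ) : Matrix (Fin 2) (Fin 2) ℂ :=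
  !![-(vecNormSq v * z / rowDisc τ v) + 1 / vecNormSq v,
      τ ^ 2 * star (v ⬝ᵥ v) * z / rowDisc τ v;
    τ * (v ⬝ᵥ v) * star z / rowDisc τ v, -(τ * vecNormSq v * star z / rowDisc τ v)]

/-- The coefficients of `rowCov` with respect to `v` and its conjugate. -/
def covCoeff (τ : ℝ) (v : Fin (n + 1) → ℂ) : Matrix (Fin 2) (Fin 2) ℂ :=
  !![(vecNormSq v / rowDisc τ v : ℂ), -(τ ^ 2 * star (v ⬝ᵥ v) / rowDisc τ v);
    -(τ ^ 2 * (v ⬝ᵥ v) / rowDisc τ v), τ ^ 2 * vecNormSq v / rowDisc τ v]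

theorem shiftedMean_eq (v : Fin (n + 1) → ℂ) (z : ℂ) :
    shiftedMean τ v z = z • 1 + conjPair v * (meanCoeff τ v z * (conjPair v)ᴴ) := by
  ext i j
  simp only [shiftedMean, rowMean, Matrix.of_apply, Matrix.add_apply, Matrix.smul_apply,
    Matrix.one_apply, Matrix.mul_apply, Fin.sum_univ_two, conjPair, meanCoeff,
    Matrix.conjTranspose_apply, Matrix.cons_val_zero, Matrix.cons_val_one,
    smul_eq_mul, mul_ite, mul_one, mul_zero, star_mul', star_star, Matrix.cons_val', Matrix.cons_val_fin_one]
  ring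

theorem rowCov_eq (v : Fin (n + 1) → ℂ) :
    rowCov τ v = 1 - conjPair v * (covCoeff τ v * (conjPair v)ᴴ) := by
  ext i j
  simp only [rowCov, Matrix.of_apply, Matrix.sub_apply,
    Matrix.one_apply, Matrix.mul_apply, Fin.sum_univ_two, conjPair, covCoeff,
    Matrix.conjTranspose_apply, Matrix.cons_val_zero, Matrix.cons_val_one, star_star,
    Matrix.cons_val', Matrix.cons_val_fin_one]
  ring

/-- The ratio `|vᵀ v|² / |v|⁴`. -/
def overlapRatio (v : Fin (n + 1) → ℂ) : ℝ := ‖v ⬝ᵥ v‖ ^ 2 / vecNormSq v ^ 2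

/-- The residual variance in the direction of the conjugate of the eigenvector. -/
def residualVar (τ q : ℝ) : ℝ := (1 - τ ^ 2) / (1 - τ ^ 2 * q)

/-- The distance of `z` to the conditional mean of the entry in the direction of the conjugate of
the eigenvector, squared. -/
def meanDistSq (τ q : ℝ) (z : ℂ) : ℝ :=
  ‖z - ((τ * (1 - q) / (1 - τ ^ 2 * q) : ℝ) : ℂ) * star z‖ ^ 2

-- Both `rowCov` and `shiftedMean` are multiples of the identity up to the span of `v` and its
-- conjugate, so Sylvester's identity leaves a 2 × 2 determinant. It is only linear in t because
-- `rowCov` annihilates `v`: the residual has no component r·v.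
set_option maxRecDepth 20000 in
theorem det_rowCov_add (hτ0 : 0 < τ) (hτ1 : τ < 1) (hn : 1 ≤ n) {v : Fin (n + 1) → ℂ}
    (hv : 0 < vecNormSq v) (z t : ℂ) :
    (t • rowCov τ v + (shiftedMean τ v z)ᴴ * shiftedMean τ v z).det
      = (t + (‖z‖ ^ 2 : ℝ)) ^ (n - 1) * ((residualVar τ (overlapRatio v) : ℝ) * t
        + (meanDistSq τ (overlapRatio v) z : ℝ)) := by
  have hz : star z * z = ((‖z‖ ^ 2 : ℝ) : ℂ) := by
    rw [RCLike.star_def, Complex.conj_mul']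
    push_cast
    rfl
  have h1 : t • rowCov τ v + (shiftedMean τ v z)ᴴ * shiftedMean τ v z
      = (t + (‖z‖ ^ 2 : ℝ)) • (1 : Matrix (Fin (n + 1)) (Fin (n + 1)) ℂ)
        + conjPair v * ((-(t • covCoeff τ v) + star z • meanCoeff τ v z + z • (meanCoeff τ v z)ᴴ
          + (meanCoeff τ v z)ᴴ * ((conjPair v)ᴴ * conjPair v) * meanCoeff τ v z)
            * (conjPair v)ᴴ) := by
    rw [rowCov_eq, shiftedMean_eq, ← hz, Matrix.conjTranspose_add, Matrix.conjTranspose_smul,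
      Matrix.conjTranspose_one, Matrix.conjTranspose_mul, Matrix.conjTranspose_mul,
      Matrix.conjTranspose_conjTranspose]
    simp only [Matrix.add_mul, Matrix.mul_add, Matrix.smul_mul, Matrix.mul_smul, Matrix.one_mul,
      Matrix.mul_one, Matrix.mul_assoc, smul_sub, smul_add, add_smul, mul_smul, Matrix.neg_mul,
      Matrix.mul_neg, smul_comm z (star z)]
    abel
  rw [h1, det_smul_one_add_mul hn, Matrix.mul_assoc, conjPair_gram, Matrix.det_fin_two]
  congr 1
  have hD := rowDisc_pos hτ0 hτ1 hv
  have hDc : (rowDisc τ v : ℂ) ≠ 0 := by exact_mod_cast hD.ne'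
  have hv' : (vecNormSq v : ℂ) ≠ 0 := by exact_mod_cast hv.ne'
  have hq : ((overlapRatio v : ℝ) : ℂ) = (v ⬝ᵥ v) * star (v ⬝ᵥ v) / (vecNormSq v : ℂ) ^ 2 := by
    rw [overlapRatio, RCLike.star_def, Complex.mul_conj']
    push_cast
    rfl
  have hm : ((meanDistSq τ (overlapRatio v) z : ℝ) : ℂ)
      = (z - ((τ * (1 - overlapRatio v) / (1 - τ ^ 2 * overlapRatio v) : ℝ) : ℂ) * star z)
        * (star z - ((τ * (1 - overlapRatio v) / (1 - τ ^ 2 * overlapRatio v) : ℝ) : ℂ) * z) := by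
    rw [meanDistSq]
    push_cast
    rw [← Complex.mul_conj']
    simp only [RCLike.star_def, map_sub, map_mul, map_div₀, map_one, map_pow, Complex.conj_ofReal,
      Complex.conj_conj]
  have hDq : (1 : ℂ) - τ ^ 2 * (overlapRatio v : ℝ) = rowDisc τ v / (vecNormSq v : ℂ) ^ 2 := by
    rw [hq, ofReal_rowDisc]
    field_simp
  rw [hm, residualVar, ← hz]
  push_cast
  rw [hDq, hq]
  have hstar : ∀ x : ℝ, star (x : ℂ) = x := fun x => Complex.conj_ofReal x
  simp only [meanCoeff, covCoeff, Matrix.add_apply, Matrix.smul_apply, Matrix.neg_apply,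
    Matrix.one_apply, Matrix.mul_apply, Fin.sum_univ_two, Matrix.conjTranspose_apply,
    Matrix.cons_val_zero, Matrix.cons_val_one, smul_eq_mul, star_star,
    Matrix.of_apply, Matrix.cons_val', Matrix.cons_val_fin_one, star_neg, star_add, star_mul',
    star_div₀, hstar, star_one, ← Complex.ofReal_pow, if_true, if_false, one_ne_zero,
    zero_ne_one, mul_one, mul_zero, zero_add]
  have hrel := ofReal_rowDisc τ v
  push_cast
  -- From here on numbers and their conjugates are independent symbols; the claim is a rational
  -- identity, with `hrel` as the only relation.
  generalize v ⬝ᵥ v = S at *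
  generalize star S = Sb at *
  generalize star z = zb at *
  generalize (vecNormSq v : ℂ) = N at *
  generalize (τ : ℂ) = T at *
  generalize (rowDisc τ v : ℂ) = D at *
  field_simp
  rw [hrel]
  ring

end LinearAlgebra

/-! ### The functional t^k ↦ k! on the polynomials that occur -/

section FactorialFunctional

/-- The polynomial `∑ k ≤ m, m! / k! x ^ k`. -/
def expPoly (m : ℕ) (x : ℝ) : ℝ := ∑ k ∈ Finset.range (m + 1), (m.factorial / k.factorial) * x ^ k

/-- This is the evaluation of ∫₀^∞ exp(-t) (t + x)^m dt by the binomial theorem. -/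
theorem factorialFunctional_X_add_C_pow (m : ℕ) (x : ℝ) :
    factorialFunctional ((Polynomial.X + Polynomial.C (x : ℂ)) ^ m) = (expPoly m x : ℂ) := by
  rw [add_comm, add_pow, map_sum, expPoly]
  push_cast
  refine Finset.sum_congr rfl fun k hk => ?_
  have hk' : k ≤ m := Nat.lt_succ_iff.1 (Finset.mem_range.1 hk)
  have h : Polynomial.C (x : ℂ) ^ k * Polynomial.X ^ (m - k) * (m.choose k : Polynomial ℂ)
      = Polynomial.C ((x : ℂ) ^ k * m.choose k) * Polynomial.X ^ (m - k) := by
    rw [Polynomial.C_mul, Polynomial.C_pow, Polynomial.C_eq_natCast]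
    ring
  rw [h, factorialFunctional_C_mul_X_pow]
  have h2 : ((m.choose k * k.factorial * (m - k).factorial : ℕ) : ℂ) = m.factorial := by
    exact_mod_cast Nat.choose_mul_factorial_mul_factorial hk'
  have h3 : (k.factorial : ℂ) ≠ 0 := by exact_mod_cast k.factorial_ne_zero
  rw [← h2]
  push_cast
  field_simp

/-- The conditional second moment of the Jacobian. -/
def jacobianMoment (m : ℕ) (x c₁ c₀ : ℝ) : ℝ :=
  c₁ * (expPoly (m + 1) x - x * expPoly m x) + c₀ * expPoly m x

/-- The linear factor is rewritten as c₁ ((X + x) - x) + c₀, so that only powers of X + x occur. -/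
theorem factorialFunctional_jacobian (m : ℕ) (x c₁ c₀ : ℝ) :
    factorialFunctional ((Polynomial.X + Polynomial.C (x : ℂ)) ^ m
      * (Polynomial.C (c₁ : ℂ) * Polynomial.X + Polynomial.C (c₀ : ℂ)))
      = (jacobianMoment m x c₁ c₀ : ℂ) := by
  have h : (Polynomial.X + Polynomial.C (x : ℂ)) ^ m
      * (Polynomial.C (c₁ : ℂ) * Polynomial.X + Polynomial.C (c₀ : ℂ))
      = (c₁ : ℂ) • ((Polynomial.X + Polynomial.C (x : ℂ)) ^ (m + 1)
          - (x : ℂ) • (Polynomial.X + Polynomial.C (x : ℂ)) ^ m)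
        + (c₀ : ℂ) • (Polynomial.X + Polynomial.C (x : ℂ)) ^ m := by
    simp only [Polynomial.smul_eq_C_mul]
    ring
  rw [h, map_add, map_smul, map_smul, map_sub, map_smul, factorialFunctional_X_add_C_pow,
    factorialFunctional_X_add_C_pow, jacobianMoment]
  push_cast
  simp only [smul_eq_mul]

end FactorialFunctional

/-! ### Covariance of the residual of a row -/

section RowMoments

variable {n : ℕ} {τ : ℝ}

theorem integral_mul_add_mul {α : Type*} [MeasurableSpace α] {μ : Measure α} {f g : α → ℂ}
    (hf : Integrable f μ) (hg : Integrable g μ) (a b : ℂ) :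
    ∫ x, a * f x + b * g x ∂μ = a * ∫ x, f x ∂μ + b * ∫ x, g x ∂μ := by
  rw [integral_add (hf.const_mul a) (hg.const_mul b), integral_const_mul, integral_const_mul]

theorem integral_mul_add_mul_add {α : Type*} [MeasurableSpace α] {μ : Measure α}
    {f g f' g' : α → ℂ} (hf : Integrable f μ) (hg : Integrable g μ) (hf' : Integrable f' μ)
    (hg' : Integrable g' μ) (a b a' b' : ℂ) :
    ∫ x, (a * f x + b * g x) + (a' * f' x + b' * g' x) ∂μ
      = (a * ∫ x, f x ∂μ + b * ∫ x, g x ∂μ) + (a' * ∫ x, f' x ∂μ + b' * ∫ x, g' x ∂μ) := by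
  rw [integral_add (f := fun x => a * f x + b * g x) (g := fun x => a' * f' x + b' * g' x)
    ((hf.const_mul a).add (hg.const_mul b)) ((hf'.const_mul a').add (hg'.const_mul b')),
    integral_mul_add_mul hf hg, integral_mul_add_mul hf' hg']

theorem memLp_eval_pi_entryLaw (hτ0 : 0 < τ) (hτ1 : τ < 1) (l : Fin n) :
    MemLp (fun r : Fin n → ℂ => r l) 2 (Measure.pi fun _ => entryLaw τ) := by
  have := isProbabilityMeasure_entryLaw hτ0 hτ1
  exact (memLp_entryLaw hτ0 hτ1).comp_measurePreserving
    (measurePreserving_eval (fun _ : Fin n => entryLaw τ) l)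

theorem integral_eval_pi_entryLaw (hτ0 : 0 < τ) (hτ1 : τ < 1) (l : Fin n) :
    ∫ r : Fin n → ℂ, r l ∂(Measure.pi fun _ => entryLaw τ) = 0 := by
  have := isProbabilityMeasure_entryLaw hτ0 hτ1
  rw [integral_eval, integral_entryLaw hτ0 hτ1]

theorem integral_mul_pi_entryLaw (hτ0 : 0 < τ) (hτ1 : τ < 1) (l m : Fin n) :
    ∫ r : Fin n → ℂ, r l * r m ∂(Measure.pi fun _ => entryLaw τ) = if l = m then (τ : ℂ) else 0 := by
  have := isProbabilityMeasure_entryLaw hτ0 hτ1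
  split_ifs with h
  · subst h
    rw [integral_comp_eval (μ := fun _ : Fin n => entryLaw τ) (f := fun x : ℂ => x * x)
      (by fun_prop), integral_mul_self_entryLaw hτ0 hτ1]
  · have hi := iIndepFun_pi (μ := fun _ : Fin n => entryLaw τ) (X := fun _ (x : ℂ) => x)
      fun _ => aemeasurable_id
    rw [(hi.indepFun h).integral_fun_mul_eq_mul_integral
      (memLp_eval_pi_entryLaw hτ0 hτ1 l).aestronglyMeasurable
      (memLp_eval_pi_entryLaw hτ0 hτ1 m).aestronglyMeasurable, integral_eval_pi_entryLaw hτ0 hτ1, zero_mul]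

theorem integral_star_mul_pi_entryLaw (hτ0 : 0 < τ) (hτ1 : τ < 1) (l m : Fin n) :
    ∫ r : Fin n → ℂ, star (r l) * r m ∂(Measure.pi fun _ => entryLaw τ)
      = if l = m then 1 else 0 := by
  have := isProbabilityMeasure_entryLaw hτ0 hτ1
  split_ifs with h
  · subst h
    rw [integral_comp_eval (μ := fun _ : Fin n => entryLaw τ) (f := fun x : ℂ => star x * x)
      (by fun_prop), integral_star_mul_self_entryLaw hτ0 hτ1]
  · have hi := iIndepFun_pi (μ := fun _ : Fin n => entryLaw τ) (X := fun _ (x : ℂ) => x)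
      fun _ => aemeasurable_id
    have hi2 := (hi.indepFun h).comp (φ := fun x : ℂ => star x) (ψ := fun x : ℂ => x)
      (by fun_prop) measurable_id
    rw [hi2.integral_fun_mul_eq_mul_integral (X := fun r : Fin n → ℂ => star (r l))
      (Y := fun r : Fin n → ℂ => r m)
      (memLp_eval_pi_entryLaw hτ0 hτ1 l).star.aestronglyMeasurable
      (memLp_eval_pi_entryLaw hτ0 hτ1 m).aestronglyMeasurable, integral_eval_pi_entryLaw hτ0 hτ1, mul_zero]

theorem memLp_linear_pi_entryLaw (hτ0 : 0 < τ) (hτ1 : τ < 1) (a b : Fin n → ℂ) :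
    MemLp (fun r : Fin n → ℂ => ∑ l, (a l * r l + b l * star (r l))) 2
      (Measure.pi fun _ => entryLaw τ) :=
  memLp_finsetSum _ fun l _ => ((memLp_eval_pi_entryLaw hτ0 hτ1 l).const_mul _).add
    ((memLp_eval_pi_entryLaw hτ0 hτ1 l).star.const_mul _)

theorem integral_linear_pi_entryLaw (hτ0 : 0 < τ) (hτ1 : τ < 1) (a b : Fin n → ℂ) :
    ∫ r : Fin n → ℂ, ∑ l, (a l * r l + b l * star (r l)) ∂(Measure.pi fun _ => entryLaw τ) = 0 := by
  have := isProbabilityMeasure_entryLaw hτ0 hτ1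
  have hi : ∀ l, Integrable (fun r : Fin n → ℂ => r l) (Measure.pi fun _ => entryLaw τ) :=
    fun l => (memLp_eval_pi_entryLaw hτ0 hτ1 l).integrable one_le_two
  have hs : ∀ l, Integrable (fun r : Fin n → ℂ => star (r l)) (Measure.pi fun _ => entryLaw τ) :=
    fun l => (memLp_eval_pi_entryLaw hτ0 hτ1 l).star.integrable one_le_two
  have hstar : ∀ l, ∫ r : Fin n → ℂ, star (r l) ∂(Measure.pi fun _ => entryLaw τ) = 0 := by
    intro l
    have := integral_conj (f := fun r : Fin n → ℂ => r l) (μ := Measure.pi fun _ => entryLaw τ)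
    rw [integral_eval_pi_entryLaw hτ0 hτ1, map_zero] at this
    exact this
  rw [integral_finsetSum (f := fun l (r : Fin n → ℂ) => a l * r l + b l * star (r l)) _
    fun l _ => ((hi l).const_mul _).add ((hs l).const_mul _)]
  refine Finset.sum_eq_zero fun l _ => ?_
  rw [integral_mul_add_mul (hi l) (hs l), hstar, integral_eval_pi_entryLaw hτ0 hτ1]
  simp

/-- Independence and centring kill the off-diagonal terms; on the diagonal only E|r|² = 1 and E r² =
τ enter. -/
theorem integral_star_linear_mul_linear (hτ0 : 0 < τ) (hτ1 : τ < 1) (a b a' b' : Fin n → ℂ) :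
    ∫ r : Fin n → ℂ, star (∑ l, (a l * r l + b l * star (r l)))
        * ∑ l, (a' l * r l + b' l * star (r l)) ∂(Measure.pi fun _ => entryLaw τ)
      = ∑ l, (star (a l) * a' l + star (b l) * b' l
        + τ * (star (a l) * b' l + star (b l) * a' l)) := by
  have h2 := memLp_eval_pi_entryLaw (n := n) hτ0 hτ1
  have i1 : ∀ l m, Integrable (fun r : Fin n → ℂ => star (r l) * r m)
      (Measure.pi fun _ => entryLaw τ) := fun l m => (h2 l).star.integrable_mul (h2 m)
  have i2 : ∀ l m, Integrable (fun r : Fin n → ℂ => r l * r m)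
      (Measure.pi fun _ => entryLaw τ) := fun l m => (h2 l).integrable_mul (h2 m)
  have i3 : ∀ l m, Integrable (fun r : Fin n → ℂ => star (r l * r m))
      (Measure.pi fun _ => entryLaw τ) := fun l m => by
    have := (h2 l).star.integrable_mul (h2 m).star
    refine this.congr (Eventually.of_forall fun r => ?_)
    simp
  have hstar : ∀ l m, ∫ r : Fin n → ℂ, star (r l * r m) ∂(Measure.pi fun _ => entryLaw τ)
      = if l = m then (τ : ℂ) else 0 := by
    intro l m
    have := integral_conj (f := fun r : Fin n → ℂ => r l * r m)
      (μ := Measure.pi fun _ => entryLaw τ)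
    rw [integral_mul_pi_entryLaw hτ0 hτ1] at this
    refine this.trans ?_
    split_ifs <;> simp
  have key : ∀ r : Fin n → ℂ, star (∑ l, (a l * r l + b l * star (r l)))
        * ∑ l, (a' l * r l + b' l * star (r l))
      = ∑ l, ∑ m, (((star (a l) * a' m) * (star (r l) * r m)
        + (star (b l) * b' m) * (star (r m) * r l))
        + ((star (a l) * b' m) * star (r l * r m) + (star (b l) * a' m) * (r l * r m))) := by
    intro r
    rw [star_sum, Finset.sum_mul_sum]
    refine Finset.sum_congr rfl fun l _ => Finset.sum_congr rfl fun m _ => ?_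
    simp only [star_add, star_mul', star_star]
    ring
  have hI : ∀ l m, Integrable (fun r : Fin n → ℂ => ((star (a l) * a' m) * (star (r l) * r m)
        + (star (b l) * b' m) * (star (r m) * r l))
        + ((star (a l) * b' m) * star (r l * r m) + (star (b l) * a' m) * (r l * r m)))
      (Measure.pi fun _ => entryLaw τ) := fun l m =>
    (((i1 l m).const_mul _).add ((i1 m l).const_mul _)).add
      (((i3 l m).const_mul _).add ((i2 l m).const_mul _))
  simp_rw [key]
  rw [integral_finsetSum _ fun l _ => integrable_finsetSum _ fun m _ => hI l m]
  refine Finset.sum_congr rfl fun l _ => ?_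
  rw [integral_finsetSum _ fun m _ => hI l m]
  rw [Finset.sum_eq_single_of_mem l (Finset.mem_univ _)]
  · rw [integral_mul_add_mul_add (i1 l l) (i1 l l) (i3 l l) (i2 l l)]
    simp only [hstar, integral_mul_pi_entryLaw hτ0 hτ1,
      integral_star_mul_pi_entryLaw hτ0 hτ1, if_true]
    ring
  · intro m _ hm
    rw [integral_mul_add_mul_add (i1 l m) (i1 m l) (i3 l m) (i2 l m)]
    simp only [hstar, integral_mul_pi_entryLaw hτ0 hτ1,
      integral_star_mul_pi_entryLaw hτ0 hτ1, if_neg hm, if_neg hm.symm]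
    ring

/-- The coefficients of `ζ` and of its conjugate in `rowMean`. -/
def rowMeanCoeff (τ : ℝ) (v : Fin (n + 1) → ℂ) (j : Fin (n + 1)) : ℂ × ℂ :=
  ((star (v j) * vecNormSq v - τ ^ 2 * v j * star (v ⬝ᵥ v)) / rowDisc τ v,
    τ * (v j * vecNormSq v - star (v j) * (v ⬝ᵥ v)) / rowDisc τ v)

/-- The residual of a row `r` after projection to its part determined by `r ⬝ᵥ v`. -/
def rowResidual (τ : ℝ) (v r : Fin (n + 1) → ℂ) : Fin (n + 1) → ℂ := r - rowMean τ v (r ⬝ᵥ v)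

theorem rowResidual_apply (v r : Fin (n + 1) → ℂ) (j : Fin (n + 1)) :
    rowResidual τ v r j = ∑ l, (((if j = l then 1 else 0) - (rowMeanCoeff τ v j).1 * v l) * r l
      + (-(rowMeanCoeff τ v j).2 * star (v l)) * star (r l)) := by
  have h1 : ∑ l, (((if j = l then 1 else 0) - (rowMeanCoeff τ v j).1 * v l) * r l
      + (-(rowMeanCoeff τ v j).2 * star (v l)) * star (r l))
      = r j - (rowMeanCoeff τ v j).1 * (r ⬝ᵥ v) - (rowMeanCoeff τ v j).2 * star (r ⬝ᵥ v) := by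
    simp only [dotProduct, star_sum, Finset.mul_sum, sub_mul, Finset.sum_add_distrib,
      Finset.sum_sub_distrib, ite_mul, one_mul, zero_mul, Finset.sum_ite_eq, Finset.mem_univ,
      if_true, star_mul']
    rw [sub_eq_add_neg (r j - _), ← Finset.sum_neg_distrib]
    congr 1
    · congr 1
      exact Finset.sum_congr rfl fun l _ => by ring
    · exact Finset.sum_congr rfl fun l _ => by ring
  rw [h1, rowResidual, Pi.sub_apply, rowMean, rowMeanCoeff]
  ring

theorem memLp_rowResidual (hτ0 : 0 < τ) (hτ1 : τ < 1) (v : Fin (n + 1) → ℂ) (j : Fin (n + 1)) :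
    MemLp (fun r => rowResidual τ v r j) 2 (Measure.pi fun _ => entryLaw τ) := by
  simp_rw [rowResidual_apply]
  exact memLp_linear_pi_entryLaw hτ0 hτ1 _ _

theorem integral_rowResidual (hτ0 : 0 < τ) (hτ1 : τ < 1) (v : Fin (n + 1) → ℂ) (j : Fin (n + 1)) :
    ∫ r, rowResidual τ v r j ∂(Measure.pi fun _ => entryLaw τ) = 0 := by
  simp_rw [rowResidual_apply]
  exact integral_linear_pi_entryLaw hτ0 hτ1 _ _

/-- Expanding the residual as a real-linear function of the row reduces the covariance to the sums
|v|² and vᵀv; the result simplifies to `rowCov` by the definition of `rowDisc`. -/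
theorem integral_star_rowResidual_mul (hτ0 : 0 < τ) (hτ1 : τ < 1) {v : Fin (n + 1) → ℂ}
    (hv : 0 < vecNormSq v) (k j : Fin (n + 1)) :
    ∫ r, star (rowResidual τ v r k) * rowResidual τ v r j ∂(Measure.pi fun _ => entryLaw τ)
      = rowCov τ v k j := by
  simp_rw [rowResidual_apply]
  rw [integral_star_linear_mul_linear hτ0 hτ1]
  have hN := sum_star_mul_self v
  have hD : (rowDisc τ v : ℂ) ≠ 0 := by exact_mod_cast (rowDisc_pos hτ0 hτ1 hv).ne'
  have hrel := ofReal_rowDisc τ v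
  have hstar : ∀ x : ℝ, star (x : ℂ) = x := fun x => Complex.conj_ofReal x
  have expand : ∀ α β α' β' : ℂ, ∑ l, (star ((if k = l then 1 else 0) - α * v l)
        * ((if j = l then 1 else 0) - α' * v l)
        + star (-β * star (v l)) * (-β' * star (v l))
        + τ * (star ((if k = l then 1 else 0) - α * v l) * (-β' * star (v l))
          + star (-β * star (v l)) * ((if j = l then 1 else 0) - α' * v l)))
      = (if k = j then 1 else 0) - α' * v k - star α * star (v j) + star α * α' * vecNormSq v
        + star β * β' * vecNormSq v
        + τ * (-β' * star (v k) + star α * β' * star (v ⬝ᵥ v) - star β * v j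
          + star β * α' * (v ⬝ᵥ v)) := by
    intro α β α' β'
    have e : ∀ l, (star ((if k = l then 1 else 0) - α * v l)
        * ((if j = l then 1 else 0) - α' * v l)
        + star (-β * star (v l)) * (-β' * star (v l))
        + τ * (star ((if k = l then 1 else 0) - α * v l) * (-β' * star (v l))
          + star (-β * star (v l)) * ((if j = l then 1 else 0) - α' * v l)))
      = (if k = l then (if j = l then 1 else 0) else 0) - (if k = l then α' * v l else 0)
        - (if j = l then star α * star (v l) else 0) + (star α * α') * (v l * star (v l))
        + (star β * β') * (v l * star (v l))
        + τ * (-(if k = l then β' * star (v l) else 0) + (star α * β') * star (v l * v l)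
          - (if j = l then star β * v l else 0) + (star β * α') * (v l * v l)) := by
      intro l
      split_ifs <;> simp only [star_sub, star_mul', star_one, star_zero, star_neg, star_star] <;> ring
    simp_rw [e]
    simp only [Finset.sum_add_distrib, Finset.sum_sub_distrib, ← Finset.mul_sum,
      Finset.sum_neg_distrib, Finset.sum_ite_eq, Finset.mem_univ, if_true, hN, dotProduct, star_sum]
    rw [show (if j = k then (1 : ℂ) else 0) = if k = j then 1 else 0 by simp [eq_comm]]
    ring
  rw [expand, rowCov, Matrix.of_apply]
  simp only [rowMeanCoeff, star_div₀, star_sub, star_mul', star_star, hstar, star_pow]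
  generalize v ⬝ᵥ v = S at *
  generalize star S = Sb at *
  generalize (vecNormSq v : ℂ) = N at *
  generalize (rowDisc τ v : ℂ) = D at *
  field_simp
  rw [hrel]
  ring

end RowMoments

/-! ### The conditional second moment of the Jacobian -/

section DetMoment

variable {n : ℕ} {τ : ℝ}

/-- The squared modulus of the determinant is a double sum over permutations of products over rows.
Independence turns each product into a product of row moments A i a · conj(A i b) + C b a, and the
permutation identity sums them. Only second moments are used, not the Gaussian form. -/
theorem integral_norm_det_sq {m : ℕ} {E : Type*} [MeasurableSpace E] {ρ : Measure E}
    [IsProbabilityMeasure ρ] {g : E → Fin m → ℂ} (hg : ∀ j, MemLp (fun x => g x j) 2 ρ)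
    (h0 : ∀ j, ∫ x, g x j ∂ρ = 0) {A C : Matrix (Fin m) (Fin m) ℂ}
    (hC : ∀ k j, ∫ x, star (g x k) * g x j ∂ρ = C k j) {P : Polynomial ℂ}
    (hP : ∀ t, (t • C + Aᴴ * A).det = P.eval t) :
    Integrable (fun X : Fin m → E => ‖(Matrix.of fun i j => A i j - g (X i) j).det‖ ^ 2)
      (Measure.pi fun _ => ρ) ∧
    ((∫ X : Fin m → E, ‖(Matrix.of fun i j => A i j - g (X i) j).det‖ ^ 2
      ∂(Measure.pi fun _ => ρ) : ℝ) : ℂ) = factorialFunctional P := by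
  have hi : ∀ j, Integrable (fun x => g x j) ρ := fun j => (hg j).integrable one_le_two
  have his : ∀ j, Integrable (fun x => star (g x j)) ρ :=
    fun j => (hg j).star.integrable one_le_two
  have h0s : ∀ j, ∫ x, star (g x j) ∂ρ = 0 := by
    intro j
    have := integral_conj (f := fun x => g x j) (μ := ρ)
    rw [h0, map_zero] at this
    exact this
  have hint : ∀ i a b, Integrable
      (fun x => (A i a - g x a) * star (A i b - g x b)) ρ := by
    intro i a b
    exact ((memLp_const (A i a)).sub (hg a)).integrable_mul ((memLp_const (A i b)).sub (hg b)).star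
  have hval : ∀ i a b, ∫ x, (A i a - g x a) * star (A i b - g x b) ∂ρ
      = A i a * star (A i b) + C b a := by
    intro i a b
    have e : ∀ x, (A i a - g x a) * star (A i b - g x b)
        = ((A i a * star (A i b)) * 1 + 1 * (star (g x b) * g x a))
          + ((-star (A i b)) * g x a + (-A i a) * star (g x b)) := by
      intro x
      rw [star_sub]
      ring
    simp_rw [e]
    have h2 : Integrable (fun x => star (g x b) * g x a) ρ := (hg b).star.integrable_mul (hg a)
    rw [integral_mul_add_mul_add (f := fun _ : E => (1 : ℂ)) (integrable_const 1)
      h2 (hi a) (his b)]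
    simp only [integral_const, probReal_univ, h0, h0s, one_smul, hC]
    ring
  have hexp : ∀ X : Fin m → E,
      ((‖(Matrix.of fun i j => A i j - g (X i) j).det‖ ^ 2 : ℝ) : ℂ)
      = ∑ σ : Equiv.Perm (Fin m), ∑ π : Equiv.Perm (Fin m),
          (((Equiv.Perm.sign σ : ℤ) : ℂ) * ((Equiv.Perm.sign π : ℤ) : ℂ))
            * ∏ i, ((A i (σ i) - g (X i) (σ i)) * star (A i (π i) - g (X i) (π i))) := by
    intro X
    push_cast
    rw [← Complex.mul_conj', ← Matrix.det_transpose, Matrix.det_apply', map_sum,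
      Finset.sum_mul_sum]
    refine Finset.sum_congr rfl fun σ _ => Finset.sum_congr rfl fun π _ => ?_
    simp only [Matrix.transpose_apply, Matrix.of_apply, map_mul, map_prod, Finset.prod_mul_distrib,
      RCLike.star_def, map_intCast]
    ring
  have hI : ∀ σ π : Equiv.Perm (Fin m), Integrable (fun X : Fin m → E =>
      (((Equiv.Perm.sign σ : ℤ) : ℂ) * ((Equiv.Perm.sign π : ℤ) : ℂ))
        * ∏ i, ((A i (σ i) - g (X i) (σ i)) * star (A i (π i) - g (X i) (π i))))
      (Measure.pi fun _ => ρ) := fun σ π =>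
    (Integrable.fintype_prod_dep (f := fun i x => (A i (σ i) - g x (σ i))
      * star (A i (π i) - g x (π i))) fun i => hint i _ _).const_mul _
  have hIc : Integrable (fun X : Fin m → E =>
      ((‖(Matrix.of fun i j => A i j - g (X i) j).det‖ ^ 2 : ℝ) : ℂ)) (Measure.pi fun _ => ρ) := by
    simp_rw [hexp]
    exact integrable_finsetSum _ fun σ _ => integrable_finsetSum _ fun π _ => hI σ π
  refine ⟨by simpa only [RCLike.re_to_complex, Complex.ofReal_re] using hIc.re, ?_⟩
  rw [← integral_complex_ofReal]
  simp_rw [hexp]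
  rw [integral_finsetSum _ fun σ _ => integrable_finsetSum _ fun π _ => hI σ π,
    ← sum_perm_perm_eq_factorialFunctional A (A.map star) C P (by
      intro t
      rw [← hP t]
      rfl)]
  refine Finset.sum_congr rfl fun σ _ => ?_
  rw [integral_finsetSum _ fun π _ => hI σ π]
  refine Finset.sum_congr rfl fun π _ => ?_
  rw [integral_const_mul, integral_fintype_prod_eq_prod (fun i x => (A i (σ i) - g x (σ i))
      * star (A i (π i) - g x (π i)))]
  simp_rw [hval]
  rfl

theorem rowShift_eq (v r : Fin (n + 1) → ℂ) (ζ : ℂ) :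
    rowShift τ v ζ r = rowResidual τ v r + rowMean τ v ζ := rfl

theorem lintegral_norm_det_shifted (hτ0 : 0 < τ) (hτ1 : τ < 1) (hn : 1 ≤ n)
    {v : Fin (n + 1) → ℂ} (hv : 0 < vecNormSq v) (z : ℂ) :
    ∫⁻ X : Fin (n + 1) → Fin (n + 1) → ℂ, ENNReal.ofReal (‖(Matrix.of fun i j =>
        shiftedMean τ v z i j - rowResidual τ v (X i) j).det‖ ^ 2)
        ∂(Measure.pi fun _ => Measure.pi fun _ => entryLaw τ)
      = ENNReal.ofReal (jacobianMoment (n - 1) (‖z‖ ^ 2) (residualVar τ (overlapRatio v))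
          (meanDistSq τ (overlapRatio v) z)) := by
  have := isProbabilityMeasure_entryLaw hτ0 hτ1
  obtain ⟨hI, hE⟩ := integral_norm_det_sq (memLp_rowResidual hτ0 hτ1 v)
    (integral_rowResidual hτ0 hτ1 v) (A := shiftedMean τ v z)
    (integral_star_rowResidual_mul hτ0 hτ1 hv)
    (P := (Polynomial.X + Polynomial.C ((‖z‖ ^ 2 : ℝ) : ℂ)) ^ (n - 1)
      * (Polynomial.C ((residualVar τ (overlapRatio v) : ℝ) : ℂ) * Polynomial.X
        + Polynomial.C ((meanDistSq τ (overlapRatio v) z : ℝ) : ℂ))) (by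
      intro t
      rw [det_rowCov_add hτ0 hτ1 hn hv]
      simp)
  rw [factorialFunctional_jacobian] at hE
  rw [← Complex.ofReal_injective hE, ofReal_integral_eq_lintegral_ofReal hI
    (Eventually.of_forall fun _ => by positivity)]

theorem rowShift_dotProduct {v : Fin (n + 1) → ℂ} (hD : rowDisc τ v ≠ 0) (ζ : ℂ)
    (r : Fin (n + 1) → ℂ) : rowShift τ v ζ r ⬝ᵥ v = ζ := by
  rw [rowShift, add_dotProduct, sub_dotProduct, dotProduct_rowMean hD, dotProduct_rowMean hD]
  ring

theorem chartNormSq_eq (p : Fin (n + 1) → ℂ) : vecNormSq (chartVec p) = chartNormSq p := rfl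

/-- The matrix Z = z - X + v v* / |v|² satisfies Z v = v. As `v 0 = 1`, its column 0 may be replaced
by `v`; subtracting multiples of that column from the others removes the rank-one term and leaves
the chart Jacobian. The added term makes the residual and mean have rows of full length. -/
theorem det_chartJacobian_rowShift (hτ0 : 0 < τ) (hτ1 : τ < 1) (p : Fin (n + 1) → ℂ)
    (X : Fin (n + 1) → Fin (n + 1) → ℂ) :
    (chartJacobian (p, fun i => Fin.tail
      (rowShift τ (chartVec p) (p 0 * chartVec p i) (X i)))).det
      = (Matrix.of fun i j => shiftedMean τ (chartVec p) (p 0) i j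
          - rowResidual τ (chartVec p) (X i) j).det := by
  set v := chartVec p with hvd
  have hv : 0 < vecNormSq v := chartNormSq_pos p
  have hD := (rowDisc_pos hτ0 hτ1 hv).ne'
  have hv' : (vecNormSq v : ℂ) ≠ 0 := by exact_mod_cast hv.ne'
  set Z : Matrix (Fin (n + 1)) (Fin (n + 1)) ℂ := Matrix.of fun i j =>
    shiftedMean τ v (p 0) i j - rowResidual τ v (X i) j with hZ
  have hZij : ∀ i j, Z i j = (if i = j then p 0 else 0) - rowShift τ v (p 0 * v i) (X i) j
      + v i * (star (v j) / vecNormSq v) := by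
    intro i j
    simp only [hZ, Matrix.of_apply, shiftedMean, rowShift_eq, Pi.add_apply]
    ring
  have hv0 : v 0 = 1 := by simp [hvd]
  have hZv : ∀ i, ∑ j, v j • Z i j = v i := by
    intro i
    have h1 := rowShift_dotProduct hD (p 0 * v i) (X i)
    have h2 : ∑ j, v j * (v i * (star (v j) / vecNormSq v)) = v i := by
      have : ∀ j, v j * (v i * (star (v j) / vecNormSq v))
          = (v i / vecNormSq v) * (v j * star (v j)) := fun j => by ring
      simp_rw [this]
      rw [← Finset.mul_sum, sum_star_mul_self]
      field_simp
    simp only [hZij, smul_eq_mul, mul_add, mul_sub, Finset.sum_add_distrib,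
      Finset.sum_sub_distrib, h2, mul_ite, mul_zero, Finset.sum_ite_eq, Finset.mem_univ, if_true]
    rw [dotProduct] at h1
    have h3 : ∑ j, v j * rowShift τ v (p 0 * v i) (X i) j = p 0 * v i := by
      refine Eq.trans ?_ h1
      exact Finset.sum_congr rfl fun j _ => mul_comm _ _
    rw [h3]
    ring
  have h4 := Matrix.det_updateCol_sum Z 0 v
  rw [hv0, one_smul] at h4
  simp_rw [hZv] at h4
  rw [← h4, ← Matrix.det_transpose, ← Matrix.det_transpose (Z.updateCol 0 _)]
  symm
  refine Matrix.det_eq_of_forall_row_eq_smul_add_const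
    (Fin.cons 0 fun j : Fin n => star (v j.succ) / vecNormSq v) 0 (by simp) fun j i => ?_
  refine Fin.cases ?_ (fun k => ?_) j
  · simp [chartJacobian, hvd]
  · simp only [Matrix.transpose_apply, Matrix.updateCol_ne (Fin.succ_ne_zero k), hZij,
      chartJacobian, Matrix.of_apply, Fin.cons_zero, Fin.cons_succ, Fin.tail, ← hvd]
    ring

end DetMoment

/-! ### Integrating out the remaining columns -/

section ChartDensity

variable {n : ℕ} {τ : ℝ}

/-- The rows are independent, so the row disintegration applies to each; testing it on indicators
identifies the measures. -/
theorem pi_withDensity_rowOfTail (hτ0 : 0 < τ) (hτ1 : τ < 1) {v : Fin (n + 1) → ℂ}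
    (hv0 : v 0 = 1) (ζ : Fin (n + 1) → ℂ) :
    (volume : Measure (Fin (n + 1) → Fin n → ℂ)).withDensity
        (fun R => ∏ i, ENNReal.ofReal (∏ k, gaussDensity τ (rowOfTail v (ζ i) (R i) k)))
      = (∏ i, ENNReal.ofReal (rowDensity τ v (ζ i))) •
        (Measure.pi fun _ : Fin (n + 1) => Measure.pi fun _ : Fin (n + 1) => entryLaw τ).map
          fun X i => Fin.tail (rowShift τ v (ζ i) (X i)) := by
  have := isProbabilityMeasure_entryLaw hτ0 hτ1
  have hm : ∀ i, Measurable fun r : Fin n → ℂ => ENNReal.ofReal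
      (∏ k, gaussDensity τ (rowOfTail v (ζ i) r k)) := by
    intro i
    refine ENNReal.measurable_ofReal.comp (Continuous.measurable ?_)
    have hc : Continuous fun r : Fin n → ℂ => rowOfTail v (ζ i) r :=
      (continuous_rowOfTail v).comp (by fun_prop : Continuous fun r : Fin n → ℂ => (ζ i, r))
    exact continuous_finsetProd _ fun k _ => (continuous_gaussDensity τ).comp
      ((continuous_apply k).comp hc)
  have hσ : ∀ i : Fin (n + 1), SigmaFinite ((volume : Measure (Fin n → ℂ)).withDensity
      ((fun i r => ENNReal.ofReal (∏ k, gaussDensity τ (rowOfTail v (ζ i) r k))) i)) := by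
    intro i
    exact SigmaFinite.withDensity_ofReal _
  have hT : ∀ i, Measurable fun r : Fin (n + 1) → ℂ => Fin.tail (rowShift τ v (ζ i) r) := by
    intro i
    refine measurable_pi_lambda _ fun j => ?_
    exact (measurable_pi_apply _).comp (continuous_rowShift τ v (ζ i)).measurable
  have hTT : Measurable fun (X : Fin (n + 1) → Fin (n + 1) → ℂ) (i : Fin (n + 1)) =>
      Fin.tail (rowShift τ v (ζ i) (X i)) :=
    measurable_pi_lambda _ fun i => (hT i).comp (measurable_pi_apply i)
  have h1 := @pi_withDensity_fin _ _ (n + 1) (volume : Measure (Fin n → ℂ)) _ _ hm hσ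
  refine Eq.trans h1.symm ?_
  refine @Measure.pi_eq _ _ _ _ _ hσ _ fun s hs => ?_
  rw [Measure.smul_apply, Measure.map_apply hTT (MeasurableSet.univ_pi hs), smul_eq_mul]
  have hpre : (fun (X : Fin (n + 1) → Fin (n + 1) → ℂ) (i : Fin (n + 1)) =>
      Fin.tail (rowShift τ v (ζ i) (X i))) ⁻¹' Set.univ.pi s
      = Set.univ.pi fun i => (fun r => Fin.tail (rowShift τ v (ζ i) r)) ⁻¹' s i := by
    ext X
    simp
  rw [hpre, Measure.pi_pi, ← Finset.prod_mul_distrib]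
  refine Finset.prod_congr rfl fun i _ => ?_
  have h2 := rowDensity_mul_lintegral hτ0 hτ1 hv0 (ζ i)
    (f := (s i).indicator 1) (measurable_one.indicator (hs i))
  rw [withDensity_apply _ (hs i), ← lintegral_indicator (hs i),
    ← lintegral_indicator_one ((hT i) (hs i))]
  refine Eq.trans h2.symm ?_
  refine lintegral_congr fun r => ?_
  by_cases hr : r ∈ s i <;> simp [hr]

theorem matrixDensity_chartMap (p : Fin (n + 1) → ℂ) (R : Fin (n + 1) → Fin n → ℂ) :
    matrixDensity τ (chartMap (p, R)) = ∏ i, ENNReal.ofReal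
      (∏ k, gaussDensity τ (rowOfTail (chartVec p) (p 0 * chartVec p i) (R i) k)) := by
  rw [matrixDensity, ← Finset.prod_mul_distrib]
  refine Finset.prod_congr rfl fun i _ => ?_
  rw [ENNReal.ofReal_prod_of_nonneg fun k _ => gaussDensity_nonneg τ _, Fin.prod_univ_succ]
  simp [chartMap, rowOfTail]

/-- Summing over the rows turns the values z v_i back into |v|² and vᵀv, so that the result depends
on `v` only through `overlapRatio`. -/
theorem sum_rowExponent (hτ0 : 0 < τ) (hτ1 : τ < 1) {v : Fin (n + 1) → ℂ}
    (hv : 0 < vecNormSq v) (z : ℂ) :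
    ∑ i, rowExponent τ v (z * v i)
      = (‖z‖ ^ 2 - τ * overlapRatio v * (z ^ 2).re) / (1 - τ ^ 2 * overlapRatio v) := by
  have hD := rowDisc_pos hτ0 hτ1 hv
  have h1 : ∑ i, rowExponent τ v (z * v i)
      = (vecNormSq v * (‖z‖ ^ 2 * vecNormSq v)
        - τ * (star (v ⬝ᵥ v) * (z ^ 2 * (v ⬝ᵥ v))).re) / rowDisc τ v := by
    simp only [rowExponent]
    rw [← Finset.sum_div, Finset.sum_sub_distrib, ← Finset.mul_sum, ← Finset.mul_sum,
      ← Complex.re_sum, ← Finset.mul_sum]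
    congr 3
    · rw [vecNormSq, Finset.mul_sum]
      simp only [norm_mul, mul_pow]
    · congr 3
      rw [dotProduct, Finset.mul_sum]
      exact Finset.sum_congr rfl fun i _ => by ring
  have h2 : star (v ⬝ᵥ v) * (z ^ 2 * (v ⬝ᵥ v)) = ((‖v ⬝ᵥ v‖ ^ 2 : ℝ) : ℂ) * z ^ 2 := by
    rw [mul_left_comm, RCLike.star_def, Complex.conj_mul']
    push_cast
    ring
  have h3 : rowDisc τ v = vecNormSq v ^ 2 * (1 - τ ^ 2 * overlapRatio v) := by
    rw [rowDisc, overlapRatio]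
    field_simp
  have h4 : (1 - τ ^ 2 * overlapRatio v) ≠ 0 := by
    intro h
    rw [h3, h, mul_zero] at hD
    exact lt_irrefl _ hD
  rw [h1, h2, Complex.re_ofReal_mul, h3]
  have h5 : ‖v ⬝ᵥ v‖ ^ 2 = vecNormSq v ^ 2 * overlapRatio v := by
    rw [overlapRatio]
    field_simp
  rw [h5]
  field_simp

/-- The joint density of an eigenvalue and of `|vᵀ v|²`, up to the weight of the latter. -/
def radialDensity (n : ℕ) (τ q : ℝ) (z : ℂ) : ℝ :=
  ((Real.pi * √(1 - τ ^ 2 * q)) ^ (n + 1))⁻¹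
    * Real.exp (-((‖z‖ ^ 2 - τ * q * (z ^ 2).re) / (1 - τ ^ 2 * q)))
    * jacobianMoment (n - 1) (‖z‖ ^ 2) (residualVar τ q) (meanDistSq τ q z)

theorem prod_rowDensity (hτ0 : 0 < τ) (hτ1 : τ < 1) {v : Fin (n + 1) → ℂ}
    (hv : 0 < vecNormSq v) (z : ℂ) :
    ∏ i, rowDensity τ v (z * v i) = (vecNormSq v ^ (n + 1))⁻¹
      * (((Real.pi * √(1 - τ ^ 2 * overlapRatio v)) ^ (n + 1))⁻¹ * Real.exp
        (-((‖z‖ ^ 2 - τ * overlapRatio v * (z ^ 2).re) / (1 - τ ^ 2 * overlapRatio v)))) := by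
  have h3 : rowDisc τ v = vecNormSq v ^ 2 * (1 - τ ^ 2 * overlapRatio v) := by
    rw [rowDisc, overlapRatio]
    field_simp
  simp only [rowDensity]
  rw [Finset.prod_mul_distrib, Finset.prod_const, Finset.card_univ, Fintype.card_fin,
    ← Real.exp_sum, Finset.sum_neg_distrib, sum_rowExponent hτ0 hτ1 hv, h3,
    Real.sqrt_mul (by positivity), Real.sqrt_sq hv.le, ← mul_assoc, ← inv_pow, ← inv_pow, ← mul_assoc, ← mul_pow]
  congr 2
  rw [← mul_inv]
  congr 1
  ring

/-- The density of the row products gives the prefactor, the average of the Jacobian over residuals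
gives `jacobianMoment`. Apart from a power of |v|², everything is a function of z and
`overlapRatio`. -/
theorem lintegral_matrixDensity_chartMap (hτ0 : 0 < τ) (hτ1 : τ < 1) (hn : 1 ≤ n)
    (p : Fin (n + 1) → ℂ) :
    ∫⁻ R, matrixDensity τ (chartMap (p, R))
        * ENNReal.ofReal (‖(chartJacobian (p, R)).det‖ ^ 2)
      = ENNReal.ofReal ((vecNormSq (chartVec p) ^ (n + 1))⁻¹
        * radialDensity n τ (overlapRatio (chartVec p)) (p 0)) := by
  have hv : 0 < vecNormSq (chartVec p) := chartNormSq_pos p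
  have hv0 : chartVec p 0 = 1 := by simp
  have hJ : Measurable fun R : Fin (n + 1) → Fin n → ℂ =>
      ENNReal.ofReal (‖(chartJacobian (p, R)).det‖ ^ 2) := by
    refine ENNReal.measurable_ofReal.comp (Continuous.measurable ?_)
    refine (Continuous.norm ?_).pow 2
    refine Continuous.matrix_det ?_
    refine continuous_pi fun i => continuous_pi fun j => ?_
    refine Fin.cases ?_ (fun k => ?_) j
    · simp only [chartJacobian, Matrix.of_apply, Fin.cons_zero]
      fun_prop
    · simp only [chartJacobian, Matrix.of_apply, Fin.cons_succ]
      fun_prop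
  have hd : Measurable fun R : Fin (n + 1) → Fin n → ℂ => ∏ i, ENNReal.ofReal
      (∏ k, gaussDensity τ (rowOfTail (chartVec p) (p 0 * chartVec p i) (R i) k)) := by
    have hc : ∀ i, Continuous fun R : Fin (n + 1) → Fin n → ℂ =>
        rowOfTail (chartVec p) (p 0 * chartVec p i) (R i) := fun i =>
      (continuous_rowOfTail _).comp (by fun_prop :
        Continuous fun R : Fin (n + 1) → Fin n → ℂ => (p 0 * chartVec p i, R i))
    refine Finset.measurable_prod _ fun i _ => ENNReal.measurable_ofReal.comp (Continuous.measurable ?_)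
    exact continuous_finsetProd _ fun k _ => (continuous_gaussDensity τ).comp
      ((continuous_apply k).comp (hc i))
  have hT : Measurable fun (X : Fin (n + 1) → Fin (n + 1) → ℂ) (i : Fin (n + 1)) =>
      Fin.tail (rowShift τ (chartVec p) (p 0 * chartVec p i) (X i)) := by
    refine measurable_pi_lambda _ fun i => measurable_pi_lambda _ fun j => ?_
    exact (measurable_pi_apply _).comp ((continuous_rowShift τ _ _).measurable.comp
      (measurable_pi_apply i))
  simp_rw [matrixDensity_chartMap]
  have e := lintegral_withDensity_eq_lintegral_mul
    (volume : Measure (Fin (n + 1) → Fin n → ℂ)) hd hJ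
  refine Eq.trans e.symm ?_
  rw [pi_withDensity_rowOfTail hτ0 hτ1 hv0, lintegral_smul_measure, lintegral_map hJ hT]
  simp_rw [det_chartJacobian_rowShift hτ0 hτ1]
  rw [lintegral_norm_det_shifted hτ0 hτ1 hn hv, smul_eq_mul,
    ← ENNReal.ofReal_prod_of_nonneg, prod_rowDensity hτ0 hτ1 hv,
    ← ENNReal.ofReal_mul, radialDensity]
  · congr 1
    ring
  · have : 0 ≤ Real.pi * √(1 - τ ^ 2 * overlapRatio (chartVec p)) := by positivity
    positivity
  · intro i _
    unfold rowDensity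
    positivity

end ChartDensity

/-! ### Real Gaussian integrals of norms and Gram determinants -/

section RadialIntegrals

/-- A nonzero Bochner integral certifies integrability, because the integral of a non-integrable
function is 0 by default. -/
theorem lintegral_ofReal_eq_of_integral {α : Type*} [MeasurableSpace α] {μ : Measure α} {f : α → ℝ}
    (hf : ∀ x, 0 ≤ f x) {c : ℝ} (hc : 0 < c) (h : ∫ x, f x ∂μ = c) :
    ∫⁻ x, ENNReal.ofReal (f x) ∂μ = ENNReal.ofReal c := by
  have hi : Integrable f μ := by
    by_contra hi
    rw [integral_undef hi] at h
    exact hc.ne h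
  rw [← h, ofReal_integral_eq_lintegral_ofReal hi (Eventually.of_forall hf)]

theorem lintegral_norm_pow_mul_exp {d : ℕ} (hd : 1 ≤ d) (k : ℕ) :
    ∫⁻ x : EuclideanSpace ℝ (Fin d), ENNReal.ofReal (‖x‖ ^ (2 * k) * Real.exp (-‖x‖ ^ 2))
      = ENNReal.ofReal (√Real.pi ^ d * Real.Gamma (d / 2 + k) / Real.Gamma (d / 2)) := by
  have hd' : (0 : ℝ) < d := by exact_mod_cast hd
  have hG : 0 < Real.Gamma (d / 2) := Real.Gamma_pos_of_pos (by positivity)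
  have hG2 : 0 < Real.Gamma (d / 2 + k) := Real.Gamma_pos_of_pos (by positivity)
  have hpi := Real.pi_pos
  refine lintegral_ofReal_eq_of_integral (fun x => by positivity) (by positivity) ?_
  have : Nonempty (Fin d) := ⟨⟨0, hd⟩⟩
  have : Nontrivial (EuclideanSpace ℝ (Fin d)) := by
    refine Module.nontrivial_of_finrank_pos (R := ℝ) ?_
    rw [finrank_euclideanSpace_fin]
    omega
  rw [integral_fun_norm_addHaar volume (fun r : ℝ => r ^ (2 * k) * Real.exp (-r ^ 2)),
    finrank_euclideanSpace_fin, Measure.real, EuclideanSpace.volume_ball, ENNReal.ofReal_one,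
    one_pow, one_mul, ENNReal.toReal_ofReal (by positivity), Fintype.card_fin,
    Real.Gamma_add_one (by positivity)]
  have h1 : ∫ y in Set.Ioi (0 : ℝ), y ^ (d - 1) • (y ^ (2 * k) * Real.exp (-y ^ 2))
      = 1 / 2 * Real.Gamma (d / 2 + k) := by
    have h2 := integral_rpow_mul_exp_neg_rpow (p := 2) (q := d - 1 + 2 * k) (by norm_num)
      (by have : (0 : ℝ) ≤ k := by positivity
          linarith)
    rw [show ((d : ℝ) - 1 + 2 * k + 1) / 2 = d / 2 + k by ring] at h2
    rw [← h2]
    refine setIntegral_congr_fun measurableSet_Ioi fun y hy => ?_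
    have e : ((d : ℝ) - 1 + 2 * k) = ((d - 1 + 2 * k : ℕ) : ℝ) := by
      push_cast [Nat.cast_sub hd]
      ring
    simp only [smul_eq_mul]
    rw [e, Real.rpow_natCast, pow_add, Real.rpow_two]
    ring
  rw [h1]
  simp only [nsmul_eq_mul, smul_eq_mul]
  field_simp

/-- The difference |y|² - y_0² is the squared norm of the last n coordinates, and the first
coordinate integrates out to √π. -/
theorem lintegral_exp_mul_tail_pow {n : ℕ} (hn : 1 ≤ n) (k : ℕ) :
    ∫⁻ y : EuclideanSpace ℝ (Fin (n + 1)),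
        ENNReal.ofReal ((‖y‖ ^ 2 - y 0 ^ 2) ^ k * Real.exp (-‖y‖ ^ 2))
      = ENNReal.ofReal (√Real.pi ^ (n + 1) * Real.Gamma (n / 2 + k) / Real.Gamma (n / 2)) := by
  have e1 := (PiLp.volume_preserving_toLp (Fin (n + 1))).lintegral_comp_emb
    (MeasurableEquiv.toLp 2 (Fin (n + 1) → ℝ)).measurableEmbedding
    fun y : EuclideanSpace ℝ (Fin (n + 1)) =>
      ENNReal.ofReal ((‖y‖ ^ 2 - y 0 ^ 2) ^ k * Real.exp (-‖y‖ ^ 2))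
  have e2 := (volume_preserving_piFinSuccAbove (fun _ : Fin (n + 1) => ℝ) 0).symm.lintegral_comp_emb
    (MeasurableEquiv.piFinSuccAbove (fun _ : Fin (n + 1) => ℝ) 0).symm.measurableEmbedding
    fun y : Fin (n + 1) → ℝ => ENNReal.ofReal ((‖WithLp.toLp 2 y‖ ^ 2 - y 0 ^ 2) ^ k
      * Real.exp (-‖WithLp.toLp 2 y‖ ^ 2))
  have e3 := (PiLp.volume_preserving_toLp (Fin n)).lintegral_comp_emb
    (MeasurableEquiv.toLp 2 (Fin n → ℝ)).measurableEmbedding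
    fun y : EuclideanSpace ℝ (Fin n) => ENNReal.ofReal (‖y‖ ^ (2 * k) * Real.exp (-‖y‖ ^ 2))
  rw [lintegral_norm_pow_mul_exp hn] at e3
  rw [← e1]
  refine e2.symm.trans ?_
  have e4 : ∀ y : ℝ × (Fin n → ℝ), ENNReal.ofReal
      ((‖WithLp.toLp 2 ((MeasurableEquiv.piFinSuccAbove (fun _ : Fin (n + 1) => ℝ) 0).symm y)‖ ^ 2
        - ((MeasurableEquiv.piFinSuccAbove (fun _ : Fin (n + 1) => ℝ) 0).symm y) 0 ^ 2) ^ k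
      * Real.exp (-‖WithLp.toLp 2
        ((MeasurableEquiv.piFinSuccAbove (fun _ : Fin (n + 1) => ℝ) 0).symm y)‖ ^ 2))
      = ENNReal.ofReal (Real.exp (-1 * y.1 ^ 2))
        * ENNReal.ofReal (‖WithLp.toLp 2 y.2‖ ^ (2 * k) * Real.exp (-‖WithLp.toLp 2 y.2‖ ^ 2)) := by
    intro y
    have h : ‖WithLp.toLp 2 ((MeasurableEquiv.piFinSuccAbove (fun _ : Fin (n + 1) => ℝ) 0).symm y)‖
        ^ 2 = y.1 ^ 2 + ‖WithLp.toLp 2 y.2‖ ^ 2 := by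
      rw [EuclideanSpace.norm_sq_eq, EuclideanSpace.norm_sq_eq, Fin.sum_univ_succ]
      simp [MeasurableEquiv.piFinSuccAbove]
    have h' : ((MeasurableEquiv.piFinSuccAbove (fun _ : Fin (n + 1) => ℝ) 0).symm y) 0 = y.1 := by
      simp [MeasurableEquiv.piFinSuccAbove]
    rw [h, h', ← ENNReal.ofReal_mul (by positivity)]
    congr 1
    rw [show -(y.1 ^ 2 + ‖WithLp.toLp 2 y.2‖ ^ 2) = -1 * y.1 ^ 2 + -‖WithLp.toLp 2 y.2‖ ^ 2 by ring,
      Real.exp_add, pow_mul]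
    ring
  simp_rw [e4]
  have hc : Continuous fun y : Fin n → ℝ =>
      ‖WithLp.toLp 2 y‖ ^ (2 * k) * Real.exp (-‖WithLp.toLp 2 y‖ ^ 2) := by
    have := PiLp.continuous_toLp 2 (fun _ : Fin n => ℝ)
    fun_prop
  rw [Measure.volume_eq_prod, lintegral_prod_mul (f := fun s : ℝ => ENNReal.ofReal
    (Real.exp (-1 * s ^ 2))) (g := fun y : Fin n → ℝ => ENNReal.ofReal
      (‖WithLp.toLp 2 y‖ ^ (2 * k) * Real.exp (-‖WithLp.toLp 2 y‖ ^ 2))) (by fun_prop)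
    (ENNReal.measurable_ofReal.comp hc.measurable).aemeasurable,
    e3, lintegral_ofReal_eq_of_integral (fun _ => by positivity) (by
      rw [div_one]; exact Real.sqrt_pos.2 Real.pi_pos) (integral_gaussian 1),
    ← ENNReal.ofReal_mul (by positivity), div_one]
  congr 1
  ring

theorem lintegral_exp_mul_gram_pow {n : ℕ} (hn : 1 ≤ n) (k : ℕ)
    (x : EuclideanSpace ℝ (Fin (n + 1))) :
    ∫⁻ y : EuclideanSpace ℝ (Fin (n + 1)),
        ENNReal.ofReal ((‖x‖ ^ 2 * ‖y‖ ^ 2 - (inner ℝ x y) ^ 2) ^ k * Real.exp (-‖y‖ ^ 2))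
      = ENNReal.ofReal (‖x‖ ^ (2 * k)) * ENNReal.ofReal
        (√Real.pi ^ (n + 1) * Real.Gamma (n / 2 + k) / Real.Gamma (n / 2)) := by
  set e : EuclideanSpace ℝ (Fin (n + 1)) := ‖x‖ • EuclideanSpace.single 0 (1 : ℝ) with he
  have hnorm : ‖e‖ = ‖x‖ := by simp [he, norm_smul]
  -- This reflection exchanges `e` and `x`, which have equal norms; it reduces the Gram determinant
  -- to the case of a vector along the first axis.
  set U := (ℝ ∙ (e - x))ᗮ.reflection with hU
  have hUe : U e = x := Submodule.reflection_sub hnorm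
  have h1 := U.measurePreserving.lintegral_comp_emb
    U.toHomeomorph.measurableEmbedding
    fun y : EuclideanSpace ℝ (Fin (n + 1)) =>
      ENNReal.ofReal ((‖x‖ ^ 2 * ‖y‖ ^ 2 - (inner ℝ x y) ^ 2) ^ k * Real.exp (-‖y‖ ^ 2))
  rw [← h1, ← lintegral_exp_mul_tail_pow hn, ← lintegral_const_mul' _ _ ENNReal.ofReal_ne_top]
  refine lintegral_congr fun y => ?_
  have h2 : inner ℝ x (U y) = ‖x‖ * y 0 := by
    rw [← hUe, LinearIsometryEquiv.inner_map_map, LinearIsometryEquiv.norm_map, he,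
      inner_smul_left, EuclideanSpace.inner_single_left]
    simp [norm_smul]
  rw [h2, LinearIsometryEquiv.norm_map, ← ENNReal.ofReal_mul (by positivity)]
  congr 1
  rw [show ‖x‖ ^ 2 * ‖y‖ ^ 2 - (‖x‖ * y 0) ^ 2 = ‖x‖ ^ 2 * (‖y‖ ^ 2 - y 0 ^ 2) by ring, mul_pow,
    ← pow_mul, mul_assoc]

end RadialIntegrals

/-! ### Moments of 1 - |vᵀv|²/|v|⁴ on projective space -/

section ProjectiveMoments

variable {n : ℕ}

/-- The Gram determinant `|v|⁴ - |vᵀ v|²` of `v` and its conjugate. -/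
def gramDefect (v : Fin (n + 1) → ℂ) : ℝ := vecNormSq v ^ 2 - ‖v ⬝ᵥ v‖ ^ 2

theorem gramDefect_nonneg (v : Fin (n + 1) → ℂ) : 0 ≤ gramDefect v :=
  sub_nonneg.2 (pow_le_pow_left₀ (norm_nonneg _) (norm_dotProduct_self_le v) 2)

theorem vecNormSq_smul (c : ℂ) (v : Fin (n + 1) → ℂ) :
    vecNormSq (c • v) = ‖c‖ ^ 2 * vecNormSq v := by
  simp [vecNormSq, mul_pow, Finset.mul_sum]

theorem gramDefect_smul (c : ℂ) (v : Fin (n + 1) → ℂ) :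
    gramDefect (c • v) = ‖c‖ ^ 4 * gramDefect v := by
  rw [gramDefect, vecNormSq_smul, smul_dotProduct, dotProduct_smul, norm_smul, norm_smul, gramDefect]
  ring

@[fun_prop]
theorem continuous_vecNormSq : Continuous (vecNormSq (n := n)) := by
  unfold vecNormSq
  fun_prop

theorem continuous_dotProduct_self : Continuous fun v : Fin (n + 1) → ℂ => v ⬝ᵥ v := by
  unfold dotProduct
  fun_prop

@[fun_prop]
theorem continuous_gramDefect : Continuous (gramDefect (n := n)) :=
  (continuous_vecNormSq.pow 2).sub (continuous_dotProduct_self.norm.pow 2)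

/-- For v = x + i y, the quantity |v|⁴ - |vᵀv|² is 4 (|x|²|y|² - (x·y)²), so the integral is
computed first over y and then over x. -/
theorem lintegral_gramDefect_pow (hn : 1 ≤ n) (k : ℕ) :
    ∫⁻ v : Fin (n + 1) → ℂ, ENNReal.ofReal (gramDefect v ^ k * Real.exp (-vecNormSq v))
      = ENNReal.ofReal (4 ^ k * (√Real.pi ^ (n + 1) * Real.Gamma (n / 2 + k) / Real.Gamma (n / 2))
        * (√Real.pi ^ (n + 1) * Real.Gamma ((n + 1) / 2 + k) / Real.Gamma ((n + 1) / 2))) := by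
  have m1 : MeasurePreserving
      (MeasurableEquiv.arrowProdEquivProdArrow ℝ ℝ (Fin (n + 1))).symm :=
    (volume_measurePreserving_arrowProdEquivProdArrow ℝ ℝ (Fin (n + 1))).symm
  have m2 : MeasurePreserving (fun (x : Fin (n + 1) → ℝ × ℝ) i =>
      Complex.measurableEquivRealProd.symm (x i)) :=
    volume_preserving_pi fun _ => Complex.volume_preserving_equiv_real_prod.symm
  have hm : Measurable fun v : Fin (n + 1) → ℂ =>
      ENNReal.ofReal (gramDefect v ^ k * Real.exp (-vecNormSq v)) :=
    ENNReal.measurable_ofReal.comp (by fun_prop : Continuous fun v : Fin (n + 1) → ℂ =>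
      gramDefect v ^ k * Real.exp (-vecNormSq v)).measurable
  have m3 := (m2.comp m1).lintegral_comp hm
  rw [← m3]
  let F : EuclideanSpace ℝ (Fin (n + 1)) → EuclideanSpace ℝ (Fin (n + 1)) → ℝ≥0∞ := fun x y =>
    ENNReal.ofReal (4 ^ k * Real.exp (-‖x‖ ^ 2)) * ENNReal.ofReal
      ((‖x‖ ^ 2 * ‖y‖ ^ 2 - (inner ℝ x y) ^ 2) ^ k * Real.exp (-‖y‖ ^ 2))
  have key : ∀ a : (Fin (n + 1) → ℝ) × (Fin (n + 1) → ℝ), ENNReal.ofReal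
      (gramDefect (((fun (x : Fin (n + 1) → ℝ × ℝ) i => Complex.measurableEquivRealProd.symm (x i)) ∘
        (MeasurableEquiv.arrowProdEquivProdArrow ℝ ℝ (Fin (n + 1))).symm) a) ^ k
      * Real.exp (-vecNormSq (((fun (x : Fin (n + 1) → ℝ × ℝ) i =>
        Complex.measurableEquivRealProd.symm (x i)) ∘
        (MeasurableEquiv.arrowProdEquivProdArrow ℝ ℝ (Fin (n + 1))).symm) a)))
      = F (WithLp.toLp 2 a.1) (WithLp.toLp 2 a.2) := by
    rintro ⟨x, y⟩
    set v : Fin (n + 1) → ℂ := ((fun (x : Fin (n + 1) → ℝ × ℝ) i =>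
        Complex.measurableEquivRealProd.symm (x i)) ∘
        (MeasurableEquiv.arrowProdEquivProdArrow ℝ ℝ (Fin (n + 1))).symm) (x, y)
    have hv : ∀ i, v i = ⟨x i, y i⟩ := fun i => rfl
    have h1 : vecNormSq v = ‖WithLp.toLp 2 x‖ ^ 2 + ‖WithLp.toLp 2 y‖ ^ 2 := by
      rw [EuclideanSpace.norm_sq_eq, EuclideanSpace.norm_sq_eq, ← Finset.sum_add_distrib, vecNormSq]
      refine Finset.sum_congr rfl fun i _ => ?_
      rw [hv, ← Complex.normSq_eq_norm_sq, Complex.normSq_apply]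
      simp [pow_two]
    have h2 : (v ⬝ᵥ v).re = ‖WithLp.toLp 2 x‖ ^ 2 - ‖WithLp.toLp 2 y‖ ^ 2 := by
      rw [EuclideanSpace.norm_sq_eq, EuclideanSpace.norm_sq_eq, ← Finset.sum_sub_distrib, dotProduct,
        Complex.re_sum]
      refine Finset.sum_congr rfl fun i _ => ?_
      rw [hv, Complex.mul_re]
      simp [pow_two]
    have h3 : (v ⬝ᵥ v).im = 2 * inner ℝ (WithLp.toLp 2 x) (WithLp.toLp 2 y) := by
      rw [PiLp.inner_apply, Finset.mul_sum, dotProduct, Complex.im_sum]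
      refine Finset.sum_congr rfl fun i _ => ?_
      rw [hv, Complex.mul_im]
      simp
      ring
    have h4 : gramDefect v = 4 * (‖WithLp.toLp 2 x‖ ^ 2 * ‖WithLp.toLp 2 y‖ ^ 2
        - inner ℝ (WithLp.toLp 2 x) (WithLp.toLp 2 y) ^ 2) := by
      rw [gramDefect, ← Complex.normSq_eq_norm_sq, Complex.normSq_apply, h1, h2, h3]
      ring
    simp only [F]
    rw [h4, h1, ← ENNReal.ofReal_mul (by positivity), neg_add, Real.exp_add, mul_pow]
    congr 1
    ring
  simp_rw [key]
  have hF : Measurable fun a : (Fin (n + 1) → ℝ) × (Fin (n + 1) → ℝ) =>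
      F (WithLp.toLp 2 a.1) (WithLp.toLp 2 a.2) := by
    have := hm.comp (m2.comp m1).measurable
    rw [← funext key]
    exact this
  rw [Measure.volume_eq_prod, lintegral_prod _ hF.aemeasurable]
  have mp := PiLp.volume_preserving_toLp (Fin (n + 1))
  have me := (MeasurableEquiv.toLp 2 (Fin (n + 1) → ℝ)).measurableEmbedding
  have h5 : ∀ x : Fin (n + 1) → ℝ, ∫⁻ y : Fin (n + 1) → ℝ, F (WithLp.toLp 2 x) (WithLp.toLp 2 y)
      = ENNReal.ofReal (4 ^ k * (√Real.pi ^ (n + 1) * Real.Gamma (n / 2 + k) / Real.Gamma (n / 2)))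
        * ENNReal.ofReal (‖WithLp.toLp 2 x‖ ^ (2 * k) * Real.exp (-‖WithLp.toLp 2 x‖ ^ 2)) := by
    intro x
    have := mp.lintegral_comp_emb me (F (WithLp.toLp 2 x))
    refine this.trans ?_
    simp only [F]
    rw [lintegral_const_mul' _ _ ENNReal.ofReal_ne_top, lintegral_exp_mul_gram_pow hn,
      ENNReal.ofReal_mul (by positivity), ENNReal.ofReal_mul (by positivity),
      ENNReal.ofReal_mul (by positivity)]
    ring
  simp_rw [h5]
  have h6 := mp.lintegral_comp_emb me (fun x : EuclideanSpace ℝ (Fin (n + 1)) =>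
    ENNReal.ofReal (‖x‖ ^ (2 * k) * Real.exp (-‖x‖ ^ 2)))
  have hG : 0 < Real.Gamma ((n : ℝ) / 2) :=
    Real.Gamma_pos_of_pos (by have : (0 : ℝ) < n := by exact_mod_cast hn
                              positivity)
  have hG2 : 0 ≤ Real.Gamma ((n : ℝ) / 2 + k) := Real.Gamma_nonneg_of_nonneg (by positivity)
  rw [lintegral_const_mul' _ _ ENNReal.ofReal_ne_top, h6, lintegral_norm_pow_mul_exp (by omega),
    ← ENNReal.ofReal_mul (by positivity)]
  push_cast
  rfl

theorem lintegral_comp_smul_complex {c : ℂ} (hc : c ≠ 0) (f : (Fin n → ℂ) → ℝ≥0∞) :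
    ∫⁻ w, f w = ENNReal.ofReal (‖c‖ ^ (2 * n)) * ∫⁻ w, f (c • w) := by
  let L : (Fin n → ℂ) →ₗ[ℂ] (Fin n → ℂ) := c • LinearMap.id
  have hdet : LinearMap.det (L.restrictScalars ℝ) = ‖c‖ ^ (2 * n) := by
    rw [LinearMap.det_restrictScalars, Algebra.norm_complex_eq]
    simp [L, LinearMap.det_smul, Complex.normSq_eq_norm_sq, ← pow_mul, mul_comm]
  have hpos : 0 < ‖c‖ ^ (2 * n) := by positivity
  have hmap := Measure.map_linearMap_addHaar_eq_smul_addHaar (volume : Measure (Fin n → ℂ))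
    (f := L.restrictScalars ℝ) (by rw [hdet]; exact hpos.ne')
  rw [hdet, abs_of_pos (by positivity)] at hmap
  have he : MeasurableEmbedding fun w : Fin n → ℂ => c • w :=
    (Homeomorph.smulOfNeZero c hc).measurableEmbedding
  have h1 : ∫⁻ w, f (c • w) = ENNReal.ofReal (‖c‖ ^ (2 * n))⁻¹ * ∫⁻ w, f w := by
    rw [← smul_eq_mul, ← lintegral_smul_measure, ← hmap]
    exact (he.lintegral_map f).symm
  rw [h1, ← mul_assoc, ← ENNReal.ofReal_mul hpos.le, mul_inv_cancel₀ hpos.ne', ENNReal.ofReal_one,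
    one_mul]

theorem vecNormSq_cons_pos (w : Fin n → ℂ) : 0 < vecNormSq (Fin.cons 1 w : Fin (n + 1) → ℂ) := by
  rw [vecNormSq, Fin.sum_univ_succ]
  have : 0 ≤ ∑ i : Fin n, ‖(Fin.cons 1 w : Fin (n + 1) → ℂ) i.succ‖ ^ 2 :=
    Finset.sum_nonneg fun i _ => by positivity
  simp only [Fin.cons_zero, norm_one]
  linarith

theorem one_sub_overlapRatio {v : Fin (n + 1) → ℂ} (hv : 0 < vecNormSq v) :
    1 - overlapRatio v = gramDefect v / vecNormSq v ^ 2 := by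
  rw [overlapRatio, gramDefect]
  field_simp

theorem lintegral_complex_norm_pow_mul_exp (m : ℕ) {b : ℝ} (hb : 0 < b) :
    ∫⁻ c : ℂ, ENNReal.ofReal (‖c‖ ^ (2 * m) * Real.exp (-(b * ‖c‖ ^ 2)))
      = ENNReal.ofReal (Real.pi * m.factorial * (b ^ (m + 1))⁻¹) := by
  refine lintegral_ofReal_eq_of_integral (fun c => by positivity) (by positivity) ?_
  have h := Complex.integral_rpow_mul_exp_neg_mul_rpow (p := 2) (q := (2 * m : ℕ)) one_le_two
    (by have : (0 : ℝ) ≤ (2 * m : ℕ) := by positivity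
        linarith) hb
  rw [show (((2 * m : ℕ) : ℝ) + 2) / 2 = m + 1 by push_cast; ring,
    show -(((2 * m : ℕ) : ℝ) + 2) / 2 = -((m + 1 : ℕ) : ℝ) by push_cast; ring,
    Real.Gamma_nat_eq_factorial, Real.rpow_neg hb.le, Real.rpow_natCast] at h
  rw [show Real.pi * m.factorial * (b ^ (m + 1))⁻¹
    = 2 * Real.pi / 2 * (b ^ (m + 1))⁻¹ * m.factorial by ring, ← h]
  refine integral_congr_ae (Eventually.of_forall fun c => ?_)
  simp only [Real.rpow_natCast, Real.rpow_two, neg_mul]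

/-- Polar decomposition v = c (1, w): the Jacobian is |c|^(2n) and `gramDefect` is homogeneous of
degree 4, so the integral over c is a Gamma integral giving (n + 2k)!. -/
theorem lintegral_gramDefect_pow_eq_projective (k : ℕ) :
    ∫⁻ v : Fin (n + 1) → ℂ, ENNReal.ofReal (gramDefect v ^ k * Real.exp (-vecNormSq v))
      = ENNReal.ofReal (Real.pi * (n + 2 * k).factorial) * ∫⁻ w : Fin n → ℂ,
        ENNReal.ofReal ((vecNormSq (Fin.cons 1 w : Fin (n + 1) → ℂ) ^ (n + 1))⁻¹
          * (1 - overlapRatio (Fin.cons 1 w : Fin (n + 1) → ℂ)) ^ k) := by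
  let F : (Fin (n + 1) → ℂ) → ℝ≥0∞ := fun v =>
    ENNReal.ofReal (gramDefect v ^ k * Real.exp (-vecNormSq v))
  have hF : Measurable F :=
    ENNReal.measurable_ofReal.comp (by fun_prop : Continuous fun v : Fin (n + 1) → ℂ =>
      gramDefect v ^ k * Real.exp (-vecNormSq v)).measurable
  have hcons : Continuous fun p : ℂ × (Fin n → ℂ) => (Fin.cons p.1 p.2 : Fin (n + 1) → ℂ) := by
    fun_prop
  have hcons1 : Continuous fun w : Fin n → ℂ => (Fin.cons 1 w : Fin (n + 1) → ℂ) := by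
    fun_prop
  have e1 := (volume_preserving_piFinSuccAbove (fun _ : Fin (n + 1) => ℂ) 0).symm.lintegral_comp hF
  have e2 : ∀ p : ℂ × (Fin n → ℂ),
      F ((MeasurableEquiv.piFinSuccAbove (fun _ : Fin (n + 1) => ℂ) 0).symm p)
        = F (Fin.cons p.1 p.2) := by
    intro p
    simp [MeasurableEquiv.piFinSuccAbove]
    rfl
  refine e1.symm.trans ?_
  simp_rw [e2]
  rw [Measure.volume_eq_prod, lintegral_prod (fun p : ℂ × (Fin n → ℂ) => F (Fin.cons p.1 p.2))
    (hF.comp hcons.measurable).aemeasurable]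
  have e3 : ∀ᵐ c : ℂ, ∫⁻ w, F (Fin.cons c w) = ∫⁻ w : Fin n → ℂ,
      ENNReal.ofReal (gramDefect (Fin.cons 1 w : Fin (n + 1) → ℂ) ^ k)
        * ENNReal.ofReal (‖c‖ ^ (2 * (n + 2 * k))
          * Real.exp (-(vecNormSq (Fin.cons 1 w : Fin (n + 1) → ℂ) * ‖c‖ ^ 2))) := by
    have h0 : ∀ᵐ c : ℂ, c ≠ 0 := by
      rw [ae_iff]
      simp
    filter_upwards [h0] with c hc
    rw [lintegral_comp_smul_complex hc, ← lintegral_const_mul' _ _ ENNReal.ofReal_ne_top]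
    refine lintegral_congr fun w => ?_
    have : (Fin.cons c (c • w) : Fin (n + 1) → ℂ) = c • Fin.cons 1 w := by
      funext i
      refine Fin.cases ?_ (fun j => ?_) i <;> simp
    simp only [F]
    have hg := gramDefect_nonneg (Fin.cons 1 w : Fin (n + 1) → ℂ)
    rw [this, gramDefect_smul, vecNormSq_smul, ← ENNReal.ofReal_mul (by positivity),
      ← ENNReal.ofReal_mul (by positivity)]
    congr 1
    rw [mul_pow, ← pow_mul, mul_comm (‖c‖ ^ 2) (vecNormSq _)]
    ring
  rw [lintegral_congr_ae e3, lintegral_lintegral_swap,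
    ← lintegral_const_mul' _ _ ENNReal.ofReal_ne_top]
  · refine lintegral_congr fun w => ?_
    have hv := vecNormSq_cons_pos w
    have hg := gramDefect_nonneg (Fin.cons 1 w : Fin (n + 1) → ℂ)
    rw [lintegral_const_mul' _ _ ENNReal.ofReal_ne_top, lintegral_complex_norm_pow_mul_exp _ hv,
      ← ENNReal.ofReal_mul (by positivity), ← ENNReal.ofReal_mul (by positivity),
      one_sub_overlapRatio hv]
    congr 1
    rw [div_pow, ← pow_mul, show n + 2 * k + 1 = (n + 1) + 2 * k by ring, pow_add]
    field_simp
  · change AEMeasurable (fun p : ℂ × (Fin n → ℂ) =>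
      ENNReal.ofReal (gramDefect (Fin.cons 1 p.2 : Fin (n + 1) → ℂ) ^ k)
        * ENNReal.ofReal (‖p.1‖ ^ (2 * (n + 2 * k))
          * Real.exp (-(vecNormSq (Fin.cons 1 p.2 : Fin (n + 1) → ℂ) * ‖p.1‖ ^ 2)))) _
    refine (Measurable.fun_mul ?_ ?_).aemeasurable
    · exact ENNReal.measurable_ofReal.comp
        (((continuous_gramDefect.comp hcons1).comp continuous_snd).pow k).measurable
    · refine ENNReal.measurable_ofReal.comp (Continuous.measurable ?_)
      have := (continuous_vecNormSq.comp hcons1).comp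
        (continuous_snd : Continuous fun p : ℂ × (Fin n → ℂ) => p.2)
      simp only [Function.comp_def] at this
      fun_prop

/-- Comparing the two evaluations of the Gaussian integral, Legendre's duplication formula collapses
the Gamma factors to n / (n + 2k), the k-th moment of a Beta(n/2, 1) variable; π^n / n! is the total
mass. -/
theorem lintegral_one_sub_overlapRatio_pow (hn : 1 ≤ n) (k : ℕ) :
    ∫⁻ w : Fin n → ℂ,
        ENNReal.ofReal ((vecNormSq (Fin.cons 1 w : Fin (n + 1) → ℂ) ^ (n + 1))⁻¹
          * (1 - overlapRatio (Fin.cons 1 w : Fin (n + 1) → ℂ)) ^ k)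
      = ENNReal.ofReal (Real.pi ^ n / n.factorial * (n / (n + 2 * k))) := by
  have h := lintegral_gramDefect_pow_eq_projective (n := n) k
  rw [lintegral_gramDefect_pow hn] at h
  have hn' : (0 : ℝ) < n := by exact_mod_cast hn
  have hc : 0 < Real.pi * (n + 2 * k).factorial := by positivity
  have hval : 4 ^ k * (√Real.pi ^ (n + 1) * Real.Gamma (n / 2 + k) / Real.Gamma (n / 2))
        * (√Real.pi ^ (n + 1) * Real.Gamma ((n + 1) / 2 + k) / Real.Gamma ((n + 1) / 2))
      = Real.pi * (n + 2 * k).factorial * (Real.pi ^ n / n.factorial * (n / (n + 2 * k))) := by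
    have d1 := Real.Gamma_mul_Gamma_add_half ((n : ℝ) / 2)
    have d2 := Real.Gamma_mul_Gamma_add_half ((n : ℝ) / 2 + k)
    rw [show (n : ℝ) / 2 + 1 / 2 = (n + 1) / 2 by ring, show 2 * ((n : ℝ) / 2) = n by ring] at d1
    rw [show (n : ℝ) / 2 + k + 1 / 2 = (n + 1) / 2 + k by ring,
      show 2 * ((n : ℝ) / 2 + k) = n + 2 * k by ring,
      show 1 - ((n : ℝ) + 2 * k) = (1 - n) - (2 * k : ℕ) by push_cast; ring,
      Real.rpow_sub two_pos, Real.rpow_natCast, pow_mul] at d2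
    have f1 : Real.Gamma ((n : ℝ) + 1) = n.factorial := Real.Gamma_nat_eq_factorial n
    rw [Real.Gamma_add_one hn'.ne'] at f1
    have f2 : Real.Gamma (((n + 2 * k : ℕ) : ℝ) + 1) = (n + 2 * k).factorial :=
      Real.Gamma_nat_eq_factorial _
    have hnk : (0 : ℝ) < (n + 2 * k : ℕ) := by
      have : (0 : ℝ) ≤ k := by positivity
      push_cast
      linarith
    rw [Real.Gamma_add_one hnk.ne'] at f2
    have g1 : 0 < Real.Gamma ((n : ℝ) / 2) := Real.Gamma_pos_of_pos (by positivity)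
    have g2 : 0 < Real.Gamma (((n : ℝ) + 1) / 2) := Real.Gamma_pos_of_pos (by positivity)
    have g3 : 0 < Real.Gamma (n : ℝ) := Real.Gamma_pos_of_pos hn'
    have h2 : (0 : ℝ) < 2 ^ (1 - (n : ℝ)) := by positivity
    have hs : √Real.pi ^ (n + 1) * √Real.pi ^ (n + 1) = Real.pi ^ (n + 1) := by
      rw [← mul_pow, Real.mul_self_sqrt Real.pi_pos.le]
    have hsp : 0 < √Real.pi := Real.sqrt_pos.2 Real.pi_pos
    push_cast at f2 hnk
    calc _ = 4 ^ k * (√Real.pi ^ (n + 1) * √Real.pi ^ (n + 1))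
          * (Real.Gamma (n / 2 + k) * Real.Gamma ((n + 1) / 2 + k))
          / (Real.Gamma (n / 2) * Real.Gamma ((n + 1) / 2)) := by ring
      _ = _ := by
        rw [d1, d2, hs, ← f1, ← f2]
        norm_num
        field_simp
        ring
  rw [hval, ENNReal.ofReal_mul hc.le] at h
  exact ((ENNReal.mul_right_inj (ENNReal.ofReal_pos.2 hc).ne' ENNReal.ofReal_ne_top).1 h).symm

end ProjectiveMoments

/-! ### Finite measures on [0, 1] are determined by their moments -/

section MomentDeterminacy

theorem integral_eval_eq_of_moments {μ ν : Measure ℝ} [IsFiniteMeasure μ] [IsFiniteMeasure ν]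
    (hμ : ∀ᵐ x ∂μ, x ∈ Set.Icc (0 : ℝ) 1) (hν : ∀ᵐ x ∂ν, x ∈ Set.Icc (0 : ℝ) 1)
    (h : ∀ k : ℕ, ∫⁻ x, ENNReal.ofReal (x ^ k) ∂μ = ∫⁻ x, ENNReal.ofReal (x ^ k) ∂ν)
    (p : Polynomial ℝ) : ∫ x, p.eval x ∂μ = ∫ x, p.eval x ∂ν := by
  have hi : ∀ (ρ : Measure ℝ) [IsFiniteMeasure ρ], (∀ᵐ x ∂ρ, x ∈ Set.Icc (0 : ℝ) 1) →
      ∀ k : ℕ, Integrable (fun x => x ^ k) ρ := by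
    intro ρ _ hρ k
    refine Integrable.of_bound (by fun_prop) 1 ?_
    filter_upwards [hρ] with x hx
    rw [Real.norm_of_nonneg (pow_nonneg hx.1 k)]
    exact pow_le_one₀ hx.1 hx.2
  have hm : ∀ k : ℕ, ∫ x, x ^ k ∂μ = ∫ x, x ^ k ∂ν := by
    intro k
    rw [integral_eq_lintegral_of_nonneg_ae (hμ.mono fun x hx => pow_nonneg hx.1 k)
      (by fun_prop), integral_eq_lintegral_of_nonneg_ae (hν.mono fun x hx => pow_nonneg hx.1 k)
      (by fun_prop), h]
  simp_rw [Polynomial.eval_eq_sum_range]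
  rw [integral_finsetSum _ fun k _ => (hi μ hμ k).const_mul _,
    integral_finsetSum _ fun k _ => (hi ν hν k).const_mul _]
  refine Finset.sum_congr rfl fun k _ => ?_
  rw [integral_const_mul, integral_const_mul, hm]

/-- Weierstrass approximation: equal moments give equal integrals of polynomials, hence of
continuous functions. -/
theorem measure_eq_of_moments {μ ν : Measure ℝ} [IsFiniteMeasure μ] [IsFiniteMeasure ν]
    (hμ : ∀ᵐ x ∂μ, x ∈ Set.Icc (0 : ℝ) 1) (hν : ∀ᵐ x ∂ν, x ∈ Set.Icc (0 : ℝ) 1)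
    (h : ∀ k : ℕ, ∫⁻ x, ENNReal.ofReal (x ^ k) ∂μ = ∫⁻ x, ENNReal.ofReal (x ^ k) ∂ν) : μ = ν := by
  refine ext_of_forall_integral_eq_of_IsFiniteMeasure fun f => ?_
  have key : ∀ (p : Polynomial ℝ) (ε : ℝ), (∀ x ∈ Set.Icc (0 : ℝ) 1, |p.eval x - f x| < ε) →
      ∀ (ρ : Measure ℝ) [IsFiniteMeasure ρ], (∀ᵐ x ∂ρ, x ∈ Set.Icc (0 : ℝ) 1) →
      |∫ x, p.eval x ∂ρ - ∫ x, f x ∂ρ| ≤ ε * ρ.real Set.univ := by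
    intro p ε hp ρ _ hρ
    obtain ⟨C, hC⟩ := isCompact_Icc.exists_bound_of_continuousOn
      (p.continuous.continuousOn (s := Set.Icc (0 : ℝ) 1))
    have hpi : Integrable (fun x => p.eval x) ρ :=
      Integrable.of_bound p.continuous.aestronglyMeasurable C (hρ.mono hC)
    rw [← integral_sub hpi (f.integrable ρ), ← Real.norm_eq_abs]
    exact norm_integral_le_of_norm_le_const (hρ.mono fun x hx => (hp x hx).le)
  have hle : ∀ ε : ℝ, 0 < ε →
      |∫ x, f x ∂μ - ∫ x, f x ∂ν| ≤ ε * (μ.real Set.univ + ν.real Set.univ) := by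
    intro ε hε
    obtain ⟨p, hp⟩ := exists_polynomial_near_of_continuousOn 0 1 f f.continuous.continuousOn ε hε
    have h1 := key p ε hp μ hμ
    have h2 := key p ε hp ν hν
    rw [integral_eval_eq_of_moments hμ hν h p] at h1
    rw [abs_sub_comm] at h1
    have := abs_sub_le (∫ x, f x ∂μ) (∫ x, p.eval x ∂ν) (∫ x, f x ∂ν)
    linarith
  set M := μ.real Set.univ + ν.real Set.univ
  have hM : 0 ≤ M := by positivity
  have hz : |∫ x, f x ∂μ - ∫ x, f x ∂ν| ≤ 0 := by
    refine le_of_forall_pos_le_add fun δ hδ => ?_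
    refine (hle (δ / (M + 1)) (by positivity)).trans ?_
    rw [zero_add, div_mul_eq_mul_div, div_le_iff₀ (by positivity)]
    nlinarith
  exact sub_eq_zero.1 (abs_nonpos_iff.1 hz)

end MomentDeterminacy

/-! ### The law of the overlap ratio -/

section OverlapLaw

variable {n : ℕ}

theorem overlapRatio_nonneg (v : Fin (n + 1) → ℂ) : 0 ≤ overlapRatio v := by
  unfold overlapRatio
  positivity

theorem overlapRatio_le_one (v : Fin (n + 1) → ℂ) : overlapRatio v ≤ 1 :=
  div_le_one_of_le₀ (pow_le_pow_left₀ (norm_nonneg _) (norm_dotProduct_self_le v) 2) (sq_nonneg _)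

theorem continuous_overlapRatio_cons :
    Continuous fun w : Fin n → ℂ => overlapRatio (Fin.cons 1 w : Fin (n + 1) → ℂ) := by
  have hcons1 : Continuous fun w : Fin n → ℂ => (Fin.cons 1 w : Fin (n + 1) → ℂ) := by fun_prop
  unfold overlapRatio
  exact ((continuous_dotProduct_self.comp hcons1).norm.pow 2).div
    ((continuous_vecNormSq.comp hcons1).pow 2) fun w => pow_ne_zero 2 (vecNormSq_cons_pos w).ne'

theorem lintegral_rpow_mul_pow (hn : 1 ≤ n) (k : ℕ) {c : ℝ} (hc : 0 ≤ c) :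
    ∫⁻ x in Set.Ioo (0 : ℝ) 1, ENNReal.ofReal (c * (n / 2) * x ^ ((n : ℝ) / 2 - 1))
        * ENNReal.ofReal (x ^ k) = ENNReal.ofReal (c * (n / (n + 2 * k))) := by
  have hn' : (0 : ℝ) < n := by exact_mod_cast hn
  have hk : (0 : ℝ) ≤ k := by positivity
  have h1 : ∀ x ∈ Set.Ioo (0 : ℝ) 1, ENNReal.ofReal (c * (n / 2) * x ^ ((n : ℝ) / 2 - 1))
        * ENNReal.ofReal (x ^ k) = ENNReal.ofReal (c * (n / 2) * x ^ ((n : ℝ) / 2 - 1 + k)) := by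
    intro x hx
    have hx0 : 0 < x := hx.1
    rw [← ENNReal.ofReal_mul (by positivity), mul_assoc, Real.rpow_add_natCast hx0.ne']
  have hr : -1 < (n : ℝ) / 2 - 1 + k := by linarith
  have hint : IntervalIntegrable (fun x : ℝ => x ^ ((n : ℝ) / 2 - 1 + k)) volume 0 1 :=
    intervalIntegral.intervalIntegrable_rpow' hr
  rw [setLIntegral_congr_fun measurableSet_Ioo h1, ← ofReal_integral_eq_lintegral_ofReal]
  · rw [integral_const_mul, ← integral_Ioc_eq_integral_Ioo,
      ← intervalIntegral.integral_of_le zero_le_one, integral_rpow (Or.inl hr), Real.one_rpow,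
      Real.zero_rpow (by linarith)]
    congr 1
    rw [show (n : ℝ) / 2 - 1 + k + 1 = (n + 2 * k) / 2 by ring]
    have : (n : ℝ) + 2 * k ≠ 0 := by positivity
    field_simp
    ring
  · exact (((intervalIntegrable_iff_integrableOn_Ioo_of_le zero_le_one).1 hint).const_mul _)
  · filter_upwards [ae_restrict_mem measurableSet_Ioo] with x hx
    have hx0 : 0 < x := hx.1
    positivity

/-- The law of 1 - q and the density x^(n/2 - 1) have the same moments on [0, 1], hence coincide;
reflecting x ↦ 1 - q gives the law of q. -/
theorem lintegral_overlapRatio (hn : 1 ≤ n) {φ : ℝ → ℝ≥0∞} (hφ : Measurable φ) :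
    ∫⁻ w : Fin n → ℂ, ENNReal.ofReal ((vecNormSq (Fin.cons 1 w : Fin (n + 1) → ℂ) ^ (n + 1))⁻¹)
        * φ (overlapRatio (Fin.cons 1 w : Fin (n + 1) → ℂ))
      = ∫⁻ q in Set.Ioo (0 : ℝ) 1, ENNReal.ofReal
          (Real.pi ^ n / n.factorial * (n / 2) * (1 - q) ^ ((n : ℝ) / 2 - 1)) * φ q := by
  have hcons1 : Continuous fun w : Fin n → ℂ => (Fin.cons 1 w : Fin (n + 1) → ℂ) := by fun_prop
  have hd : Measurable fun w : Fin n → ℂ =>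
      ENNReal.ofReal ((vecNormSq (Fin.cons 1 w : Fin (n + 1) → ℂ) ^ (n + 1))⁻¹) :=
    ENNReal.measurable_ofReal.comp (((continuous_vecNormSq.comp hcons1).pow (n + 1)).measurable.inv)
  have hT : Measurable fun w : Fin n → ℂ => 1 - overlapRatio (Fin.cons 1 w : Fin (n + 1) → ℂ) :=
    (continuous_const.sub continuous_overlapRatio_cons).measurable
  have hg : Measurable fun x : ℝ => ENNReal.ofReal
      (Real.pi ^ n / n.factorial * (n / 2) * x ^ ((n : ℝ) / 2 - 1)) := by fun_prop
  set μ : Measure ℝ := (volume.withDensity fun w : Fin n → ℂ =>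
      ENNReal.ofReal ((vecNormSq (Fin.cons 1 w : Fin (n + 1) → ℂ) ^ (n + 1))⁻¹)).map
    fun w => 1 - overlapRatio (Fin.cons 1 w : Fin (n + 1) → ℂ) with hμd
  set ν : Measure ℝ := (volume.restrict (Set.Ioo (0 : ℝ) 1)).withDensity fun x => ENNReal.ofReal
      (Real.pi ^ n / n.factorial * (n / 2) * x ^ ((n : ℝ) / 2 - 1)) with hνd
  have hμl : ∀ {ψ : ℝ → ℝ≥0∞}, Measurable ψ → ∫⁻ x, ψ x ∂μ = ∫⁻ w : Fin n → ℂ,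
      ENNReal.ofReal ((vecNormSq (Fin.cons 1 w : Fin (n + 1) → ℂ) ^ (n + 1))⁻¹)
        * ψ (1 - overlapRatio (Fin.cons 1 w : Fin (n + 1) → ℂ)) := by
    intro ψ hψ
    rw [hμd, lintegral_map hψ hT]
    exact lintegral_withDensity_eq_lintegral_mul _ hd (hψ.comp hT)
  have hνl : ∀ {ψ : ℝ → ℝ≥0∞}, Measurable ψ → ∫⁻ x, ψ x ∂ν = ∫⁻ x in Set.Ioo (0 : ℝ) 1,
      ENNReal.ofReal (Real.pi ^ n / n.factorial * (n / 2) * x ^ ((n : ℝ) / 2 - 1)) * ψ x := by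
    intro ψ hψ
    exact lintegral_withDensity_eq_lintegral_mul _ hg hψ
  have hpow : ∀ k : ℕ, Measurable fun x : ℝ => ENNReal.ofReal (x ^ k) := fun k => by fun_prop
  have hμm : ∀ k : ℕ, ∫⁻ x, ENNReal.ofReal (x ^ k) ∂μ
      = ENNReal.ofReal (Real.pi ^ n / n.factorial * (n / (n + 2 * k))) := by
    intro k
    rw [hμl (hpow k), ← lintegral_one_sub_overlapRatio_pow hn]
    refine lintegral_congr fun w => ?_
    rw [ENNReal.ofReal_mul (by have := vecNormSq_cons_pos w; positivity)]
  have hνm : ∀ k : ℕ, ∫⁻ x, ENNReal.ofReal (x ^ k) ∂ν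
      = ENNReal.ofReal (Real.pi ^ n / n.factorial * (n / (n + 2 * k))) := by
    intro k
    rw [hνl (hpow k), lintegral_rpow_mul_pow hn k (by positivity)]
  have hfμ : IsFiniteMeasure μ := ⟨by
    have := hμm 0
    simp only [pow_zero, ENNReal.ofReal_one, lintegral_one] at this
    rw [this]
    exact ENNReal.ofReal_lt_top⟩
  have hfν : IsFiniteMeasure ν := ⟨by
    have := hνm 0
    simp only [pow_zero, ENNReal.ofReal_one, lintegral_one] at this
    rw [this]
    exact ENNReal.ofReal_lt_top⟩
  have heq : μ = ν := by
    refine measure_eq_of_moments ?_ ?_ fun k => (hμm k).trans (hνm k).symm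
    · refine (ae_map_iff (p := fun x => x ∈ Set.Icc (0 : ℝ) 1) hT.aemeasurable
        (measurableSet_Icc (a := (0 : ℝ)) (b := 1))).2 ?_
      exact Eventually.of_forall fun w => ⟨sub_nonneg.2 (overlapRatio_le_one _),
        sub_le_self _ (overlapRatio_nonneg _)⟩
    · refine (withDensity_absolutelyContinuous _ _).ae_le ?_
      filter_upwards [ae_restrict_mem measurableSet_Ioo] with x hx
      exact Set.Ioo_subset_Icc_self hx
  have hψ : Measurable fun x : ℝ => φ (1 - x) := hφ.comp (by fun_prop)
  have h1 := hμl hψ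
  rw [heq, hνl hψ] at h1
  simp only [sub_sub_cancel] at h1
  rw [← h1]
  have h2 := (Measure.measurePreserving_sub_left (volume : Measure ℝ) 1).setLIntegral_comp_preimage_emb
    (MeasurableEquiv.subLeft (1 : ℝ)).measurableEmbedding
    (fun x => ENNReal.ofReal (Real.pi ^ n / n.factorial * (n / 2) * x ^ ((n : ℝ) / 2 - 1))
      * φ (1 - x)) (Set.Ioo 0 1)
  rw [← h2]
  simp only [sub_sub_cancel]
  congr 2
  ext x
  simp only [Set.mem_preimage, Set.mem_Ioo]
  constructor <;> rintro ⟨a, b⟩ <;> constructor <;> linarith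

end OverlapLaw

/-! ### The joint law of the scaled eigenvalue and overlap -/

section ScaledLaw

variable {n : ℕ} {τ : ℝ}

@[fun_prop]
theorem continuous_expPoly (m : ℕ) : Continuous (expPoly m) := by
  unfold expPoly
  fun_prop

theorem measurable_radialDensity (n : ℕ) (τ : ℝ) {α : Type*} [MeasurableSpace α] {f : α → ℝ}
    {g : α → ℂ} (hf : Measurable f) (hg : Measurable g) :
    Measurable fun x => radialDensity n τ (f x) (g x) := by
  have h1 : Measurable fun x => (g x ^ 2).re := Complex.measurable_re.comp (by fun_prop)
  have h2 : ∀ m, Measurable fun x => expPoly m (‖g x‖ ^ 2) := fun m =>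
    (continuous_expPoly m).measurable.comp (by fun_prop)
  have h3 : Measurable fun x => meanDistSq τ (f x) (g x) := by
    unfold meanDistSq
    have : Measurable fun x => ((τ * (1 - f x) / (1 - τ ^ 2 * f x) : ℝ) : ℂ) :=
      Complex.measurable_ofReal.comp (by fun_prop)
    have h4 : Measurable fun x => star (g x) := continuous_star.measurable.comp hg
    fun_prop
  unfold radialDensity jacobianMoment residualVar
  fun_prop

/-- The scaled eigenvalue and overlap as functions of an eigenpair. -/
def scalePair (N : ℕ) (p : ℂ × (Fin N → ℂ)) : ℂ × ℝ :=
  (p.1 / ((√(N : ℝ) : ℝ) : ℂ), (N : ℝ) * ‖p.2 ⬝ᵥ p.2‖ ^ 2)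

theorem measurable_scalePair (N : ℕ) : Measurable (scalePair N) := by
  have : Continuous (scalePair N) := by
    unfold scalePair dotProduct
    fun_prop
  exact this.measurable

theorem norm_dotProduct_chartUnitVec (p : Fin (n + 1) → ℂ) (θ : ℝ) :
    ‖(Complex.exp (Complex.I * θ) • chartUnitVec p) ⬝ᵥ
      (Complex.exp (Complex.I * θ) • chartUnitVec p)‖ ^ 2 = overlapRatio (chartVec p) := by
  have h := chartNormSq_pos p
  have h1 : ‖Complex.exp (Complex.I * θ)‖ = 1 := by
    rw [mul_comm]
    exact Complex.norm_exp_ofReal_mul_I θ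
  have h2 : ‖(((√(chartNormSq p))⁻¹ : ℝ) : ℂ)‖ ^ 2 = (chartNormSq p)⁻¹ := by
    rw [Complex.norm_real, Real.norm_of_nonneg (by positivity), inv_pow, Real.sq_sqrt h.le]
  rw [chartUnitVec, overlapRatio, chartNormSq_eq]
  simp only [smul_dotProduct, dotProduct_smul, smul_eq_mul, norm_mul, h1, one_mul, mul_pow, h2]
  field_simp

/-- The phase does not change |vᵀv|, so the scaled pair is constant in θ and the uniform average is
trivial. -/
theorem chartPhaseLaw_preimage (p : Fin (n + 1) → ℂ) {B : Set (ℂ × ℝ)} (hB : MeasurableSet B) :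
    chartPhaseLaw p (scalePair (n + 1) ⁻¹' B) = B.indicator 1
      (p 0 / ((√((n + 1 : ℕ) : ℝ) : ℝ) : ℂ), ((n + 1 : ℕ) : ℝ) * overlapRatio (chartVec p)) := by
  have hm : Measurable fun θ : ℝ => (p 0, Complex.exp (Complex.I * θ) • chartUnitVec p) := by
    fun_prop
  rw [chartPhaseLaw, Measure.map_apply hm (measurable_scalePair _ hB), ← Set.preimage_comp]
  have h : (scalePair (n + 1) ∘ fun θ : ℝ => (p 0, Complex.exp (Complex.I * θ) • chartUnitVec p))
      = fun _ => (p 0 / ((√((n + 1 : ℕ) : ℝ) : ℝ) : ℂ),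
        ((n + 1 : ℕ) : ℝ) * overlapRatio (chartVec p)) := by
    funext θ
    simp only [Function.comp, scalePair, norm_dotProduct_chartUnitVec]
  rw [h]
  by_cases hp : (p 0 / ((√((n + 1 : ℕ) : ℝ) : ℝ) : ℂ),
        ((n + 1 : ℕ) : ℝ) * overlapRatio (chartVec p)) ∈ B
  · rw [Set.preimage_const_of_mem hp, uniformPhase_univ, Set.indicator_of_mem hp]
    rfl
  · rw [Set.preimage_const_of_notMem hp, measure_empty, Set.indicator_of_notMem hp]

/-- The empirical measure is almost surely the fibre sum, and the matrix density is constant along a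
fibre; the area formula then moves the integral to the chart. -/
theorem eigenpairLaw_apply (hτ0 : 0 < τ) (hτ1 : τ < 1) {S : Set (ℂ × (Fin (n + 1) → ℂ))}
    (hS : MeasurableSet S) :
    eigenpairLaw (n + 1) τ S = ((n + 1 : ℕ) : ℝ≥0∞)⁻¹
      * ∫⁻ P : SplitMatrix n, matrixDensity τ (chartMap P)
        * ENNReal.ofReal (‖(chartJacobian P).det‖ ^ 2) * chartPhaseLaw P.1 S := by
  have mp := measurePreserving_splitInterpolating (n := n) hτ0 hτ1
  have hae : (fun AB => empiricalEigenpairs (interpolatingMatrix (n + 1) τ AB.1 AB.2))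
      =ᵐ[(realGinibre (n + 1)).prod (realGinibre (n + 1))]
        fun AB => fiberEigenpairs (splitInterpolating n τ AB) := by
    have h := mp.quasiMeasurePreserving.ae
      ((withDensity_absolutelyContinuous volume (matrixDensity (n := n) τ)).ae_le
        ae_empiricalEigenpairs_eq)
    filter_upwards [h] with AB hAB
    rw [← joinColumns_splitInterpolating, hAB]
  have hms : Measurable fun AB => fiberEigenpairs (splitInterpolating n τ AB) :=
    measurable_fiberEigenpairs.comp mp.measurable
  have hmf : Measurable fun Y : SplitMatrix n => fiberEigenpairs Y S :=
    (Measure.measurable_coe hS).comp measurable_fiberEigenpairs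
  rw [eigenpairLaw, Measure.smul_apply, smul_eq_mul, Measure.bind_apply hS ⟨_, hms, hae⟩]
  congr 1
  have h1 : ∫⁻ AB, empiricalEigenpairs (interpolatingMatrix (n + 1) τ AB.1 AB.2) S
        ∂((realGinibre (n + 1)).prod (realGinibre (n + 1)))
      = ∫⁻ AB, fiberEigenpairs (splitInterpolating n τ AB) S
        ∂((realGinibre (n + 1)).prod (realGinibre (n + 1))) :=
    lintegral_congr_ae (hae.mono fun AB h => by simp only [h])
  rw [h1, mp.lintegral_comp hmf]
  refine (lintegral_withDensity_eq_lintegral_mul _ (measurable_matrixDensity τ) hmf).trans ?_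
  have hg : Measurable fun P : SplitMatrix n =>
      matrixDensity τ (chartMap P) * chartPhaseLaw P.1 S :=
    ((measurable_matrixDensity τ).comp contDiff_chartMap.continuous.measurable).mul
      (measurable_chartPhaseLaw_apply hS)
  have h2 := (measurable_tsum_fiber_and_lintegral volume (hasStrictFDerivAt_chartMap (n := n))
    continuous_chartDeriv hg).2
  calc _ = ∫⁻ Y : SplitMatrix n, ∑' P : {P // chartMap P = Y ∧ (chartDeriv P).det ≠ 0},
        matrixDensity τ (chartMap P.1) * chartPhaseLaw P.1.1 S := by
        refine lintegral_congr fun Y => ?_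
        rw [Pi.mul_apply, fiberEigenpairs, Measure.sum_apply _ hS, ← ENNReal.tsum_mul_left]
        refine tsum_congr fun P => ?_
        rw [P.2.1]
    _ = _ := h2
    _ = _ := by
        refine lintegral_congr fun P => ?_
        rw [det_chartDeriv, abs_of_nonneg (by positivity)]
        ring

theorem measurable_chartDensity_mul {B : Set (ℂ × ℝ)} (hB : MeasurableSet B) :
    Measurable fun p : Fin (n + 1) → ℂ => ENNReal.ofReal ((vecNormSq (chartVec p) ^ (n + 1))⁻¹
      * radialDensity n τ (overlapRatio (chartVec p)) (p 0))
      * B.indicator (1 : ℂ × ℝ → ℝ≥0∞) (p 0 / ((√((n + 1 : ℕ) : ℝ) : ℝ) : ℂ),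
        ((n + 1 : ℕ) : ℝ) * overlapRatio (chartVec p)) := by
  have c0 := continuous_chartVec (n := n)
  have c1 : Measurable fun p : Fin (n + 1) → ℂ => overlapRatio (chartVec p) := by
    unfold overlapRatio
    exact ((continuous_dotProduct_self.comp c0).norm.pow 2).measurable.div
      ((continuous_vecNormSq.comp c0).pow 2).measurable
  have c2 : Measurable fun p : Fin (n + 1) → ℂ =>
      radialDensity n τ (overlapRatio (chartVec p)) (p 0) :=
    measurable_radialDensity n τ c1 (measurable_pi_apply 0)
  have c3 : Measurable fun p : Fin (n + 1) → ℂ => (vecNormSq (chartVec p) ^ (n + 1))⁻¹ :=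
    ((continuous_vecNormSq.comp c0).pow (n + 1)).measurable.inv
  have c4 : Measurable fun p : Fin (n + 1) → ℂ => (p 0 / ((√((n + 1 : ℕ) : ℝ) : ℝ) : ℂ),
        ((n + 1 : ℕ) : ℝ) * overlapRatio (chartVec p)) := by fun_prop
  have c5 : Measurable fun p : Fin (n + 1) → ℂ => (vecNormSq (chartVec p) ^ (n + 1))⁻¹
      * radialDensity n τ (overlapRatio (chartVec p)) (p 0) := c3.fun_mul c2
  have c6 : Measurable (B.indicator (1 : ℂ × ℝ → ℝ≥0∞)) := measurable_one.indicator hB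
  exact (c5.ennreal_ofReal).fun_mul (c6.comp c4)

/-- Integrating first over the remaining columns and then over w leaves z and q, the latter
distributed by the overlap law. -/
theorem scaledLaw_apply (hτ0 : 0 < τ) (hτ1 : τ < 1) (hn : 1 ≤ n) {B : Set (ℂ × ℝ)}
    (hB : MeasurableSet B) :
    scaledLaw (n + 1) τ B = ((n + 1 : ℕ) : ℝ≥0∞)⁻¹ * ∫⁻ z : ℂ, ∫⁻ q in Set.Ioo (0 : ℝ) 1,
      ENNReal.ofReal (Real.pi ^ n / n.factorial * (n / 2) * (1 - q) ^ ((n : ℝ) / 2 - 1))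
        * (ENNReal.ofReal (radialDensity n τ q z)
        * B.indicator 1 (z / ((√((n + 1 : ℕ) : ℝ) : ℝ) : ℂ), ((n + 1 : ℕ) : ℝ) * q)) := by
  have hS := measurable_scalePair (n + 1) hB
  have h0 : scaledLaw (n + 1) τ B = eigenpairLaw (n + 1) τ (scalePair (n + 1) ⁻¹' B) :=
    Measure.map_apply (measurable_scalePair (n + 1)) hB
  rw [h0, eigenpairLaw_apply hτ0 hτ1 hS]
  congr 1
  have hJ : Measurable fun P : SplitMatrix n => ENNReal.ofReal (‖(chartJacobian P).det‖ ^ 2) := by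
    have h : (fun P : SplitMatrix n => ENNReal.ofReal (‖(chartJacobian P).det‖ ^ 2))
        = fun P : SplitMatrix n => ENNReal.ofReal (chartDeriv P).det := by
      funext P
      rw [det_chartDeriv]
    rw [h]
    exact ENNReal.measurable_ofReal.comp
      (ContinuousLinearMap.continuous_det.comp continuous_chartDeriv).measurable
  have hind : Measurable fun x : ℂ × ℝ => B.indicator (1 : ℂ × ℝ → ℝ≥0∞) x :=
    measurable_one.indicator hB
  have hD : Measurable fun P : SplitMatrix n => matrixDensity τ (chartMap P) :=
    (measurable_matrixDensity τ).comp contDiff_chartMap.continuous.measurable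
  let G : (Fin (n + 1) → ℂ) → ℝ≥0∞ := fun p =>
    ENNReal.ofReal ((vecNormSq (chartVec p) ^ (n + 1))⁻¹
      * radialDensity n τ (overlapRatio (chartVec p)) (p 0))
      * B.indicator 1 (p 0 / ((√((n + 1 : ℕ) : ℝ) : ℝ) : ℂ),
        ((n + 1 : ℕ) : ℝ) * overlapRatio (chartVec p))
  have h1 : ∫⁻ P : SplitMatrix n, matrixDensity τ (chartMap P)
        * ENNReal.ofReal (‖(chartJacobian P).det‖ ^ 2)
        * chartPhaseLaw P.1 (scalePair (n + 1) ⁻¹' B) = ∫⁻ p, G p := by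
    rw [Measure.volume_eq_prod, lintegral_prod (fun P : SplitMatrix n =>
      matrixDensity τ (chartMap P) * ENNReal.ofReal (‖(chartJacobian P).det‖ ^ 2)
        * chartPhaseLaw P.1 (scalePair (n + 1) ⁻¹' B)) ((hD.mul hJ).mul (measurable_chartPhaseLaw_apply hS)).aemeasurable]
    refine lintegral_congr fun p => ?_
    simp only [chartPhaseLaw_preimage p hB]
    rw [lintegral_mul_const, lintegral_matrixDensity_chartMap hτ0 hτ1 hn]
    exact (hD.comp measurable_prodMk_left).mul (hJ.comp measurable_prodMk_left)
  have hG : Measurable G := measurable_chartDensity_mul hB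
  rw [h1]
  have e1 := (volume_preserving_piFinSuccAbove (fun _ : Fin (n + 1) => ℂ) 0).symm.lintegral_comp hG
  rw [← e1, Measure.volume_eq_prod, lintegral_prod (fun x =>
    G ((MeasurableEquiv.piFinSuccAbove (fun _ : Fin (n + 1) => ℂ) 0).symm x)) (hG.comp
    (MeasurableEquiv.piFinSuccAbove (fun _ : Fin (n + 1) => ℂ) 0).symm.measurable).aemeasurable]
  refine lintegral_congr fun z => ?_
  have hφ : Measurable fun q : ℝ => ENNReal.ofReal (radialDensity n τ q z)
      * B.indicator (1 : ℂ × ℝ → ℝ≥0∞)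
        (z / ((√((n + 1 : ℕ) : ℝ) : ℝ) : ℂ), ((n + 1 : ℕ) : ℝ) * q) := by
    refine (ENNReal.measurable_ofReal.comp (measurable_radialDensity n τ
      measurable_id measurable_const)).mul (hind.comp ?_)
    fun_prop
  rw [← lintegral_overlapRatio hn hφ]
  refine lintegral_congr fun w => ?_
  have e2 : (MeasurableEquiv.piFinSuccAbove (fun _ : Fin (n + 1) => ℂ) 0).symm (z, w)
      = Fin.cons z w := by
    simp [MeasurableEquiv.piFinSuccAbove]
    rfl
  have e3 : chartVec (Fin.cons z w : Fin (n + 1) → ℂ) = Fin.cons 1 w := by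
    rw [chartVec, Fin.tail_cons]
  have hv := vecNormSq_cons_pos w
  simp only [G]
  rw [e2, e3, Fin.cons_zero, ENNReal.ofReal_mul (by positivity), mul_assoc]

/-- The joint density of the scaled eigenvalue and overlap. -/
def scaledDensity (n : ℕ) (τ : ℝ) (x : ℂ × ℝ) : ℝ :=
  ((n + 1 : ℕ) : ℝ)⁻¹ * (Real.pi ^ n / n.factorial * (n / 2)
    * (1 - x.2 / (n + 1 : ℕ)) ^ ((n : ℝ) / 2 - 1)
    * radialDensity n τ (x.2 / (n + 1 : ℕ)) (((√((n + 1 : ℕ) : ℝ) : ℝ) : ℂ) * x.1))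

theorem measurable_scaledDensity (n : ℕ) (τ : ℝ) : Measurable (scaledDensity n τ) := by
  have h : Measurable fun x : ℂ × ℝ => radialDensity n τ (x.2 / (n + 1 : ℕ))
      (((√((n + 1 : ℕ) : ℝ) : ℝ) : ℂ) * x.1) :=
    measurable_radialDensity n τ (by fun_prop) (by fun_prop)
  have h2 : Measurable fun x : ℂ × ℝ => (1 - x.2 / (n + 1 : ℕ)) ^ ((n : ℝ) / 2 - 1) := by fun_prop
  exact ((h2.const_mul (Real.pi ^ n / n.factorial * (n / 2))).fun_mul h).const_mul
    (((n + 1 : ℕ) : ℝ)⁻¹)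

theorem lintegral_comp_div_real {c : ℝ} (hc : 0 < c) (f : ℂ → ℝ≥0∞) :
    ∫⁻ z, f z = ENNReal.ofReal (c ^ 2) * ∫⁻ z, f ((c : ℂ) * z) := by
  have hmap := Measure.map_addHaar_smul (volume : Measure ℂ) hc.ne'
  have he : MeasurableEmbedding fun z : ℂ => c • z :=
    (Homeomorph.smulOfNeZero c hc.ne').measurableEmbedding
  rw [Complex.finrank_real_complex, abs_of_pos (by positivity)] at hmap
  have h1 : ∫⁻ z, f (c • z) = ENNReal.ofReal (c ^ 2)⁻¹ * ∫⁻ z, f z := by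
    rw [← smul_eq_mul, ← lintegral_smul_measure, ← hmap]
    exact (he.lintegral_map f).symm
  simp only [Complex.real_smul] at h1
  rw [h1, ← mul_assoc, ← ENNReal.ofReal_mul (by positivity), mul_inv_cancel₀ (by positivity),
    ENNReal.ofReal_one, one_mul]

theorem setLIntegral_Ioo_comp_div {c : ℝ} (hc : 0 < c) (f : ℝ → ℝ≥0∞) :
    ∫⁻ q in Set.Ioo (0 : ℝ) 1, f q = ENNReal.ofReal c⁻¹ * ∫⁻ u in Set.Ioo 0 c, f (u / c) := by
  have hmap := Measure.map_addHaar_smul (volume : Measure ℝ) (inv_pos.2 hc).ne'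
  rw [Module.finrank_self, pow_one, inv_inv, abs_of_pos hc] at hmap
  have he : MeasurableEmbedding fun u : ℝ => c⁻¹ • u :=
    (Homeomorph.smulOfNeZero c⁻¹ (inv_pos.2 hc).ne').measurableEmbedding
  have h1 : ∫⁻ u in Set.Ioo 0 c, f (u / c) = ENNReal.ofReal c * ∫⁻ q in Set.Ioo (0 : ℝ) 1, f q := by
    rw [← smul_eq_mul, ← lintegral_smul_measure, ← Measure.restrict_smul, ← hmap,
      he.restrict_map, he.lintegral_map]
    have : (fun u : ℝ => c⁻¹ • u) ⁻¹' Set.Ioo 0 1 = Set.Ioo 0 c := by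
      ext u
      simp only [Set.mem_preimage, smul_eq_mul, Set.mem_Ioo, inv_mul_lt_iff₀ hc, mul_one]
      refine and_congr_left fun _ => ?_
      rw [mul_pos_iff_of_pos_left (inv_pos.2 hc)]
    rw [this]
    refine lintegral_congr fun u => ?_
    rw [smul_eq_mul, div_eq_inv_mul]
  rw [h1, ← mul_assoc, ← ENNReal.ofReal_mul (by positivity), inv_mul_cancel₀ hc.ne',
    ENNReal.ofReal_one, one_mul]

/-- The rescaling of z has Jacobian N, which cancels the normalization 1/N; that of q contributes
the factor N⁻¹ of `scaledDensity`. Passing from the open to the half-open interval costs a null set.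
-/
theorem scaledLaw_eq_withDensity (hτ0 : 0 < τ) (hτ1 : τ < 1) (hn : 1 ≤ n) :
    scaledLaw (n + 1) τ = (volume.restrict (Set.univ ×ˢ Set.Ico 0 ((n + 1 : ℕ) : ℝ))).withDensity
      fun x => ENNReal.ofReal (scaledDensity n τ x) := by
  have hN : (0 : ℝ) < (n + 1 : ℕ) := by positivity
  ext B hB
  have hind : Measurable fun x : ℂ × ℝ => B.indicator (1 : ℂ × ℝ → ℝ≥0∞) x :=
    measurable_one.indicator hB
  have hd : Measurable fun x : ℂ × ℝ => ENNReal.ofReal (scaledDensity n τ x) :=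
    ENNReal.measurable_ofReal.comp (measurable_scaledDensity n τ)
  have h1 : (fun x : ℂ × ℝ => B.indicator (fun x => ENNReal.ofReal (scaledDensity n τ x)) x)
      = fun x => ENNReal.ofReal (scaledDensity n τ x) * B.indicator 1 x := by
    funext x
    by_cases hx : x ∈ B <;> simp [hx]
  have hsq : √((n + 1 : ℕ) : ℝ) ^ 2 = (n + 1 : ℕ) := Real.sq_sqrt hN.le
  have hs : 0 < √((n + 1 : ℕ) : ℝ) := Real.sqrt_pos.2 hN
  rw [withDensity_apply _ hB, ← lintegral_indicator hB, h1, Measure.volume_eq_prod,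
    ← Measure.prod_restrict, Measure.restrict_univ, lintegral_prod
    (fun x => ENNReal.ofReal (scaledDensity n τ x) * B.indicator 1 x) (hd.mul hind).aemeasurable,
    scaledLaw_apply hτ0 hτ1 hn hB, lintegral_comp_div_real hs, hsq, ENNReal.ofReal_natCast,
    ← mul_assoc, ENNReal.inv_mul_cancel (by simp) (ENNReal.natCast_ne_top _), one_mul]
  refine lintegral_congr fun z => ?_
  rw [setLIntegral_Ioo_comp_div hN, restrict_Ioo_eq_restrict_Ico,
    ← lintegral_const_mul' _ _ ENNReal.ofReal_ne_top]
  refine setLIntegral_congr_fun measurableSet_Ico fun u hu => ?_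
  have hc : (((√((n + 1 : ℕ) : ℝ) : ℝ) : ℂ)) ≠ 0 := by exact_mod_cast hs.ne'
  have hu1 : 0 ≤ 1 - u / (n + 1 : ℕ) := by
    rw [sub_nonneg, div_le_one hN]
    exact hu.2.le
  rw [mul_div_cancel_left₀ _ hc, mul_div_cancel₀ _ hN.ne', ← mul_assoc, ← mul_assoc,
    ← ENNReal.ofReal_mul (by positivity), ← ENNReal.ofReal_mul (by positivity), scaledDensity]
  congr 2
  ring

end ScaledLaw

/-! ### Continuity of the density below the upper endpoint -/

section Continuity

variable {τ : ℝ}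

theorem continuousOn_scaledDensity (hτ0 : 0 < τ) (hτ1 : τ < 1) (n : ℕ) :
    ContinuousOn (scaledDensity n τ) (Set.univ ×ˢ Set.Ico 0 ((n + 1 : ℕ) : ℝ)) := by
  have hN : (0 : ℝ) < (n + 1 : ℕ) := by positivity
  have hq : ∀ x ∈ (Set.univ : Set ℂ) ×ˢ Set.Ico 0 ((n + 1 : ℕ) : ℝ),
      0 ≤ x.2 / (n + 1 : ℕ) ∧ x.2 / (n + 1 : ℕ) < 1 := by
    rintro ⟨z, u⟩ ⟨-, hu⟩
    exact ⟨div_nonneg hu.1 hN.le, (div_lt_one hN).2 hu.2⟩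
  have hΔ : ∀ x ∈ (Set.univ : Set ℂ) ×ˢ Set.Ico 0 ((n + 1 : ℕ) : ℝ),
      1 - τ ^ 2 * (x.2 / (n + 1 : ℕ)) ≠ 0 := by
    intro x hx
    have := hq x hx
    have h2 : τ ^ 2 < 1 := by nlinarith
    nlinarith [sq_nonneg τ]
  have hΔs : ∀ x ∈ (Set.univ : Set ℂ) ×ˢ Set.Ico 0 ((n + 1 : ℕ) : ℝ),
      (Real.pi * √(1 - τ ^ 2 * (x.2 / (n + 1 : ℕ)))) ^ (n + 1) ≠ 0 := by
    intro x hx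
    have := hq x hx
    have h2 : τ ^ 2 < 1 := by nlinarith
    have h3 : 0 < 1 - τ ^ 2 * (x.2 / (n + 1 : ℕ)) := by nlinarith [sq_nonneg τ]
    have h4 := Real.sqrt_pos.2 h3
    have := Real.pi_pos
    positivity
  have h1 : ContinuousOn (fun x : ℂ × ℝ => (1 - x.2 / (n + 1 : ℕ)) ^ ((n : ℝ) / 2 - 1))
      (Set.univ ×ˢ Set.Ico 0 ((n + 1 : ℕ) : ℝ)) := by
    -- The base is positive because u < N; for n = 1 the exponent is -1/2, so the endpoint u = N
    -- must be excluded.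
    refine ContinuousOn.rpow_const (by fun_prop) fun x hx => Or.inl ?_
    have := hq x hx
    linarith
  have hre : Continuous fun x : ℂ × ℝ => (((((√((n + 1 : ℕ) : ℝ) : ℝ) : ℂ)) * x.1) ^ 2).re :=
    Complex.continuous_re.comp (by fun_prop)
  have hm : ContinuousOn (fun x : ℂ × ℝ => meanDistSq τ (x.2 / (n + 1 : ℕ))
      ((((√((n + 1 : ℕ) : ℝ) : ℝ) : ℂ)) * x.1)) (Set.univ ×ˢ Set.Ico 0 ((n + 1 : ℕ) : ℝ)) := by
    unfold meanDistSq
    have h2 : ContinuousOn (fun x : ℂ × ℝ => τ * (1 - x.2 / (n + 1 : ℕ))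
        / (1 - τ ^ 2 * (x.2 / (n + 1 : ℕ)))) (Set.univ ×ˢ Set.Ico 0 ((n + 1 : ℕ) : ℝ)) :=
      ContinuousOn.div (by fun_prop) (by fun_prop) hΔ
    have h3 := Complex.continuous_ofReal.comp_continuousOn h2
    have h4 : Continuous fun x : ℂ × ℝ => star ((((√((n + 1 : ℕ) : ℝ) : ℝ) : ℂ)) * x.1) :=
      continuous_star.comp (by fun_prop)
    exact ((ContinuousOn.sub (by fun_prop) (h3.mul h4.continuousOn)).norm).pow 2
  have hr : ContinuousOn (fun x : ℂ × ℝ => residualVar τ (x.2 / (n + 1 : ℕ)))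
      (Set.univ ×ˢ Set.Ico 0 ((n + 1 : ℕ) : ℝ)) :=
    ContinuousOn.div (by fun_prop) (by fun_prop) hΔ
  have he : ∀ m, Continuous fun x : ℂ × ℝ =>
      expPoly m (‖(((√((n + 1 : ℕ) : ℝ) : ℝ) : ℂ)) * x.1‖ ^ 2) := fun m =>
    (continuous_expPoly m).comp (by fun_prop)
  have h5 : ContinuousOn (fun x : ℂ × ℝ => -((‖(((√((n + 1 : ℕ) : ℝ) : ℝ) : ℂ)) * x.1‖ ^ 2
      - τ * (x.2 / (n + 1 : ℕ)) * (((((√((n + 1 : ℕ) : ℝ) : ℝ) : ℂ)) * x.1) ^ 2).re)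
      / (1 - τ ^ 2 * (x.2 / (n + 1 : ℕ))))) (Set.univ ×ˢ Set.Ico 0 ((n + 1 : ℕ) : ℝ)) :=
    (ContinuousOn.div (by fun_prop) (by fun_prop) hΔ).neg
  have h6 : ContinuousOn (fun x : ℂ × ℝ =>
      ((Real.pi * √(1 - τ ^ 2 * (x.2 / (n + 1 : ℕ)))) ^ (n + 1))⁻¹)
      (Set.univ ×ˢ Set.Ico 0 ((n + 1 : ℕ) : ℝ)) :=
    ContinuousOn.inv₀ (by fun_prop) hΔs
  unfold scaledDensity radialDensity jacobianMoment
  exact continuousOn_const.mul ((continuousOn_const.mul h1).mul ((h6.mul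
    (Real.continuous_exp.comp_continuousOn h5)).mul
      ((hr.mul ((he _).continuousOn.sub (ContinuousOn.mul (by fun_prop) (he _).continuousOn))).add
        (hm.mul (he _).continuousOn))))

end Continuity

/-! ### Poisson probabilities with mean proportional to n -/

section PoissonTail

/-- Chernoff's bound: every term with k ≥ n grows at least by the factor s^n when x is replaced by s
x. -/
theorem exp_sub_sum_le {x s : ℝ} (hx : 0 ≤ x) (hs : 1 ≤ s) (n : ℕ) :
    Real.exp x - ∑ k ∈ Finset.range n, x ^ k / k.factorial ≤ (s ^ n)⁻¹ * Real.exp (s * x) := by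
  have hsum : ∀ y : ℝ, HasSum (fun k : ℕ => y ^ k / k.factorial) (Real.exp y) := by
    intro y
    rw [Real.exp_eq_exp_ℝ]
    exact NormedSpace.expSeries_div_hasSum_exp y
  have h1 := (hasSum_nat_add_iff' n).mpr (hsum x)
  have h2 := ((hasSum_nat_add_iff' n).mpr (hsum (s * x))).mul_left (s ^ n)⁻¹
  have hs0 : 0 < s := by linarith
  refine (hasSum_le (fun k => ?_) h1 h2).trans ?_
  · rw [mul_pow, pow_add s k n]
    have : 1 ≤ s ^ k := one_le_pow₀ hs
    rw [show (s ^ n)⁻¹ * (s ^ k * s ^ n * x ^ (k + n) / (k + n).factorial)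
      = s ^ k * (x ^ (k + n) / (k + n).factorial) by field_simp]
    exact le_mul_of_one_le_left (by positivity) this
  · refine mul_le_mul_of_nonneg_left ?_ (by positivity)
    exact sub_le_self _ (Finset.sum_nonneg fun k _ => by positivity)

/-- The probability that a Poisson variable of mean `x` is less than `n`. -/
def poissonHead (n : ℕ) (x : ℝ) : ℝ :=
  Real.exp (-x) * ∑ k ∈ Finset.range n, x ^ k / k.factorial

theorem poissonHead_le_one (n : ℕ) {x : ℝ} (hx : 0 ≤ x) : poissonHead n x ≤ 1 := by
  have h := Real.sum_le_exp_of_nonneg hx n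
  rw [poissonHead, Real.exp_neg, inv_mul_le_iff₀ (Real.exp_pos x), mul_one]
  exact h

theorem tendsto_poissonHead {r : ℝ} (hr : 0 ≤ r) (hr1 : r < 1) :
    Tendsto (fun n : ℕ => poissonHead n ((n + 1 : ℕ) * r)) atTop (𝓝 1) := by
  -- This s satisfies r < 1/s < 1. Then log s ≥ 1 - 1/s = (s - 1)/s > (s - 1) r, so the ratio c of
  -- the Chernoff bound is below one.
  set s : ℝ := 2 / (1 + r) with hs
  have hs1 : 1 < s := by
    rw [hs, lt_div_iff₀ (by linarith)]
    linarith
  have hs0 : 0 < s := by linarith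
  have hlog : (s - 1) * r < Real.log s := by
    have h1 := Real.one_sub_inv_le_log_of_pos hs0
    have h2 : r < s⁻¹ := by
      rw [hs, inv_div]
      linarith
    have h3 : 1 - s⁻¹ = (s - 1) * s⁻¹ := by
      field_simp
    have h4 : (s - 1) * r < (s - 1) * s⁻¹ := mul_lt_mul_of_pos_left h2 (by linarith)
    linarith
  set c : ℝ := Real.exp ((s - 1) * r) / s with hc
  have hc0 : 0 ≤ c := by positivity
  have hc1 : c < 1 := by
    rw [hc, div_lt_one hs0]
    calc Real.exp ((s - 1) * r) < Real.exp (Real.log s) := Real.exp_lt_exp.2 hlog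
      _ = s := Real.exp_log hs0
  have hlim : Tendsto (fun n : ℕ => 1 - Real.exp ((s - 1) * r) * c ^ n) atTop (𝓝 1) := by
    have := (tendsto_pow_atTop_nhds_zero_of_lt_one hc0 hc1).const_mul (Real.exp ((s - 1) * r))
    simpa using this.const_sub 1
  refine tendsto_of_tendsto_of_tendsto_of_le_of_le hlim tendsto_const_nhds (fun n => ?_)
    fun n => poissonHead_le_one n (by positivity)
  have hx : (0 : ℝ) ≤ (n + 1 : ℕ) * r := by positivity
  have h := mul_le_mul_of_nonneg_left (exp_sub_sum_le hx hs1.le n)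
    (Real.exp_pos (-((n + 1 : ℕ) * r))).le
  rw [mul_sub, ← Real.exp_add, neg_add_cancel, Real.exp_zero] at h
  have h2 : Real.exp (-((n + 1 : ℕ) * r)) * ((s ^ n)⁻¹ * Real.exp (s * ((n + 1 : ℕ) * r)))
      = Real.exp ((s - 1) * r) * c ^ n := by
    have h3 : Real.exp (-((n + 1 : ℕ) * r)) * Real.exp (s * ((n + 1 : ℕ) * r))
        = Real.exp ((s - 1) * r) * Real.exp ((s - 1) * r) ^ n := by
      rw [← Real.exp_add, ← Real.exp_nat_mul, ← Real.exp_add]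
      congr 1
      push_cast
      ring
    rw [hc, div_pow (Real.exp _), mul_left_comm, h3, div_eq_mul_inv]
    ring
  rw [h2] at h
  simp only [poissonHead]
  linarith

/-- The atom at n is at most the mass outside {0, …, n - 1}, which tends to 0. -/
theorem tendsto_poisson_atom {r : ℝ} (hr : 0 ≤ r) (hr1 : r < 1) :
    Tendsto (fun n : ℕ => Real.exp (-((n + 1 : ℕ) * r)) * (((n + 1 : ℕ) * r) ^ n / n.factorial))
      atTop (𝓝 0) := by
  have h := (tendsto_poissonHead hr hr1).const_sub 1
  rw [sub_self] at h
  refine tendsto_of_tendsto_of_tendsto_of_le_of_le tendsto_const_nhds h (fun n => ?_) fun n => ?_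
  · have hx : (0 : ℝ) ≤ (n + 1 : ℕ) * r := by positivity
    positivity
  · have hx : (0 : ℝ) ≤ (n + 1 : ℕ) * r := by positivity
    have h1 := poissonHead_le_one (n + 1) hx
    rw [poissonHead, Finset.sum_range_succ, mul_add] at h1
    simp only [poissonHead]
    linarith

end PoissonTail

/-! ### The limit of the density -/

section Limit

variable {τ : ℝ}

theorem expPoly_eq_poissonHead (m : ℕ) (x : ℝ) :
    expPoly m x = m.factorial * (Real.exp x * poissonHead (m + 1) x) := by
  rw [poissonHead, ← mul_assoc (Real.exp x), ← Real.exp_add, add_neg_cancel, Real.exp_zero, one_mul, expPoly,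
    Finset.mul_sum]
  exact Finset.sum_congr rfl fun k _ => by ring

theorem expPoly_succ (m : ℕ) (x : ℝ) :
    expPoly (m + 1) x = (m + 1) * expPoly m x + x ^ (m + 1) := by
  rw [expPoly, Finset.sum_range_succ, expPoly, Finset.mul_sum]
  have : ((m + 1).factorial : ℝ) ≠ 0 := by positivity
  rw [div_self this, one_mul]
  congr 1
  refine Finset.sum_congr rfl fun k _ => ?_
  rw [Nat.factorial_succ]
  push_cast
  ring

theorem meanDistSq_mul (q c : ℝ) (z : ℂ) :
    meanDistSq τ q ((c : ℂ) * z) = c ^ 2 * meanDistSq τ q z := by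
  rw [meanDistSq, meanDistSq, star_mul', show star (c : ℂ) = c from Complex.conj_ofReal c,
    mul_left_comm, ← mul_sub, norm_mul, mul_pow, Complex.norm_real, Real.norm_eq_abs, sq_abs]

/-- This form isolates the bounded factors. The term exp(-N|z|²) of the row density cancels the
exponential in `expPoly`, the factorials and powers of π cancel, and the last summand of `expPoly (m
+ 1)` becomes a Poisson atom. -/
theorem scaledDensity_eq (hτ0 : 0 < τ) (hτ1 : τ < 1) {n : ℕ} (hn : 1 ≤ n) (z : ℂ) {u : ℝ}
    (hu : 0 ≤ u) (hu1 : u < (n + 1 : ℕ)) :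
    scaledDensity n τ (z, u) = (2 * Real.pi)⁻¹ * (1 - u / (n + 1 : ℕ)) ^ ((n : ℝ) / 2 - 1)
      * (√(1 - τ ^ 2 * (u / (n + 1 : ℕ))) ^ (n + 1))⁻¹
      * Real.exp ((τ * u * (z ^ 2).re - τ ^ 2 * u * ‖z‖ ^ 2) / (1 - τ ^ 2 * (u / (n + 1 : ℕ))))
      * (poissonHead n ((n + 1 : ℕ) * ‖z‖ ^ 2) * (residualVar τ (u / (n + 1 : ℕ))
          * (n / (n + 1 : ℕ) - ‖z‖ ^ 2) + meanDistSq τ (u / (n + 1 : ℕ)) z)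
        + residualVar τ (u / (n + 1 : ℕ)) * (n / (n + 1 : ℕ))
          * (Real.exp (-((n + 1 : ℕ) * ‖z‖ ^ 2)) * (((n + 1 : ℕ) * ‖z‖ ^ 2) ^ n / n.factorial))) := by
  obtain ⟨m, rfl⟩ : ∃ m, n = m + 1 := ⟨n - 1, by omega⟩
  have hN : (0 : ℝ) < (m + 1 + 1 : ℕ) := by positivity
  have hsq : √((m + 1 + 1 : ℕ) : ℝ) ^ 2 = (m + 1 + 1 : ℕ) := Real.sq_sqrt hN.le
  have hq0 : 0 ≤ u / (m + 1 + 1 : ℕ) := by positivity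
  have hq1 : u / (m + 1 + 1 : ℕ) < 1 := (div_lt_one hN).2 hu1
  have hΔ : 0 < 1 - τ ^ 2 * (u / (m + 1 + 1 : ℕ)) := by
    have h2 : τ ^ 2 < 1 := by nlinarith
    nlinarith [sq_nonneg τ]
  have hnorm : ‖(((√((m + 1 + 1 : ℕ) : ℝ) : ℝ) : ℂ)) * z‖ ^ 2 = (m + 1 + 1 : ℕ) * ‖z‖ ^ 2 := by
    rw [norm_mul, mul_pow, Complex.norm_real, Real.norm_eq_abs, sq_abs, hsq]
  have hre : ((((√((m + 1 + 1 : ℕ) : ℝ) : ℝ) : ℂ) * z) ^ 2).re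
      = (m + 1 + 1 : ℕ) * (z ^ 2).re := by
    rw [mul_pow, ← Complex.ofReal_pow, hsq, Complex.re_ofReal_mul]
  simp only [scaledDensity, radialDensity]
  rw [hnorm, hre, meanDistSq_mul, hsq, jacobianMoment, Nat.add_sub_cancel, expPoly_succ,
    expPoly_eq_poissonHead]
  set N : ℝ := ((m + 1 + 1 : ℕ) : ℝ) with hNd
  set q := u / N with hq
  have huq : u = N * q := by
    rw [hq]
    field_simp
  have hexp : Real.exp (-((N * ‖z‖ ^ 2 - τ * q * (N * (z ^ 2).re)) / (1 - τ ^ 2 * q)))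
      = Real.exp (-(N * ‖z‖ ^ 2)) * Real.exp ((τ * u * (z ^ 2).re - τ ^ 2 * u * ‖z‖ ^ 2)
        / (1 - τ ^ 2 * q)) := by
    rw [← Real.exp_add, huq]
    congr 1
    field_simp
    ring
  have hee : Real.exp (-(N * ‖z‖ ^ 2)) * Real.exp (N * ‖z‖ ^ 2) = 1 := by
    rw [← Real.exp_add, neg_add_cancel, Real.exp_zero]
  have hs : √(1 - τ ^ 2 * q) ≠ 0 := (Real.sqrt_pos.2 hΔ).ne'
  have hpi := Real.pi_ne_zero
  rw [hexp, Nat.factorial_succ]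
  set X := N * ‖z‖ ^ 2 with hX
  have hXN : ‖z‖ ^ 2 = X / N := by
    rw [hX]
    field_simp
  have hmf : (m.factorial : ℝ) ≠ 0 := by positivity
  have hm1 : ((m : ℝ) + 1) ≠ 0 := by positivity
  rw [hXN]
  generalize Real.exp ((τ * u * (z ^ 2).re - τ ^ 2 * u * (X / N)) / (1 - τ ^ 2 * q)) = Y
  generalize poissonHead (m + 1) X = H
  generalize meanDistSq τ q z = c₀
  generalize residualVar τ q = c₁
  generalize √(1 - τ ^ 2 * q) = D at *
  generalize Real.exp (-X) = E at *
  generalize Real.exp X = F at *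
  push_cast
  generalize (1 - q) ^ (((m : ℝ) + 1) / 2 - 1) = R
  have h1 : (N⁻¹ * (Real.pi ^ (m + 1) / ((m + 1) * m.factorial) * ((m + 1) / 2) * R
      * (((Real.pi * D) ^ (m + 1 + 1))⁻¹ * (E * Y) * (c₁ * ((m + 1) * (m.factorial * (F * H))
        + X ^ (m + 1) - X * (m.factorial * (F * H))) + N * c₀ * (m.factorial * (F * H))))))
      = (2 * Real.pi)⁻¹ * R * (D ^ (m + 1 + 1))⁻¹ * Y *
        ((E * F) * H * (c₁ * ((m + 1) / N - X / N) + c₀)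
          + c₁ * ((m + 1) / N) * (E * (X ^ (m + 1) / ((m + 1) * m.factorial)))) := by
    field_simp
    ring
  rw [h1, hee, one_mul]

theorem tendsto_one_sub_div_pow (t : ℝ) :
    Tendsto (fun n : ℕ => (1 - t / (n + 1 : ℕ)) ^ (n + 1)) atTop (𝓝 (Real.exp (-t))) := by
  have h := (Real.tendsto_one_add_div_pow_exp (-t)).comp (tendsto_add_atTop_nat 1)
  refine h.congr fun n => ?_
  simp only [Function.comp, neg_div, ← sub_eq_add_neg]

theorem tendsto_div_succ (t : ℝ) : Tendsto (fun n : ℕ => t / (n + 1 : ℕ)) atTop (𝓝 0) :=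
  (tendsto_const_div_atTop_nhds_zero_nat t).comp (tendsto_add_atTop_nat 1)

theorem tendsto_one_sub_div_rpow {u : ℝ} :
    Tendsto (fun n : ℕ => (1 - u / (n + 1 : ℕ)) ^ ((n : ℝ) / 2 - 1)) atTop
      (𝓝 (Real.exp (-(u / 2)))) := by
  have h0 := (tendsto_div_succ u).const_sub 1
  rw [sub_zero] at h0
  have h1 := (tendsto_one_sub_div_pow u).sqrt
  -- The exponent splits as n/2 - 1 = (n + 1)/2 - 3/2; only the first part contributes to the limit.
  have h2 := h0.rpow_const (p := -(3 / 2)) (Or.inl one_ne_zero)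
  have h3 := h1.mul h2
  rw [Real.one_rpow, mul_one, ← Real.exp_half, neg_div] at h3
  refine h3.congr' ?_
  filter_upwards [h0.eventually (lt_mem_nhds zero_lt_one)] with n hn
  rw [Real.sqrt_eq_rpow, ← Real.rpow_natCast, ← Real.rpow_mul hn.le, ← Real.rpow_add hn]
  congr 1
  push_cast
  ring

theorem sqrt_pow {a : ℝ} (ha : 0 ≤ a) (n : ℕ) : √a ^ n = √(a ^ n) := by
  rw [← Real.sqrt_sq (pow_nonneg (Real.sqrt_nonneg a) n), ← pow_mul, mul_comm, pow_mul,
    Real.sq_sqrt ha]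

/-- From Re(z²) ≤ |z|² < 1, the coefficient is at least 1 - τ² - 2τ(1 - τ)|z|², which exceeds (1 -
τ)². -/
theorem aCoeff_pos (hτ0 : 0 < τ) (hτ1 : τ < 1) {z : ℂ} (hz : ‖z‖ < 1) : 0 < aCoeff τ z := by
  have h1 : (z ^ 2).re ≤ ‖z‖ ^ 2 := (Complex.re_le_norm _).trans (norm_pow z 2).le
  have h2 : ‖z‖ ^ 2 < 1 := by nlinarith [norm_nonneg z]
  rw [aCoeff]
  nlinarith [mul_le_mul_of_nonneg_left h1 hτ0.le, mul_pos hτ0 (sub_pos.2 hτ1),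
    mul_pos (mul_pos hτ0 (sub_pos.2 hτ1)) (sub_pos.2 h2), sq_nonneg (1 - τ)]

theorem tendsto_scaledDensity (hτ0 : 0 < τ) (hτ1 : τ < 1) {z : ℂ} (hz : ‖z‖ < 1) {u : ℝ}
    (hu : 0 ≤ u) :
    Tendsto (fun n : ℕ => scaledDensity n τ (z, u)) atTop
      (𝓝 (aCoeff τ z / (2 * Real.pi) * Real.exp (-(aCoeff τ z * u / 2)))) := by
  have hr0 : 0 ≤ ‖z‖ ^ 2 := by positivity
  have hr1 : ‖z‖ ^ 2 < 1 := by nlinarith [norm_nonneg z]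
  have hq := tendsto_div_succ u
  have hΔ : Tendsto (fun n : ℕ => 1 - τ ^ 2 * (u / (n + 1 : ℕ))) atTop (𝓝 1) := by
    simpa using (hq.const_mul (τ ^ 2)).const_sub 1
  have hΔi' : ∀ c : ℝ, Tendsto (fun n : ℕ => c / (1 - τ ^ 2 * (u / (n + 1 : ℕ)))) atTop (𝓝 c) := by
    intro c
    simpa only [div_eq_mul_inv, inv_one, mul_one] using (hΔ.inv₀ one_ne_zero).const_mul c
  have hΔi : Tendsto (fun n : ℕ => (√(1 - τ ^ 2 * (u / (n + 1 : ℕ))) ^ (n + 1))⁻¹) atTop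
      (𝓝 (Real.exp (τ ^ 2 * u / 2))) := by
    have h := ((tendsto_one_sub_div_pow (τ ^ 2 * u)).sqrt).inv₀ (by positivity)
    rw [← Real.exp_half, ← Real.exp_neg, neg_div, neg_neg] at h
    refine h.congr' ?_
    filter_upwards [hΔ.eventually (lt_mem_nhds zero_lt_one)] with n hn
    rw [sqrt_pow hn.le, mul_div_assoc]
  have hX : Tendsto (fun n : ℕ => Real.exp ((τ * u * (z ^ 2).re - τ ^ 2 * u * ‖z‖ ^ 2)
      / (1 - τ ^ 2 * (u / (n + 1 : ℕ))))) atTop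
      (𝓝 (Real.exp (τ * u * (z ^ 2).re - τ ^ 2 * u * ‖z‖ ^ 2))) := by
    have h := hΔi' (τ * u * (z ^ 2).re - τ ^ 2 * u * ‖z‖ ^ 2)
    exact (Real.continuous_exp.tendsto _).comp h
  have hc₁ : Tendsto (fun n : ℕ => residualVar τ (u / (n + 1 : ℕ))) atTop (𝓝 (1 - τ ^ 2)) :=
    hΔi' (1 - τ ^ 2)
  have hc₀ : Tendsto (fun n : ℕ => meanDistSq τ (u / (n + 1 : ℕ)) z) atTop
      (𝓝 (‖z - (τ : ℂ) * star z‖ ^ 2)) := by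
    have h1 : Tendsto (fun n : ℕ => τ * (1 - u / (n + 1 : ℕ)) / (1 - τ ^ 2 * (u / (n + 1 : ℕ))))
        atTop (𝓝 τ) := by
      have := ((hq.const_sub 1).const_mul τ).mul (hΔ.inv₀ one_ne_zero)
      simpa only [div_eq_mul_inv, inv_one, mul_one, sub_zero] using this
    have h2 := (Complex.continuous_ofReal.tendsto τ).comp h1
    exact (((h2.mul_const (star z)).const_sub z).norm).pow 2
  have hn : Tendsto (fun n : ℕ => (n : ℝ) / (n + 1 : ℕ)) atTop (𝓝 1) := by
    simpa using tendsto_natCast_div_add_atTop (1 : ℝ)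
  have hmain := ((((tendsto_one_sub_div_rpow (u := u)).const_mul (2 * Real.pi)⁻¹).mul hΔi).mul
    hX).mul (((tendsto_poissonHead hr0 hr1).mul ((hc₁.mul (hn.sub_const (‖z‖ ^ 2))).add hc₀)).add
      ((hc₁.mul hn).mul (tendsto_poisson_atom hr0 hr1)))
  have hnorm : ‖z - (τ : ℂ) * star z‖ ^ 2 = ‖z‖ ^ 2 - 2 * τ * (z ^ 2).re + τ ^ 2 * ‖z‖ ^ 2 := by
    rw [← Complex.normSq_eq_norm_sq, ← Complex.normSq_eq_norm_sq, Complex.normSq_apply,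
      Complex.normSq_apply, pow_two, Complex.mul_re]
    simp
    ring
  have hval : (2 * Real.pi)⁻¹ * Real.exp (-(u / 2)) * Real.exp (τ ^ 2 * u / 2)
      * Real.exp (τ * u * (z ^ 2).re - τ ^ 2 * u * ‖z‖ ^ 2)
      * (1 * ((1 - τ ^ 2) * (1 - ‖z‖ ^ 2) + ‖z - (τ : ℂ) * star z‖ ^ 2) + (1 - τ ^ 2) * 1 * 0)
      = aCoeff τ z / (2 * Real.pi) * Real.exp (-(aCoeff τ z * u / 2)) := by
    have he : Real.exp (-(u / 2)) * Real.exp (τ ^ 2 * u / 2)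
        * Real.exp (τ * u * (z ^ 2).re - τ ^ 2 * u * ‖z‖ ^ 2)
        = Real.exp (-(aCoeff τ z * u / 2)) := by
      rw [← Real.exp_add, ← Real.exp_add, aCoeff]
      congr 1
      ring
    have ha : 1 * ((1 - τ ^ 2) * (1 - ‖z‖ ^ 2) + ‖z - (τ : ℂ) * star z‖ ^ 2)
        + (1 - τ ^ 2) * 1 * 0 = aCoeff τ z := by
      rw [hnorm, aCoeff]
      ring
    rw [ha, mul_assoc (2 * Real.pi)⁻¹, mul_assoc (2 * Real.pi)⁻¹, he]
    ring
  rw [hval] at hmain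
  refine hmain.congr' ?_
  have hlarge : ∀ᶠ n : ℕ in atTop, u < (n + 1 : ℕ) :=
    (tendsto_natCast_atTop_atTop.comp (tendsto_add_atTop_nat 1)).eventually_gt_atTop u
  filter_upwards [hlarge, eventually_ge_atTop 1] with n h1 h2
  rw [scaledDensity_eq hτ0 hτ1 h2 z hu h1]

/-- The maximum with 0 secures nonnegativity everywhere, also for u outside [0, N); `ENNReal.ofReal`
does not see it. -/
theorem isScaledJPD_scaledDensity (hτ0 : 0 < τ) (hτ1 : τ < 1) {n : ℕ} (hn : 1 ≤ n) :
    IsScaledJPD (n + 1) τ fun x => max 0 (scaledDensity n τ x) := by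
  refine ⟨continuousOn_const.sup (continuousOn_scaledDensity hτ0 hτ1 n),
    fun x => le_max_left _ _, ?_⟩
  rw [scaledLaw_eq_withDensity hτ0 hτ1 hn]
  congr 1
  funext x
  rw [ENNReal.ofReal_max, ENNReal.ofReal_zero, max_eq_right zero_le]

end Limit

end InterpolatingGinibre

end

/-! ### The main theorem -/

theorem mainTheorem9 (τ : ℝ) (hτ0 : 0 < τ) (hτ1 : τ < 1) :
    ∃ p : ℕ → ℂ × ℝ → ℝ,
      (∀ N : ℕ, 2 ≤ N → InterpolatingGinibre.IsScaledJPD N τ (p N)) ∧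
      ∀ (z : ℂ) (u : ℝ), ‖z‖ < 1 → 0 ≤ u →
        Tendsto (fun N : ℕ => p N (z, u)) atTop
          (𝓝 (InterpolatingGinibre.aCoeff τ z / (2 * Real.pi) *
            Real.exp (-(InterpolatingGinibre.aCoeff τ z * u / 2)))) := by
  refine ⟨fun N x => max 0 (InterpolatingGinibre.scaledDensity (N - 1) τ x), fun N hN => ?_,
    fun z u hz hu => ?_⟩
  · obtain ⟨n, rfl⟩ : ∃ n, N = n + 1 := ⟨N - 1, by omega⟩
    exact InterpolatingGinibre.isScaledJPD_scaledDensity hτ0 hτ1 (by omega)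
  · rw [← tendsto_add_atTop_iff_nat 1]
    have h := (tendsto_const_nhds (x := (0 : ℝ))).max
      (InterpolatingGinibre.tendsto_scaledDensity hτ0 hτ1 hz hu)
    -- The limit is nonnegative by `aCoeff_pos`, so truncation at 0 does not affect it.
    rw [max_eq_right] at h
    · exact h
    · have := InterpolatingGinibre.aCoeff_pos hτ0 hτ1 hz
      positivity
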